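/- Let $d\ge 1$ be an integer and let $b(t)=\dfrac{\sigma_0(\eta(t))}{1+t}$ for $t\ge 0$, where: (A1) $\sigma_0:\mathbb R\to\mathbb R$ is periodic, with period $2T>0$, and Hölder continuous of some order $\alpha>1/2$. Write $m=\frac1{2T}\int_{-T}^{T}\sigma_0(s)\,ds$ for its mean value. (A2) At least one of the following holds: (a) $\sigma_0(x)\ge 0$ for all $x\in\mathbb R$; (b) $0<m<1$. (A3) $\eta\in C^2([0,\infty))$, $\eta(0)\ge 0$, and $\eta'(t)>0$, $\eta''(t)>0$ for all $t\ge 0$. For $t\ge0$ put $\mu(t)=\max_{0\le\tau\le t}\dfrac{1}{(1+\tau)\eta''(\tau)}$. Let $\tilde m_0=\min\{2,m\}$ in case (a) and $\tilde m_0=m$ in case (b) (the two values agree if both hold). Then for every $\varepsilon>0$ and every $\tilde m$ with $0<\tilde m\le\tilde m_0$ there is a constant $C>0$, depending only on $d,\sigma_0,\eta,\varepsilon,\tilde m$, such that every finite-energy solution $u$ of $$\partial_t^2u-\Delta u+b(t)\,\partial_tu=0\quad\text{in }(0,\infty)\times\mathbb R^d,\qquad u(0,\cdot)=u_0,\quad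 \partial_tu(0,\cdot)=u_1,$$ with $u_0\in\dot H^{1-\tilde m/2}(\mathbb R^d)$ satisfies, for all $t\ge 0$, $$E(t)\le C\left(1+\frac{\exp(\varepsilon\mu(t))}{(1+t)^{m-\tilde m}}\right)(1+t)^{-\tilde m}\Big(E(0)+\|u_0\|^2_{\dot H^{1-\tilde m/2}}\Big),\qquad E(t)=\|\nabla u(t,\cdot)\|_{L^2}^2+\|\partial_tu(t,\cdot)\|_{L^2}^2 .$$ Here a finite-energy solution is a (complex-valued) curve $t\mapsto u(t,\cdot)$ of tempered distributions, $t\ge 0$, with $\nabla u,\ \partial_tu\in C([0,\infty);L^2(\mathbb R^d))$, which satisfies the equation in the sense of distributions. The space $\dot H^s(\mathbb R^d)$ consists of the tempered distributions $f$ whose Fourier transform $\hat f(\xi)=\int f(x)e^{-2\pi i x\cdot\xi}\,dx$ is a locally integrable function with $\|f\|_{\dot H^s}:=\|(2\pi|\xi|)^s\hat f\|_{L^2}<\infty$. -/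

import Mathlib

open MeasureTheory Set
open scoped SchwartzMap FourierTransform LineDeriv Laplacian ENNReal NNReal

noncomputable section

namespace DissipativeWave

/-- Complex-valued square-integrable functions on `ℝ^d`. -/
abbrev L2 (d : ℕ) := Lp ℂ 2 (volume : Measure (EuclideanSpace ℝ (Fin d)))

/-- `u` is a finite-energy solution on `[0,∞)` of `u_tt - Δ u + b(t) u_t = 0` in `ℝ^d`:
a curve of tempered distributions with `∇u ∈ C([0,∞); L²)`, `∂_t u ∈ C([0,∞); L²)`, for which the
equation holds for all times `t > 0` in the sense of distributions. The time derivatives are the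
derivatives of the pairings with every Schwartz function (one-sided at `t = 0`). The values for
negative times play no role. -/
structure FiniteEnergySolution (d : ℕ) (b : ℝ → ℝ) where
  /-- the solution -/
  u : ℝ → 𝓢'(EuclideanSpace ℝ (Fin d), ℂ)
  /-- the spatial derivatives `∂_{x_j} u(t)` -/
  grad : ℝ → Fin d → L2 d
  /-- the time derivative `∂_t u(t)` -/
  dt : ℝ → L2 d
  grad_eq : ∀ t, 0 ≤ t → ∀ j : Fin d,
    ∂_{EuclideanSpace.single j (1 : ℝ)} (u t) = Lp.toTemperedDistribution (grad t j)
  dt_eq : ∀ t, 0 ≤ t → ∀ φ : 𝓢(EuclideanSpace ℝ (Fin d), ℂ),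
    HasDerivWithinAt (fun s => u s φ) (Lp.toTemperedDistribution (dt t) φ) (Ici 0) t
  continuousOn_grad : ∀ j : Fin d, ContinuousOn (fun t => grad t j) (Ici 0)
  continuousOn_dt : ContinuousOn dt (Ici 0)
  equation : ∀ t, 0 < t → ∀ φ : 𝓢(EuclideanSpace ℝ (Fin d), ℂ),
    HasDerivAt (fun s => Lp.toTemperedDistribution (dt s) φ)
      ((Δ (u t)) φ - (b t : ℂ) * Lp.toTemperedDistribution (dt t) φ) t

/-- The total energy `E(t) = ‖∇u(t)‖² + ‖∂_t u(t)‖²` (with `L²` norms). -/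
def FiniteEnergySolution.energy {d : ℕ} {b : ℝ → ℝ} (S : FiniteEnergySolution d b) (t : ℝ) : ℝ :=
  ∑ j, ‖S.grad t j‖ ^ 2 + ‖S.dt t‖ ^ 2

/-- The Fourier transform of the tempered distribution `f` is the locally integrable
function `g`. -/
def HasFourierDensity {d : ℕ} (f : 𝓢'(EuclideanSpace ℝ (Fin d), ℂ))
    (g : EuclideanSpace ℝ (Fin d) → ℂ) : Prop :=
  LocallyIntegrable g volume ∧
    ∀ φ : 𝓢(EuclideanSpace ℝ (Fin d), ℂ), Integrable (fun ξ => φ ξ * g ξ) volume ∧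
      (𝓕 f) φ = ∫ ξ, φ ξ * g ξ

/-- The norm of the homogeneous Sobolev space `Ḣ^s(ℝ^d)`, with value `∞` off that space: the `L²`
norm of `(2π|ξ|)^s f̂(ξ)`, where `f̂` has to be a locally integrable function (it is then unique
almost everywhere, so that the infimum is over equal values). With Mathlib's normalization
`f̂(ξ) = ∫ f(x) e^{-2πi x·ξ} dx` this is `‖(-Δ)^{s/2} f‖_{L²}`. -/
def homSobolevENorm {d : ℕ} (s : ℝ) (f : 𝓢'(EuclideanSpace ℝ (Fin d), ℂ)) : ℝ≥0∞ :=
  ⨅ (g : EuclideanSpace ℝ (Fin d) → ℂ) (_ : HasFourierDensity f g),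
    eLpNorm (fun ξ => (((2 * Real.pi * ‖ξ‖) ^ s : ℝ) : ℂ) * g ξ) 2 volume

/-- `f ∈ Ḣ^s(ℝ^d)`. -/
def MemHomSobolev {d : ℕ} (s : ℝ) (f : 𝓢'(EuclideanSpace ℝ (Fin d), ℂ)) : Prop :=
  homSobolevENorm s f < ∞

/-- The norm of `f ∈ Ḣ^s(ℝ^d)` as a real number. -/
def homSobolevNorm {d : ℕ} (s : ℝ) (f : 𝓢'(EuclideanSpace ℝ (Fin d), ℂ)) : ℝ :=
  (homSobolevENorm s f).toReal

/-- The mean value of a function of period `2T`. -/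
def periodMean (T : ℝ) (σ₀ : ℝ → ℝ) : ℝ :=
  1 / (2 * T) * ∫ s in (-T)..T, σ₀ s

/-- The first derivative on `[0,∞)`, one-sided at `0`. -/
def deriv₁ (η : ℝ → ℝ) (t : ℝ) : ℝ := derivWithin η (Ici 0) t

/-- The second derivative on `[0,∞)`, one-sided at `0`. -/
def deriv₂ (η : ℝ → ℝ) (t : ℝ) : ℝ := derivWithin (deriv₁ η) (Ici 0) t

/-- `μ(t) = max_{0 ≤ τ ≤ t} 1 / ((1+τ) η''(τ))`. -/
def oscillationRate (η : ℝ → ℝ) (t : ℝ) : ℝ :=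
  sSup ((fun τ => 1 / ((1 + τ) * deriv₂ η τ)) '' Icc 0 t)

end DissipativeWave

end

/-!
On the Fourier side the equation decouples into the scalar equations `v'' + b v' + l² v = 0` with
`l = 2π|ξ|`, and the energy of the solution is the integral over `ξ` of `l² |v|² + |v'|²`. It is
therefore enough to prove, for one mode and with constants independent of `l`, the estimate
`Damping.exists_energy_le`; its right-hand side contains `l^(2 - m') |v(0)|²`, which is what the norm
of `u₀` in `Ḣ^{1 - m'/2}` controls.

*One mode.* As long as `l (1 + t)` is small, the term `l² v` is a perturbation: the equation is
integrated with the factor `exp ∫ b`, which is comparable to `(1 + t)^m`, and the perturbation is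
absorbed (`Damping.IsMode.energy_le_of_low_frequency`). Once `l (1 + t)` is bounded below, put
`w = v' + i l v`, so that `|w|²` is the energy of the mode. The logarithm of `|w|²` has the derivative
`-b - b Re (w̄ / w)`, and `w̄ / w` equals `e^{-2ilτ}` up to a slowly varying factor of modulus one. The
mean of `b` gives the decay `(1 + t)^{-m}`, and what is left are integrals of
`(σ (η τ) - m) e^{-2ilτ} P(τ)` with amplitudes `P` of size `1 / (1 + τ)`
(`Damping.IsMode.energy_le_mul_exp`).

*Oscillatory integrals.* The profile `σ - m` is expanded into a Fourier series, which leads to the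
phases `πk η(τ) / T - 2lτ`. If `l` is small the phases are not stationary, because `η'` is bounded
below, and the integrals are bounded (`Damping.exists_norm_integral_sub_m_le_of_small`). Otherwise
their second derivative is at least `|πk / T| / (μ (1 + τ))` in modulus, and a second-order
stationary phase estimate with a free parameter `δ` bounds the integral of the `k`-th mode by a
multiple of `1 / δ_k + δ_k μ / |k|` (`norm_integral_exp_mul_le_of_deriv_ge`). The choice
`δ_k = δ |k|^{1/2}` makes this `O(|k|^{-1/2})`, which can be summed against the coefficients of a
Hölder function of order `α > 1/2` (`exists_norm_sub_fourierCoeff_zero_le`). With small `δ` the loss is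
`C + ε μ` (`Damping.exists_norm_integral_sub_m_le_add`). It concerns only frequencies bounded away from
zero, for which the whole energy decays like `(1 + t)^{-m}`; this is the second term of the estimate.

*From tempered distributions to modes.* The Fourier transforms of `∂_t u` and `∂_j u` are curves in
`L²` that satisfy integrated forms of the equation. After multiplication by cutoffs in `ξ` they solve a
linear differential equation in `L²` with a bounded multiplication operator. The same equation is
solvable in the algebra of bounded continuous functions, where evaluation at `ξ` gives the scalar
equation, and uniqueness in `L²` identifies the two (`FiniteEnergySolution.ae_exists_mode`).
-/

namespace DissipativeWave

/-! ### Oscillatory integrals -/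

theorem norm_sub_le_sub_of_norm_deriv_le {E : Type*} [NormedAddCommGroup E] [NormedSpace ℝ E]
    {f f' : ℝ → E} {g g' : ℝ → ℝ} {s t : ℝ} (hst : s ≤ t)
    (hf : ∀ τ ∈ Icc s t, HasDerivAt f (f' τ) τ) (hg : ∀ τ ∈ Icc s t, HasDerivAt g (g' τ) τ)
    (h : ∀ τ ∈ Icc s t, ‖f' τ‖ ≤ g' τ) : ‖f t - f s‖ ≤ g t - g s := by
  refine image_norm_le_of_norm_deriv_right_le_deriv_boundary' (a := s) (b := t)
    (f := fun τ => f τ - f s) (f' := f') (B := fun τ => g τ - g s) (B' := g') ?_ ?_ ?_ ?_ ?_ ?_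
    ⟨hst, le_rfl⟩
  · exact fun τ hτ => ((hf τ hτ).sub_const _).continuousAt.continuousWithinAt
  · exact fun τ hτ => ((hf τ (Ico_subset_Icc_self hτ)).sub_const _).hasDerivWithinAt
  · simp
  · exact fun τ hτ => ((hg τ hτ).sub_const _).continuousAt.continuousWithinAt
  · exact fun τ hτ => ((hg τ (Ico_subset_Icc_self hτ)).sub_const _).hasDerivWithinAt
  · exact fun τ hτ => h τ (Ico_subset_Icc_self hτ)

theorem norm_exp_I_mul_ofReal (x : ℝ) : ‖Complex.exp (Complex.I * x)‖ = 1 := by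
  rw [mul_comm]; exact Complex.norm_exp_ofReal_mul_I x

/-- Integration by parts against `e^{iH}` with a free multiplier `f` in place of `1 / H'`. The
multiplier may be chosen so that the error `1 - H' f` is small away from stationary points and
`f` stays bounded near them. The function `B` is a primitive of an upper bound of the remainder. -/
theorem norm_integral_exp_mul_le {H G f f' B B' : ℝ → ℝ} {P P' : ℝ → ℂ} {s t : ℝ} (hst : s ≤ t)
    (hH : ∀ τ ∈ Icc s t, HasDerivAt H (G τ) τ)
    (hf : ∀ τ ∈ Icc s t, HasDerivAt f (f' τ) τ)
    (hP : ∀ τ ∈ Icc s t, HasDerivAt P (P' τ) τ)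
    (hB : ∀ τ ∈ Icc s t, HasDerivAt B (B' τ) τ)
    (hbound : ∀ τ ∈ Icc s t,
      ‖P τ‖ * |1 - G τ * f τ| + |f' τ| * ‖P τ‖ + |f τ| * ‖P' τ‖ ≤ B' τ) :
    ‖∫ τ in s..t, Complex.exp (Complex.I * H τ) * P τ‖ ≤
      B t - B s + (|f t| * ‖P t‖ + |f s| * ‖P s‖) := by
  -- `R` is the boundary term; `φ + i R'` is the remainder.
  set φ : ℝ → ℂ := fun τ => Complex.exp (Complex.I * H τ) * P τ with hφ
  set R : ℝ → ℂ := fun τ => Complex.exp (Complex.I * H τ) * f τ * P τ with hR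
  have hexp : ∀ τ ∈ Icc s t, HasDerivAt (fun τ => Complex.exp (Complex.I * H τ))
      (Complex.exp (Complex.I * H τ) * (Complex.I * G τ)) τ := fun τ hτ =>
    (((hH τ hτ).ofReal_comp).const_mul Complex.I).cexp
  set R' : ℝ → ℂ := fun τ => (Complex.exp (Complex.I * H τ) * (Complex.I * G τ) * f τ +
    Complex.exp (Complex.I * H τ) * f' τ) * P τ + Complex.exp (Complex.I * H τ) * f τ * P' τ
    with hR'
  have hRd : ∀ τ ∈ Icc s t, HasDerivAt R (R' τ) τ := fun τ hτ =>
    ((hexp τ hτ).mul (hf τ hτ).ofReal_comp).mul (hP τ hτ)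
  have hφc : ContinuousOn φ (Icc s t) := fun τ hτ =>
    ((hexp τ hτ).mul (hP τ hτ)).continuousAt.continuousWithinAt
  -- the integrand is extended continuously to the whole line, for two-sided derivatives
  set ψ : ℝ → ℂ := IccExtend hst ((Icc s t).domRestrict φ) with hψ
  have hψc : Continuous ψ := (continuousOn_iff_continuous_domRestrict.1 hφc).Icc_extend'
  have hψφ : ∀ τ ∈ Icc s t, ψ τ = φ τ := fun τ hτ => by
    rw [hψ, IccExtend_of_mem hst _ hτ]; rfl
  have hint : ∫ τ in s..t, φ τ = ∫ τ in s..t, ψ τ :=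
    intervalIntegral.integral_congr fun τ hτ => (hψφ τ (by rwa [uIcc_of_le hst] at hτ)).symm
  have key : ‖((∫ τ in s..t, ψ τ) + Complex.I * R t) - ((∫ τ in s..s, ψ τ) + Complex.I * R s)‖
      ≤ B t - B s := by
    refine norm_sub_le_sub_of_norm_deriv_le (f := fun r => (∫ τ in s..r, ψ τ) + Complex.I * R r)
      (f' := fun τ => ψ τ + Complex.I * R' τ) (g' := B') hst ?_ hB ?_
    · exact fun τ hτ => (hψc.integral_hasStrictDerivAt s τ).hasDerivAt.add ((hRd τ hτ).const_mul _)
    · intro τ hτ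
      refine le_trans ?_ (hbound τ hτ)
      rw [hψφ τ hτ]
      have : φ τ + Complex.I * R' τ = Complex.exp (Complex.I * H τ) *
          (P τ * ((1 - G τ * f τ : ℝ) : ℂ) + Complex.I * ((f' τ : ℂ) * P τ)
            + Complex.I * ((f τ : ℂ) * P' τ)) := by
        simp only [hφ, hR']; push_cast
        linear_combination (Complex.exp (Complex.I * H τ) * G τ * f τ * P τ) * Complex.I_sq
      rw [this, norm_mul, norm_exp_I_mul_ofReal, one_mul]
      refine (norm_add₃_le).trans ?_
      simp only [norm_mul, Complex.norm_I, one_mul, Complex.norm_real, Real.norm_eq_abs]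
      exact le_rfl
  rw [hint]
  have hRn : ∀ r, ‖Complex.I * R r‖ = |f r| * ‖P r‖ := fun r => by
    simp [hR]
  rw [← hRn, ← hRn]
  rw [intervalIntegral.integral_same, zero_add] at key
  calc ‖∫ τ in s..t, ψ τ‖
      = ‖((∫ τ in s..t, ψ τ) + Complex.I * R t - Complex.I * R s)
          + (Complex.I * R s - Complex.I * R t)‖ := by congr 1; ring
    _ ≤ _ := (norm_add_le _ _).trans (add_le_add key ((norm_sub_le _ _).trans (add_comm _ _).le))

theorem hasDerivAt_neg_div_one_add (c : ℝ) {τ : ℝ} (hτ : 0 ≤ τ) :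
    HasDerivAt (fun τ => -(c / (1 + τ))) (c / (1 + τ) ^ 2) τ := by
  have h1 : (1 + τ) ≠ 0 := by positivity
  have := ((hasDerivAt_const τ c).div ((hasDerivAt_id τ).const_add 1) h1).neg
  convert! this using 1
  simp; ring

/-- Non-stationary phase: the derivative `G` of the phase is monotone and stays away from `0`. -/
theorem norm_integral_exp_mul_le_of_le_abs {H G G₂ : ℝ → ℝ} {P P' : ℝ → ℂ} {s t sg g C : ℝ}
    (hs : 0 ≤ s) (hst : s ≤ t) (hg : 0 < g) (hC : 0 ≤ C) (hsg : |sg| = 1)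
    (hH : ∀ τ ∈ Icc s t, HasDerivAt H (G τ) τ)
    (hG : ∀ τ ∈ Icc s t, HasDerivAt G (G₂ τ) τ)
    (hG₂ : ∀ τ ∈ Icc s t, 0 ≤ sg * G₂ τ) (hgG : ∀ τ ∈ Icc s t, g ≤ |G τ|)
    (hP : ∀ τ ∈ Icc s t, HasDerivAt P (P' τ) τ)
    (hPn : ∀ τ ∈ Icc s t, ‖P τ‖ ≤ 1 / (1 + τ))
    (hP'n : ∀ τ ∈ Icc s t, ‖P' τ‖ ≤ C / (1 + τ) ^ 2) :
    ‖∫ τ in s..t, Complex.exp (Complex.I * H τ) * P τ‖ ≤ (4 + C) / (g * (1 + s)) := by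
  have hG0 : ∀ τ ∈ Icc s t, G τ ≠ 0 := fun τ hτ h => by
    have := hgG τ hτ; rw [h, abs_zero] at this; linarith
  have hPs : ∀ τ ∈ Icc s t, ‖P τ‖ ≤ 1 / (1 + s) := fun τ hτ =>
    (hPn τ hτ).trans (one_div_le_one_div_of_le (by linarith) (by linarith [hτ.1]))
  have hinv : ∀ τ ∈ Icc s t, |(G τ)⁻¹| ≤ 1 / g := fun τ hτ => by
    rw [abs_inv, ← one_div]; exact one_div_le_one_div_of_le hg (hgG τ hτ)
  have main := norm_integral_exp_mul_le (f := fun τ => (G τ)⁻¹) (f' := fun τ => -G₂ τ / G τ ^ 2)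
    (B := fun τ => -(sg * (1 / (1 + s)) * (G τ)⁻¹) + -((C / g) / (1 + τ)))
    (B' := fun τ => -(sg * (1 / (1 + s)) * (-G₂ τ / G τ ^ 2)) + (C / g) / (1 + τ) ^ 2)
    hst hH (fun τ hτ => (hG τ hτ).fun_inv (hG0 τ hτ)) hP
    (fun τ hτ => ((((hG τ hτ).fun_inv (hG0 τ hτ)).const_mul _).neg).add
      (hasDerivAt_neg_div_one_add _ (hs.trans hτ.1))) ?_
  · refine main.trans ?_
    have e1 := mul_le_mul (hinv t ⟨hst, le_rfl⟩) (hPs t ⟨hst, le_rfl⟩) (norm_nonneg _)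
      (by positivity)
    have e2 := mul_le_mul (hinv s ⟨le_rfl, hst⟩) (hPs s ⟨le_rfl, hst⟩) (norm_nonneg _)
      (by positivity)
    have e3 : ∀ r ∈ Icc s t, |sg * (1 / (1 + s)) * (G r)⁻¹| ≤ 1 / g * (1 / (1 + s)) := fun r hr => by
      rw [abs_mul, abs_mul, hsg, one_mul, abs_of_nonneg (by positivity : 0 ≤ 1 / (1 + s)), mul_comm]
      gcongr; exact hinv r hr
    have e4 := abs_le.1 (e3 t ⟨hst, le_rfl⟩)
    have e5 := abs_le.1 (e3 s ⟨le_rfl, hst⟩)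
    have e6 : 0 ≤ (C / g) / (1 + t) := by have := hs.trans hst; positivity
    have e7 : (4 + C) / (g * (1 + s)) = 4 * (1 / g * (1 / (1 + s))) + (C / g) / (1 + s) := by
      field_simp
    rw [e7]; linarith [e4.1, e5.2]
  · intro τ hτ
    have h1 : 1 - G τ * (G τ)⁻¹ = 0 := by rw [mul_inv_cancel₀ (hG0 τ hτ)]; ring
    have h2 : |-G₂ τ / G τ ^ 2| = sg * G₂ τ / G τ ^ 2 := by
      rw [abs_div, abs_neg, abs_of_nonneg (sq_nonneg (G τ)), ← abs_of_nonneg (hG₂ τ hτ), abs_mul,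
        hsg, one_mul]
    have h3 : |(G τ)⁻¹| * ‖P' τ‖ ≤ (C / g) / (1 + τ) ^ 2 := by
      calc _ ≤ 1 / g * (C / (1 + τ) ^ 2) :=
            mul_le_mul (hinv τ hτ) (hP'n τ hτ) (norm_nonneg _) (by positivity)
        _ = _ := by ring
    have h4 : sg * G₂ τ / G τ ^ 2 * ‖P τ‖ ≤ sg * G₂ τ / G τ ^ 2 * (1 / (1 + s)) :=
      mul_le_mul_of_nonneg_left (hPs τ hτ) (div_nonneg (hG₂ τ hτ) (sq_nonneg _))
    have h5 : -(sg * (1 / (1 + s)) * (-G₂ τ / G τ ^ 2)) = sg * G₂ τ / G τ ^ 2 * (1 / (1 + s)) := by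
      ring
    simp only [h1, h2, h5, abs_zero, mul_zero, zero_add]
    linarith

/-- Stationary phase of second order: the derivative `G` of the phase is strictly monotone with
`|G'| ≥ 1 / (M (1 + τ))`. The multiplier is `G / (G² + δ²)`, so that the part of the integral near
the stationary point, where `|G| ≲ δ`, costs `δ M` and the rest costs `1 / δ`. -/
theorem norm_integral_exp_mul_le_of_deriv_ge {H G G₂ : ℝ → ℝ} {P P' : ℝ → ℂ} {s t sg δ C M : ℝ}
    (hs : 0 ≤ s) (hst : s ≤ t) (hδ : 0 < δ) (hC : 0 ≤ C) (hM : 0 ≤ M) (hsg : |sg| = 1)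
    (hH : ∀ τ ∈ Icc s t, HasDerivAt H (G τ) τ)
    (hG : ∀ τ ∈ Icc s t, HasDerivAt G (G₂ τ) τ)
    (hG₂ : ∀ τ ∈ Icc s t, 1 / (1 + τ) ≤ M * (sg * G₂ τ)) (hG₂' : ∀ τ ∈ Icc s t, 0 ≤ sg * G₂ τ)
    (hP : ∀ τ ∈ Icc s t, HasDerivAt P (P' τ) τ)
    (hPn : ∀ τ ∈ Icc s t, ‖P τ‖ ≤ 1 / (1 + τ))
    (hP'n : ∀ τ ∈ Icc s t, ‖P' τ‖ ≤ C / (1 + τ) ^ 2) :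
    ‖∫ τ in s..t, Complex.exp (Complex.I * H τ) * P τ‖ ≤
      (1 + Real.pi + C) / δ + Real.pi * δ * M := by
  have hD : ∀ τ, 0 < G τ ^ 2 + δ ^ 2 := fun τ => by positivity
  have hP1 : ∀ τ ∈ Icc s t, ‖P τ‖ ≤ 1 := fun τ hτ => (hPn τ hτ).trans
    ((div_le_one (by linarith [hτ.1])).2 (by linarith [hτ.1]))
  have hfb : ∀ τ, |G τ / (G τ ^ 2 + δ ^ 2)| ≤ 1 / (2 * δ) := fun τ => by
    rw [abs_div, abs_of_pos (hD τ), div_le_div_iff₀ (hD τ) (by positivity)]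
    nlinarith [sq_nonneg (|G τ| - δ), sq_abs (G τ)]
  have hfd : ∀ τ ∈ Icc s t, HasDerivAt (fun τ => G τ / (G τ ^ 2 + δ ^ 2))
      (G₂ τ * (δ ^ 2 - G τ ^ 2) / (G τ ^ 2 + δ ^ 2) ^ 2) τ := fun τ hτ => by
    have := (hG τ hτ).div (((hG τ hτ).pow 2).add_const (δ ^ 2)) (hD τ).ne'
    convert! this using 1
    simp only [Pi.pow_apply]; push_cast; ring
  have hatan : ∀ τ ∈ Icc s t, HasDerivAt (fun τ => Real.arctan (G τ / δ))
      (δ * G₂ τ / (G τ ^ 2 + δ ^ 2)) τ := fun τ hτ => by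
    convert! ((hG τ hτ).div_const δ).arctan using 1
    field_simp; ring
  have main := norm_integral_exp_mul_le (f := fun τ => G τ / (G τ ^ 2 + δ ^ 2))
    (B := fun τ => (1 / δ + δ * M) * sg * Real.arctan (G τ / δ) + -((C / δ) / (1 + τ)))
    (B' := fun τ => (1 / δ + δ * M) * sg * (δ * G₂ τ / (G τ ^ 2 + δ ^ 2)) + (C / δ) / (1 + τ) ^ 2)
    hst hH hfd hP (fun τ hτ => ((hatan τ hτ).const_mul _).add
      (hasDerivAt_neg_div_one_add _ (hs.trans hτ.1))) ?_
  · refine main.trans ?_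
    have e1 : ∀ r ∈ Icc s t, |G r / (G r ^ 2 + δ ^ 2)| * ‖P r‖ ≤ 1 / (2 * δ) := fun r hr =>
      (mul_le_mul (hfb r) (hP1 r hr) (norm_nonneg _) (by positivity)).trans (mul_one _).le
    have e2 := e1 t ⟨hst, le_rfl⟩
    have e3 := e1 s ⟨le_rfl, hst⟩
    have e4 : ∀ x, |(1 / δ + δ * M) * sg * Real.arctan x| ≤ (1 / δ + δ * M) * (Real.pi / 2) := fun x => by
      rw [abs_mul, abs_mul, hsg, mul_one, abs_of_nonneg (by positivity : 0 ≤ 1 / δ + δ * M)]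
      gcongr
      exact abs_le.2 ⟨(Real.neg_pi_div_two_lt_arctan x).le, (Real.arctan_lt_pi_div_two x).le⟩
    have e5 := (abs_le.1 (e4 (G t / δ))).2
    have e6 := (abs_le.1 (e4 (G s / δ))).1
    have e7 : 0 ≤ (C / δ) / (1 + t) := by have := hs.trans hst; positivity
    have e8 : (C / δ) / (1 + s) ≤ C / δ := div_le_self (by positivity) (by linarith)
    have e9 : (1 + Real.pi + C) / δ + Real.pi * δ * M = 2 * (1 / (2 * δ)) + C / δ
        + 2 * ((1 / δ + δ * M) * (Real.pi / 2)) := by field_simp; ring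
    rw [e9]; linarith
  · intro τ hτ
    have h0 := hG₂' τ hτ
    have h1 : |1 - G τ * (G τ / (G τ ^ 2 + δ ^ 2))| = δ ^ 2 / (G τ ^ 2 + δ ^ 2) := by
      rw [show 1 - G τ * (G τ / (G τ ^ 2 + δ ^ 2)) = δ ^ 2 / (G τ ^ 2 + δ ^ 2) by
        field_simp [(hD τ).ne']; ring]
      exact abs_of_nonneg (div_nonneg (sq_nonneg _) (hD τ).le)
    have h2 : |G₂ τ * (δ ^ 2 - G τ ^ 2) / (G τ ^ 2 + δ ^ 2) ^ 2| ≤ sg * G₂ τ / (G τ ^ 2 + δ ^ 2) := by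
      rw [abs_div, abs_mul, abs_of_pos (pow_pos (hD τ) 2), div_le_div_iff₀ (pow_pos (hD τ) 2) (hD τ)]
      have hab : |G₂ τ| = sg * G₂ τ := by rw [← abs_of_nonneg h0, abs_mul, hsg, one_mul]
      have hab2 : |δ ^ 2 - G τ ^ 2| ≤ G τ ^ 2 + δ ^ 2 :=
        abs_le.2 ⟨by nlinarith [sq_nonneg δ], by nlinarith [sq_nonneg (G τ)]⟩
      rw [hab, sq (G τ ^ 2 + δ ^ 2), ← mul_assoc]
      gcongr
    have h3 : ‖P τ‖ * (δ ^ 2 / (G τ ^ 2 + δ ^ 2)) ≤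
        M * (sg * G₂ τ) * (δ ^ 2 / (G τ ^ 2 + δ ^ 2)) :=
      mul_le_mul_of_nonneg_right ((hPn τ hτ).trans (hG₂ τ hτ)) (div_nonneg (sq_nonneg _) (hD τ).le)
    have h4 := mul_le_mul h2 (hP1 τ hτ) (norm_nonneg _) (div_nonneg h0 (hD τ).le)
    have h5 : |G τ / (G τ ^ 2 + δ ^ 2)| * ‖P' τ‖ ≤ (C / δ) / (1 + τ) ^ 2 := by
      have h6 : 0 ≤ C / (1 + τ) ^ 2 := div_nonneg hC (sq_nonneg _)
      calc _ ≤ 1 / (2 * δ) * (C / (1 + τ) ^ 2) :=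
            mul_le_mul (hfb τ) (hP'n τ hτ) (norm_nonneg _) (by positivity)
        _ ≤ 1 / δ * (C / (1 + τ) ^ 2) := by gcongr; linarith
        _ = _ := by ring
    have h7 : (1 / δ + δ * M) * sg * (δ * G₂ τ / (G τ ^ 2 + δ ^ 2)) =
        sg * G₂ τ / (G τ ^ 2 + δ ^ 2) + M * (sg * G₂ τ) * (δ ^ 2 / (G τ ^ 2 + δ ^ 2)) := by
      field_simp
    rw [h1, h7]
    linarith

/-! ### Fourier series of Hölder functions -/

section Fourier

variable {p : ℝ}

/-- The translate `x ↦ f (x + y)` of a function on the circle. -/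
noncomputable def translate (f : C(AddCircle p, ℂ)) (y : ℝ) : C(AddCircle p, ℂ) :=
  f.comp (ContinuousMap.addRight (y : AddCircle p))

theorem translate_apply (f : C(AddCircle p, ℂ)) (y : ℝ) (x : AddCircle p) :
    translate f y x = f (x + y) := rfl

theorem continuous_translate (f : C(AddCircle p, ℂ)) : Continuous (translate f) := by
  let F : C(ℝ × AddCircle p, ℂ) :=
    ⟨fun q => f (q.2 + (q.1 : AddCircle p)), f.continuous.comp
      (continuous_snd.add ((AddCircle.continuous_mk' p).comp continuous_fst))⟩
  exact F.curry.continuous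

variable [hp : Fact (0 < p)]

/-- The `k`-th Fourier coefficient as a continuous functional. -/
noncomputable def fourierCoeffCLM (k : ℤ) : C(AddCircle p, ℂ) →L[ℂ] ℂ :=
  LinearMap.mkContinuous
    { toFun := fun f => fourierCoeff f k
      map_add' := fun f g => by
        have hf : Integrable f AddCircle.haarAddCircle :=
          f.continuous.integrable_of_hasCompactSupport (HasCompactSupport.of_compactSpace _)
        have hg : Integrable g AddCircle.haarAddCircle :=
          g.continuous.integrable_of_hasCompactSupport (HasCompactSupport.of_compactSpace _)
        exact congrFun (fourierCoeff.add hf hg) k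
      map_smul' := fun c f => fourierCoeff.const_smul f c k } 1 fun f => by
    rw [one_mul]
    refine (norm_integral_le_of_norm_le_const (C := ‖f‖) (Filter.Eventually.of_forall fun x => ?_)).trans
      (by simp)
    rw [norm_smul]
    calc _ ≤ ‖fourier (T := p) (-k)‖ * ‖f‖ := mul_le_mul (ContinuousMap.norm_coe_le_norm _ _)
          (ContinuousMap.norm_coe_le_norm _ _) (norm_nonneg _) (norm_nonneg _)
      _ = _ := by rw [fourier_norm, one_mul]

theorem fourierCoeffCLM_apply (k : ℤ) (f : C(AddCircle p, ℂ)) :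
    fourierCoeffCLM k f = fourierCoeff f k := rfl

theorem norm_fourierCoeff_le (k : ℤ) (f : C(AddCircle p, ℂ)) : ‖fourierCoeff f k‖ ≤ ‖f‖ := by
  have := (fourierCoeffCLM (p := p) k).le_of_opNorm_le
    (LinearMap.mkContinuous_norm_le _ zero_le_one _) f
  rwa [one_mul] at this

theorem fourierCoeff_translate (f : C(AddCircle p, ℂ)) (y : ℝ) (k : ℤ) :
    fourierCoeff (translate f y) k = fourier k (y : AddCircle p) * fourierCoeff f k := by
  rw [fourierCoeff, fourierCoeff, ← integral_const_mul,
    ← integral_add_right_eq_self _ (y : AddCircle p)]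
  rw [← integral_add_right_eq_self (fun a : AddCircle p => fourier k (y : AddCircle p) *
    (fourier (-k) a • f a)) (y : AddCircle p)]
  rw [integral_add_right_eq_self (fun a : AddCircle p => fourier (-k) a • (translate f y) a)
    (y : AddCircle p)]
  refine integral_congr_ae (Filter.Eventually.of_forall fun x => ?_)
  have h : fourier (T := p) k (y : AddCircle p) * fourier (-k) (y : AddCircle p) = 1 := by
    rw [← fourier_add, add_neg_cancel, fourier_zero]
  have h2 : fourier (T := p) (-k) (x + y) = fourier (-k) x * fourier (-k) (y : AddCircle p) := by
    simp [fourier_apply, smul_add, AddCircle.toCircle_add]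
  simp only [translate_apply, smul_eq_mul, h2]
  linear_combination (-(fourier (T := p) (-k) x) * f (x + y)) * h

/-- A Hölder bound of order `α` gives Fourier coefficients of size `|k|^{-α}`: translation by half
a period of the `k`-th mode changes its sign. -/
theorem norm_fourierCoeff_le_of_holder {f : C(AddCircle p, ℂ)} {K α : ℝ}
    (hf : ∀ y : ℝ, ‖translate f y - f‖ ≤ K * |y| ^ α) {k : ℤ} (hk : k ≠ 0) :
    ‖fourierCoeff f k‖ ≤ K * (p / 2) ^ α * |(k : ℝ)| ^ (-α) := by
  have hp0 : 0 < p := hp.out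
  have hk0 : 0 < |(k : ℝ)| := abs_pos.2 (by exact_mod_cast hk)
  have h1 : fourier (T := p) k ((p / 2 / k : ℝ) : AddCircle p) = -1 := by
    have := fourier_add_half_inv_index hk hp0 (0 : AddCircle p)
    rwa [zero_add, fourier_eval_zero] at this
  have h2 : fourierCoeff (translate f (p / 2 / k) - f : C(AddCircle p, ℂ)) k =
      -2 * fourierCoeff f k := by
    rw [← fourierCoeffCLM_apply, map_sub, fourierCoeffCLM_apply, fourierCoeffCLM_apply,
      fourierCoeff_translate, h1]; ring
  have h3 := (norm_fourierCoeff_le k (translate f (p / 2 / k) - f)).trans (hf _)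
  rw [h2, norm_mul, norm_neg, abs_div, abs_of_pos (by positivity : 0 < p / 2),
    Real.div_rpow (by positivity) hk0.le] at h3
  rw [Real.rpow_neg hk0.le, mul_assoc, ← div_eq_mul_inv]
  have : ‖(2 : ℂ)‖ = 2 := by simp
  rw [this] at h3
  linarith [norm_nonneg (fourierCoeff f k)]

theorem norm_integral_fourier_le {k : ℤ} (hk : k ≠ 0) (h : ℝ) :
    ‖∫ y in (0 : ℝ)..h, fourier (T := p) k (y : AddCircle p)‖ ≤ p / |(k : ℝ)| := by
  have hp0 : 0 < p := hp.out
  have hk0 : 0 < |(k : ℝ)| := abs_pos.2 (by exact_mod_cast hk)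
  set c : ℂ := 2 * Real.pi * Complex.I * k / p with hc
  have hcn : ‖c‖ = 2 * Real.pi * |(k : ℝ)| / p := by
    rw [hc]; simp [abs_of_pos hp0, abs_of_pos Real.pi_pos]
  have hc0 : c ≠ 0 := by rw [← norm_ne_zero_iff, hcn]; have := Real.pi_pos; positivity
  have h1 : ∀ y : ℝ, fourier (T := p) k (y : AddCircle p) = Complex.exp (c * y) := fun y => by
    rw [fourier_coe_apply, hc]; congr 1; ring
  have h2 : ∀ y : ℝ, ‖Complex.exp (c * y)‖ = 1 := fun y => by
    rw [← h1, fourier_apply, Circle.norm_coe]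
  simp_rw [h1]
  rw [integral_exp_mul_complex hc0, norm_div, hcn]
  calc _ ≤ 2 / (2 * Real.pi * |(k : ℝ)| / p) := by
        gcongr
        refine (norm_sub_le _ _).trans ?_
        rw [h2, h2]; norm_num
    _ = (1 / Real.pi) * (p / |(k : ℝ)|) := by field_simp
    _ ≤ 1 * (p / |(k : ℝ)|) := by
        gcongr
        rw [div_le_one Real.pi_pos]; linarith [Real.pi_gt_three]
    _ = _ := one_mul _

/-- The mean of `f` over `[x, x + h]`. -/
noncomputable def average (f : C(AddCircle p, ℂ)) (h : ℝ) : C(AddCircle p, ℂ) :=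
  (h : ℂ)⁻¹ • ∫ y in (0 : ℝ)..h, translate f y

theorem fourierCoeff_average (f : C(AddCircle p, ℂ)) (h : ℝ) (k : ℤ) :
    fourierCoeff (average f h) k =
      ((h : ℂ)⁻¹ * ∫ y in (0 : ℝ)..h, fourier k (y : AddCircle p)) * fourierCoeff f k := by
  rw [average, ← fourierCoeffCLM_apply, map_smul, ← ContinuousLinearMap.intervalIntegral_comp_comm _
    ((continuous_translate f).intervalIntegrable _ _)]
  simp_rw [fourierCoeffCLM_apply, fourierCoeff_translate]
  rw [intervalIntegral.integral_mul_const, smul_eq_mul, mul_assoc]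

theorem norm_fourierCoeff_average_le (f : C(AddCircle p, ℂ)) {h : ℝ} (hh : 0 < h) (k : ℤ) :
    ‖fourierCoeff (average f h) k‖ ≤ ‖fourierCoeff f k‖ := by
  rw [fourierCoeff_average, norm_mul]
  refine mul_le_of_le_one_left (norm_nonneg _) ?_
  have := intervalIntegral.norm_integral_le_of_norm_le_const (C := 1) (a := 0) (b := h)
    (f := fun y : ℝ => fourier (T := p) k (y : AddCircle p)) fun y _ => by rw [fourier_apply, Circle.norm_coe]
  rw [norm_mul, norm_inv, Complex.norm_real, Real.norm_of_nonneg hh.le]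
  rw [one_mul, sub_zero, abs_of_pos hh] at this
  rw [inv_mul_le_iff₀ hh, mul_one]; exact this

theorem norm_average_sub_le {f : C(AddCircle p, ℂ)} {K α h : ℝ} (hK : 0 ≤ K) (hα : 0 ≤ α)
    (hf : ∀ y : ℝ, ‖translate f y - f‖ ≤ K * |y| ^ α) (hh : 0 < h) :
    ‖average f h - f‖ ≤ K * h ^ α := by
  have h1 : average f h - f = (h : ℂ)⁻¹ • ∫ y in (0 : ℝ)..h, (translate f y - f) := by
    rw [intervalIntegral.integral_sub ((continuous_translate f).intervalIntegrable _ _)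
      intervalIntegrable_const, intervalIntegral.integral_const, smul_sub, average, sub_zero]
    congr 1
    rw [← Complex.coe_smul, smul_smul, inv_mul_cancel₀ (by exact_mod_cast hh.ne'), one_smul]
  have h2 := intervalIntegral.norm_integral_le_of_norm_le_const (C := K * h ^ α) (a := 0) (b := h)
    (f := fun y : ℝ => translate f y - f) fun y hy => by
      rw [uIoc_of_le hh.le] at hy
      refine (hf y).trans ?_
      rw [abs_of_pos hy.1]
      gcongr
      · exact hy.1.le
      · exact hy.2
  rw [h1, norm_smul, norm_inv, Complex.norm_real, Real.norm_of_nonneg hh.le, inv_mul_le_iff₀ hh]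
  rwa [sub_zero, abs_of_pos hh, mul_comm] at h2

/-- A functional which is `O(|k|^{-1/2})` on the nonzero modes can be summed against the Fourier
series of a Hölder function of order `α > 1/2`, since `∑ |k|^{-α-1/2} < ∞`. The series itself need
not be handled: the averages of `f` have absolutely summable coefficients, dominated by those of
`f`. -/
theorem exists_norm_sub_fourierCoeff_zero_le (f : C(AddCircle p, ℂ)) {K α : ℝ} (hK : 0 ≤ K)
    (hα : 1 / 2 < α) (hf : ∀ y : ℝ, ‖translate f y - f‖ ≤ K * |y| ^ α) :
    ∃ S : ℝ, 0 ≤ S ∧ ∀ (L : C(AddCircle p, ℂ) →L[ℂ] ℂ) (D : ℝ),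
      (∀ k : ℤ, k ≠ 0 → ‖L (fourier k)‖ ≤ D * |(k : ℝ)| ^ (-(1 / 2) : ℝ)) →
      ‖L f - fourierCoeff f 0 * L 1‖ ≤ D * S := by
  have hp0 : 0 < p := hp.out
  set K₁ : ℝ := K * (p / 2) ^ α with hK₁
  have hK₁0 : 0 ≤ K₁ := by positivity
  have hsum : Summable fun k : ℤ => K₁ * |(k : ℝ)| ^ (-(α + 1 / 2)) :=
    (Real.summable_abs_int_rpow (by linarith)).mul_left _
  refine ⟨∑' k : ℤ, K₁ * |(k : ℝ)| ^ (-(α + 1 / 2)), tsum_nonneg fun k => by positivity, ?_⟩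
  set S := ∑' k : ℤ, K₁ * |(k : ℝ)| ^ (-(α + 1 / 2)) with hS
  intro L D hL
  have hD : 0 ≤ D := by
    have := (norm_nonneg _).trans (hL 1 one_ne_zero)
    simpa using this
  have step : ∀ h : ℝ, 0 < h → ‖L (average f h) - fourierCoeff f 0 * L 1‖ ≤ D * S := by
    intro h hh
    have hcs : Summable (fourierCoeff (average f h)) := by
      have hb : Summable fun k : ℤ => h⁻¹ * p * K₁ * |(k : ℝ)| ^ (-(α + 1)) :=
        (Real.summable_abs_int_rpow (by linarith)).mul_left _
      refine Summable.of_norm_bounded_eventually hb ?_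
      filter_upwards [(Set.finite_singleton (0 : ℤ)).compl_mem_cofinite] with k hk
      have hk : k ≠ 0 := hk
      have hk0 : 0 < |(k : ℝ)| := abs_pos.2 (by exact_mod_cast hk)
      rw [fourierCoeff_average, norm_mul, norm_mul, norm_inv, Complex.norm_real,
        Real.norm_of_nonneg hh.le]
      calc _ ≤ h⁻¹ * (p / |(k : ℝ)|) * (K₁ * |(k : ℝ)| ^ (-α)) := by
            gcongr
            · exact norm_integral_fourier_le hk h
            · exact norm_fourierCoeff_le_of_holder hf hk
        _ = h⁻¹ * p * K₁ * (|(k : ℝ)| ^ (-α) * |(k : ℝ)| ^ (-1 : ℝ)) := by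
            rw [Real.rpow_neg_one]; ring
        _ = _ := by rw [← Real.rpow_add hk0]; congr 2; ring
    have hL1 := L.hasSum (hasSum_fourier_series_of_summable hcs)
    have hc0 : fourierCoeff (average f h) 0 = fourierCoeff f 0 := by
      rw [fourierCoeff_average]
      have : ∀ y : ℝ, fourier (T := p) 0 (y : AddCircle p) = 1 := fun y => fourier_zero
      simp_rw [this]
      rw [intervalIntegral.integral_const, sub_zero]
      have : (h : ℂ) ≠ 0 := by exact_mod_cast hh.ne'
      simp [this]
    have hL2 : HasSum (fun k : ℤ => if k = 0 then fourierCoeff f 0 * L 1 else 0)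
        (fourierCoeff f 0 * L 1) := hasSum_ite_eq 0 _
    have h4 := hL1.sub hL2
    rw [← h4.tsum_eq]
    refine tsum_of_norm_bounded (hsum.hasSum.mul_left D) fun k => ?_
    by_cases hk : k = 0
    · subst hk
      have h1 : (fourier 0 : C(AddCircle p, ℂ)) = 1 := by ext x; exact fourier_zero
      rw [map_smul, hc0, h1, if_pos rfl, smul_eq_mul, sub_self, norm_zero]
      positivity
    · have hk0 : 0 < |(k : ℝ)| := abs_pos.2 (by exact_mod_cast hk)
      rw [if_neg hk, sub_zero, map_smul, smul_eq_mul, norm_mul]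
      calc _ ≤ (K₁ * |(k : ℝ)| ^ (-α)) * (D * |(k : ℝ)| ^ (-(1 / 2) : ℝ)) := by
            gcongr
            · exact (norm_fourierCoeff_average_le f hh k).trans
                (norm_fourierCoeff_le_of_holder hf hk)
            · exact hL k hk
        _ = D * (K₁ * (|(k : ℝ)| ^ (-α) * |(k : ℝ)| ^ (-(1 / 2) : ℝ))) := by ring
        _ = _ := by rw [← Real.rpow_add hk0]; congr 3; ring
  have step2 : ∀ h : ℝ, 0 < h →
      ‖L f - fourierCoeff f 0 * L 1‖ ≤ D * S + ‖L‖ * (K * h ^ α) := by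
    intro h hh
    have e : L f - fourierCoeff f 0 * L 1 =
        (L (average f h) - fourierCoeff f 0 * L 1) - L (average f h - f) := by
      rw [map_sub]; ring
    rw [e]
    refine (norm_sub_le _ _).trans (add_le_add (step h hh) ((L.le_opNorm _).trans ?_))
    gcongr
    exact norm_average_sub_le hK (by linarith) hf hh
  have hα0 : 0 < α := by linarith
  have hlim : Filter.Tendsto (fun h : ℝ => D * S + ‖L‖ * (K * h ^ α))
      (nhdsWithin 0 (Ioi 0)) (nhds (D * S + ‖L‖ * (K * 0 ^ α))) :=
    Filter.Tendsto.mono_left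
      ((((Real.continuousAt_rpow_const 0 α (Or.inr hα0.le)).const_mul K).const_mul ‖L‖).const_add
        (D * S)) nhdsWithin_le_nhds
  rw [Real.zero_rpow hα0.ne', mul_zero, mul_zero, add_zero] at hlim
  exact ge_of_tendsto hlim (by filter_upwards [self_mem_nhdsWithin] with h hh using step2 h hh)

end Fourier

/-! ### Integrals against the oscillating coefficient -/

/-- The data of an oscillating dissipation `σ (η t) / (1 + t)`. The phase `η` and its derivatives
`η₁`, `η₂` are defined on the whole line, so that all derivatives are two-sided; only their values
on `[0, ∞)` matter. -/
structure Damping where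
  /-- the periodic profile -/
  σ : ℝ → ℝ
  /-- half the period -/
  T : ℝ
  T_pos : 0 < T
  periodic : Function.Periodic σ (2 * T)
  /-- the Hölder constant -/
  K : ℝ≥0
  /-- the Hölder exponent -/
  α : ℝ≥0
  half_lt : 1 / 2 < α
  holder : HolderWith K α σ
  /-- the phase -/
  η : ℝ → ℝ
  /-- the derivative of the phase -/
  η₁ : ℝ → ℝ
  /-- the second derivative of the phase -/
  η₂ : ℝ → ℝ
  hasDerivAt_η : ∀ t, HasDerivAt η (η₁ t) t
  hasDerivAt_η₁ : ∀ t, HasDerivAt η₁ (η₂ t) t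
  η₁_pos : ∀ t, 0 ≤ t → 0 < η₁ t
  η₂_pos : ∀ t, 0 ≤ t → 0 < η₂ t

/-- `P` is an amplitude of size `1 / (1 + τ)` on `[s, t]`, with derivative `P'` of size
`C / (1 + τ)²`. -/
structure IsAmplitude (C s t : ℝ) (P P' : ℝ → ℂ) : Prop where
  hasDerivAt : ∀ τ ∈ Icc s t, HasDerivAt P (P' τ) τ
  norm_le : ∀ τ ∈ Icc s t, ‖P τ‖ ≤ 1 / (1 + τ)
  norm_deriv_le : ∀ τ ∈ Icc s t, ‖P' τ‖ ≤ C / (1 + τ) ^ 2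

theorem IsAmplitude.continuousOn {C s t : ℝ} {P P' : ℝ → ℂ} (h : IsAmplitude C s t P P') :
    ContinuousOn P (Icc s t) := fun τ hτ => (h.hasDerivAt τ hτ).continuousAt.continuousWithinAt

namespace Damping

variable (D : Damping)

/-- The mean value of the profile. -/
noncomputable def m : ℝ := periodMean D.T D.σ

theorem fact_period_pos : Fact (0 < 2 * D.T) := ⟨by linarith [D.T_pos]⟩

theorem continuous_σ : Continuous D.σ :=
  D.holder.continuous (lt_trans (by norm_num) D.half_lt)

theorem continuous_η : Continuous D.η :=
  continuous_iff_continuousAt.2 fun t => (D.hasDerivAt_η t).continuousAt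

theorem exists_abs_σ_le : ∃ B : ℝ, 0 ≤ B ∧ ∀ x, |D.σ x| ≤ B := by
  obtain ⟨B, hB⟩ := isBounded_iff_forall_norm_le.1
    (D.periodic.isBounded_of_continuous (by linarith [D.T_pos]) D.continuous_σ)
  exact ⟨B, (norm_nonneg _).trans (hB (D.σ 0) ⟨0, rfl⟩), fun x => hB _ ⟨x, rfl⟩⟩

theorem η₁_zero_le {t : ℝ} (ht : 0 ≤ t) : D.η₁ 0 ≤ D.η₁ t := by
  have := norm_sub_le_sub_of_norm_deriv_le (E := ℝ) (f := fun _ => (0 : ℝ)) (f' := fun _ => 0) ht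
    (fun τ _ => hasDerivAt_const τ 0) (fun τ _ => D.hasDerivAt_η₁ τ)
    (fun τ hτ => by simpa using (D.η₂_pos τ hτ.1).le)
  simpa using this

/-- The profile as a function on the circle. -/
noncomputable def profile : C(AddCircle (2 * D.T), ℂ) where
  toFun x := ((D.periodic.lift x : ℝ) : ℂ)
  continuous_toFun := Complex.continuous_ofReal.comp (D.continuous_σ.quotient_lift _)

theorem profile_coe (x : ℝ) : D.profile (x : AddCircle (2 * D.T)) = (D.σ x : ℂ) := rfl

theorem norm_translate_profile_sub_le (y : ℝ) :
    haveI := D.fact_period_pos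
    ‖translate D.profile y - D.profile‖ ≤ D.K * |y| ^ (D.α : ℝ) := by
  have := D.fact_period_pos
  refine (ContinuousMap.norm_le _ (by positivity)).2 fun x => ?_
  induction x using QuotientAddGroup.induction_on with
  | H x =>
    have h : (translate D.profile y - D.profile) (x : AddCircle (2 * D.T)) =
      ((D.σ (x + y) - D.σ x : ℝ) : ℂ) := by push_cast; rfl
    have h2 := D.holder.dist_le (x + y) x
    rw [Real.dist_eq, Real.dist_eq, add_sub_cancel_left] at h2
    change ‖(translate D.profile y - D.profile) (x : AddCircle (2 * D.T))‖ ≤ _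
    rw [h, Complex.norm_real]
    exact h2

theorem fourierCoeff_profile_zero :
    haveI := D.fact_period_pos
    fourierCoeff D.profile 0 = (D.m : ℂ) := by
  have := D.fact_period_pos
  rw [fourierCoeff_eq_intervalIntegral _ _ (-D.T), m, periodMean,
    show -D.T + 2 * D.T = D.T by ring]
  simp only [neg_zero, fourier_zero, one_smul, profile_coe]
  rw [intervalIntegral.integral_ofReal, ← Complex.coe_smul]
  push_cast; rfl

/-- Bounds for the integrals of the single modes of the profile give a bound for the
profile. -/
theorem exists_norm_integral_sub_m_le : ∃ S : ℝ, 0 ≤ S ∧ ∀ (s t l : ℝ) (P : ℝ → ℂ) (X : ℝ),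
    s ≤ t → ContinuousOn P (Icc s t) →
    (∀ k : ℤ, k ≠ 0 → ‖∫ τ in s..t, Complex.exp (Complex.I *
      ((Real.pi * k / D.T * D.η τ - 2 * l * τ : ℝ) : ℂ)) * P τ‖ ≤
        X * |(k : ℝ)| ^ (-(1 / 2) : ℝ)) →
    ‖∫ τ in s..t, ((D.σ (D.η τ) - D.m : ℝ) : ℂ) *
      (Complex.exp (Complex.I * ((-(2 * l * τ) : ℝ) : ℂ)) * P τ)‖ ≤ X * S := by
  have := D.fact_period_pos
  obtain ⟨S, hS, h⟩ := exists_norm_sub_fourierCoeff_zero_le D.profile (K := D.K) (α := D.α)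
    D.K.2 (by exact_mod_cast D.half_lt) D.norm_translate_profile_sub_le
  refine ⟨S, hS, fun s t l P X hst hP hX => ?_⟩
  set Q : ℝ → ℂ := fun τ => Complex.exp (Complex.I * ((-(2 * l * τ) : ℝ) : ℂ)) * P τ with hQ
  have hQc : ContinuousOn Q (Icc s t) := by
    refine ContinuousOn.mul (Continuous.continuousOn ?_) hP
    fun_prop
  have hcont : ∀ f : C(AddCircle (2 * D.T), ℂ), Continuous fun τ => f (D.η τ : AddCircle (2 * D.T)) :=
    fun f => f.continuous.comp ((AddCircle.continuous_mk' _).comp D.continuous_η)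
  have hint : ∀ f : C(AddCircle (2 * D.T), ℂ), IntervalIntegrable
      (fun τ => f (D.η τ : AddCircle (2 * D.T)) * Q τ) volume s t := fun f => by
    refine ContinuousOn.intervalIntegrable ?_
    rw [uIcc_of_le hst]
    exact (hcont f).continuousOn.mul hQc
  obtain ⟨M, hM⟩ := isCompact_Icc.exists_bound_of_continuousOn hQc
  have hM0 : 0 ≤ M := (norm_nonneg _).trans (hM s ⟨le_rfl, hst⟩)
  let L : C(AddCircle (2 * D.T), ℂ) →L[ℂ] ℂ := LinearMap.mkContinuous
    { toFun := fun f => ∫ τ in s..t, f (D.η τ : AddCircle (2 * D.T)) * Q τ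
      map_add' := fun f g => by
        rw [← intervalIntegral.integral_add (hint f) (hint g)]
        simp [add_mul]
      map_smul' := fun c f => by
        rw [RingHom.id_apply, smul_eq_mul, ← intervalIntegral.integral_const_mul]
        simp [mul_assoc] } (M * |t - s|) fun f => by
    refine (intervalIntegral.norm_integral_le_of_norm_le_const (C := ‖f‖ * M) fun τ hτ => ?_).trans
      (by rw [mul_comm ‖f‖, mul_right_comm])
    rw [uIoc_of_le hst] at hτ
    rw [norm_mul]
    exact mul_le_mul (f.norm_coe_le_norm _) (hM τ (Ioc_subset_Icc_self hτ)) (norm_nonneg _)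
      (norm_nonneg _)
  have hL : ∀ f, L f = ∫ τ in s..t, f (D.η τ : AddCircle (2 * D.T)) * Q τ := fun f => rfl
  have key := h L X fun k hk => by
    refine le_trans (le_of_eq ?_) (hX k hk)
    rw [hL]
    congr 1
    refine intervalIntegral.integral_congr fun τ _ => ?_
    simp only [fourier_coe_apply, hQ]
    rw [← mul_assoc, ← Complex.exp_add]
    congr 2
    have : (D.T : ℂ) ≠ 0 := by exact_mod_cast D.T_pos.ne'
    push_cast; field_simp; ring
  rw [D.fourierCoeff_profile_zero, hL, hL, ← intervalIntegral.integral_const_mul,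
    ← intervalIntegral.integral_sub (hint _) ((hint _).const_mul _)] at key
  convert key using 2
  refine intervalIntegral.integral_congr fun τ _ => ?_
  simp only [profile_coe, ContinuousMap.one_apply, hQ]
  push_cast; ring

theorem hasDerivAt_phase (κ l τ : ℝ) :
    HasDerivAt (fun τ => κ * D.η τ - 2 * l * τ) (κ * D.η₁ τ - 2 * l) τ := by
  convert! ((D.hasDerivAt_η τ).const_mul κ).sub ((hasDerivAt_id τ).const_mul (2 * l)) using 1
  simp

theorem hasDerivAt_phase_deriv (κ l τ : ℝ) :
    HasDerivAt (fun τ => κ * D.η₁ τ - 2 * l) (κ * D.η₂ τ) τ :=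
  ((D.hasDerivAt_η₁ τ).const_mul κ).sub_const _

/-- Below a threshold `l₀` the frequency `2 l` is not in resonance with the oscillations. -/
theorem exists_norm_integral_sub_m_le_of_small {C : ℝ} (hC : 0 ≤ C) :
    ∃ l₀ : ℝ, 0 < l₀ ∧ ∃ C₀ : ℝ, 0 ≤ C₀ ∧ ∀ (s t l : ℝ) (P P' : ℝ → ℂ), 0 ≤ s → s ≤ t → 0 ≤ l →
      l ≤ l₀ → IsAmplitude C s t P P' →
      ‖∫ τ in s..t, ((D.σ (D.η τ) - D.m : ℝ) : ℂ) *
        (Complex.exp (Complex.I * ((-(2 * l * τ) : ℝ) : ℂ)) * P τ)‖ ≤ C₀ := by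
  obtain ⟨S, hS, h⟩ := D.exists_norm_integral_sub_m_le
  have hT := D.T_pos
  have hη := D.η₁_pos 0 le_rfl
  have hπ := Real.pi_pos
  set g : ℝ := Real.pi / D.T * D.η₁ 0 / 2 with hg
  have hg0 : 0 < g := by positivity
  refine ⟨g / 2, by positivity, (4 + C) / g * S, by positivity,
    fun s t l P P' hs hst hl hl₀ hP => h s t l P _ hst hP.continuousOn fun k hk => ?_⟩
  have hk1 : 1 ≤ |(k : ℝ)| := by exact_mod_cast Int.one_le_abs hk
  have hk0 : 0 < |(k : ℝ)| := by linarith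
  set κ : ℝ := Real.pi * k / D.T with hκ
  have hκa : |κ| = Real.pi / D.T * |(k : ℝ)| := by
    rw [hκ, abs_div, abs_mul, abs_of_pos hπ, abs_of_pos hT]; ring
  have hκ0 : κ ≠ 0 := by rw [← abs_pos, hκa]; positivity
  have hsg : SignType.sign κ * κ = |κ| := sign_mul_self κ
  have := norm_integral_exp_mul_le_of_le_abs (H := fun τ => κ * D.η τ - 2 * l * τ)
    (G := fun τ => κ * D.η₁ τ - 2 * l) (G₂ := fun τ => κ * D.η₂ τ) (sg := SignType.sign κ)
    (g := g * |(k : ℝ)|) hs hst (by positivity) hC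
    (by rcases lt_or_gt_of_ne hκ0 with h | h <;> simp [h])
    (fun τ _ => D.hasDerivAt_phase κ l τ) (fun τ _ => D.hasDerivAt_phase_deriv κ l τ)
    (fun τ hτ => by
      rw [← mul_assoc, hsg]; exact mul_nonneg (abs_nonneg _) (D.η₂_pos τ (hs.trans hτ.1)).le)
    (fun τ hτ => by
      have h1 := D.η₁_zero_le (hs.trans hτ.1)
      have h2 := abs_sub_abs_le_abs_sub (κ * D.η₁ τ) (2 * l)
      rw [abs_mul, abs_of_nonneg (hη.le.trans h1), abs_of_nonneg (by positivity : 0 ≤ 2 * l), hκa]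
        at h2
      have h3 : Real.pi / D.T * |(k : ℝ)| * D.η₁ 0 ≤ Real.pi / D.T * |(k : ℝ)| * D.η₁ τ := by gcongr
      have h4 : Real.pi / D.T * |(k : ℝ)| * D.η₁ 0 = 2 * (g * |(k : ℝ)|) := by rw [hg]; ring
      nlinarith) hP.hasDerivAt hP.norm_le hP.norm_deriv_le
  refine this.trans ?_
  calc (4 + C) / (g * |(k : ℝ)| * (1 + s)) ≤ (4 + C) / (g * |(k : ℝ)| * 1) := by
        gcongr; linarith
    _ = (4 + C) / g * |(k : ℝ)| ^ (-1 : ℝ) := by rw [Real.rpow_neg_one]; field_simp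
    _ ≤ _ := by
        gcongr
        norm_num

/-- At resonant frequencies the loss is at most `ε μ`, where `1 / (1 + τ) ≤ μ η''(τ)`. -/
theorem exists_norm_integral_sub_m_le_add {C ε : ℝ} (hC : 0 ≤ C) (hε : 0 < ε) :
    ∃ C₁ : ℝ, 0 ≤ C₁ ∧ ∀ (s t l μ : ℝ) (P P' : ℝ → ℂ), 0 ≤ s → s ≤ t → 0 ≤ μ →
      (∀ τ ∈ Icc s t, 1 / (1 + τ) ≤ μ * D.η₂ τ) → IsAmplitude C s t P P' →
      ‖∫ τ in s..t, ((D.σ (D.η τ) - D.m : ℝ) : ℂ) *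
        (Complex.exp (Complex.I * ((-(2 * l * τ) : ℝ) : ℂ)) * P τ)‖ ≤ C₁ + ε * μ := by
  obtain ⟨S, hS, h⟩ := D.exists_norm_integral_sub_m_le
  have hT := D.T_pos
  have hπ := Real.pi_pos
  set δ : ℝ := ε / (D.T * (S + 1)) with hδ
  have hδ0 : 0 < δ := by positivity
  refine ⟨(1 + Real.pi + C) / δ * S, by positivity, fun s t l μ P P' hs hst hμ hη hP => ?_⟩
  refine (h s t l P ((1 + Real.pi + C) / δ + δ * D.T * μ) hst hP.continuousOn fun k hk => ?_).trans ?_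
  · have hk1 : 1 ≤ |(k : ℝ)| := by exact_mod_cast Int.one_le_abs hk
    have hk0 : 0 < |(k : ℝ)| := by linarith
    set κ : ℝ := Real.pi * k / D.T with hκ
    have hκa : |κ| = Real.pi / D.T * |(k : ℝ)| := by
      rw [hκ, abs_div, abs_mul, abs_of_pos hπ, abs_of_pos hT]; ring
    have hκ0 : κ ≠ 0 := by rw [← abs_pos, hκa]; positivity
    have hκ1 : |κ| ≠ 0 := abs_ne_zero.2 hκ0
    have hsg : SignType.sign κ * κ = |κ| := sign_mul_self κ
    have hr0 : 0 < √|(k : ℝ)| := Real.sqrt_pos.2 hk0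
    have := norm_integral_exp_mul_le_of_deriv_ge (H := fun τ => κ * D.η τ - 2 * l * τ)
      (G := fun τ => κ * D.η₁ τ - 2 * l) (G₂ := fun τ => κ * D.η₂ τ) (sg := SignType.sign κ)
      (δ := δ * √|(k : ℝ)|) (M := μ / |κ|) hs hst (by positivity) hC (by positivity)
      (by rcases lt_or_gt_of_ne hκ0 with h | h <;> simp [h])
      (fun τ _ => D.hasDerivAt_phase κ l τ) (fun τ _ => D.hasDerivAt_phase_deriv κ l τ)
      (fun τ hτ => by
        rw [← mul_assoc (SignType.sign κ : ℝ), hsg, ← mul_assoc, div_mul_cancel₀ _ hκ1]; exact hη τ hτ)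
      (fun τ hτ => by
        rw [← mul_assoc, hsg]; exact mul_nonneg (abs_nonneg _) (D.η₂_pos τ (hs.trans hτ.1)).le)
      hP.hasDerivAt hP.norm_le hP.norm_deriv_le
    refine this.trans (le_of_eq ?_)
    have hsq : |(k : ℝ)| = √|(k : ℝ)| * √|(k : ℝ)| := (Real.mul_self_sqrt hk0.le).symm
    rw [hκa, Real.rpow_neg hk0.le, ← Real.sqrt_eq_rpow]
    generalize √|(k : ℝ)| = r at hr0 hsq
    rw [hsq]
    field_simp
  · have h1 : δ * D.T * S ≤ ε := by
      have : δ * D.T * (S + 1) = ε := by rw [hδ]; field_simp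
      nlinarith [mul_pos hδ0 hT]
    nlinarith [mul_le_mul_of_nonneg_right h1 hμ]

end Damping

/-! ### Energy estimates for a single frequency -/

namespace Damping

variable (D : Damping)

/-- The dissipation coefficient, equal to `σ (η t) / (1 + t)` for `t ≥ 0` and continuous on the
whole line. -/
noncomputable def b (t : ℝ) : ℝ := D.σ (D.η t) / (1 + max t 0)

theorem b_of_nonneg {t : ℝ} (ht : 0 ≤ t) : D.b t = D.σ (D.η t) / (1 + t) := by
  rw [b, max_eq_left ht]

theorem continuous_b : Continuous D.b := by
  have h1 := D.continuous_σ.comp D.continuous_η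
  refine h1.div (by fun_prop) fun t => ?_
  have := le_max_right t 0
  positivity

theorem abs_b_le {B : ℝ} (hB : ∀ x, |D.σ x| ≤ B) {t : ℝ} (ht : 0 ≤ t) : |D.b t| ≤ B / (1 + t) := by
  rw [b_of_nonneg _ ht, abs_div, abs_of_pos (by linarith : 0 < 1 + t)]
  gcongr
  exact hB _

/-- `v` solves `v'' + b v' + l² v = 0` on `[s, t]`, and `v₁ = v'`. -/
structure IsMode (l s t : ℝ) (v v₁ : ℝ → ℝ) : Prop where
  hasDerivAt : ∀ τ ∈ Icc s t, HasDerivAt v (v₁ τ) τ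
  hasDerivAt_deriv : ∀ τ ∈ Icc s t, HasDerivAt v₁ (-(l ^ 2 * v τ) - D.b τ * v₁ τ) τ

variable {D}

theorem IsMode.mono {l s t s' t' : ℝ} {v v₁ : ℝ → ℝ} (h : D.IsMode l s t v v₁) (hs : s ≤ s')
    (ht : t' ≤ t) : D.IsMode l s' t' v v₁ :=
  ⟨fun τ hτ => h.1 τ ⟨hs.trans hτ.1, hτ.2.trans ht⟩, fun τ hτ => h.2 τ ⟨hs.trans hτ.1, hτ.2.trans ht⟩⟩

theorem IsMode.hasDerivAt_energy {l s t : ℝ} {v v₁ : ℝ → ℝ} (h : D.IsMode l s t v v₁) {τ : ℝ}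
    (hτ : τ ∈ Icc s t) :
    HasDerivAt (fun τ => l ^ 2 * v τ ^ 2 + v₁ τ ^ 2) (-(2 * D.b τ * v₁ τ ^ 2)) τ := by
  convert! (((h.1 τ hτ).pow 2).const_mul (l ^ 2)).add ((h.2 τ hτ).pow 2) using 1
  simp; ring

/-- The energy of a mode changes at most exponentially, so that it vanishes always or never. -/
theorem IsMode.energy_le_and_le {l s t : ℝ} {v v₁ : ℝ → ℝ} (h : D.IsMode l s t v v₁)
    (hs : 0 ≤ s) {B : ℝ} (hB0 : 0 ≤ B) (hB : ∀ x, |D.σ x| ≤ B) {τ : ℝ} (hτ : τ ∈ Icc s t) :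
    l ^ 2 * v τ ^ 2 + v₁ τ ^ 2 ≤
        (l ^ 2 * v s ^ 2 + v₁ s ^ 2) * Real.exp (2 * B * (τ - s)) ∧
      (l ^ 2 * v s ^ 2 + v₁ s ^ 2) * Real.exp (-(2 * B * (τ - s))) ≤
        l ^ 2 * v τ ^ 2 + v₁ τ ^ 2 := by
  have hexp : ∀ c r : ℝ, HasDerivAt (fun r => Real.exp (c * r)) (Real.exp (c * r) * c) r :=
    fun c r => by simpa using ((hasDerivAt_id r).const_mul c).exp
  have hb : ∀ r ∈ Icc s τ, |D.b r| ≤ B := fun r hr => by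
    have hr0 := hs.trans hr.1
    exact (D.abs_b_le hB hr0).trans (div_le_self hB0 (by linarith))
  have hm : ∀ r ∈ Icc s τ, r ∈ Icc s t := fun r hr => ⟨hr.1, hr.2.trans hτ.2⟩
  have key : ∀ r ∈ Icc s τ, |2 * D.b r * v₁ r ^ 2| ≤ 2 * B * (l ^ 2 * v r ^ 2 + v₁ r ^ 2) := by
    intro r hr
    rw [abs_mul, abs_mul, abs_of_pos (two_pos : (0 : ℝ) < 2), abs_of_nonneg (sq_nonneg (v₁ r))]
    have : 0 ≤ l ^ 2 * v r ^ 2 := by positivity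
    gcongr
    · exact hb r hr
    · linarith
  constructor
  · have := norm_sub_le_sub_of_norm_deriv_le (E := ℝ) (f := fun _ => (0 : ℝ)) (f' := fun _ => 0)
      hτ.1 (fun τ _ => hasDerivAt_const τ 0)
      (fun r hr => ((h.hasDerivAt_energy (hm r hr)).mul (hexp (-(2 * B)) r)).neg) (fun r hr => by
        have := (abs_le.1 (key r hr)).1
        have h2 := Real.exp_pos (-(2 * B) * r)
        rw [norm_zero]
        nlinarith)
    simp only [sub_self, norm_zero, Pi.neg_apply, Pi.mul_apply] at this
    have h3 : Real.exp (2 * B * (τ - s)) = Real.exp (-(2 * B) * s) / Real.exp (-(2 * B) * τ) := by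
      rw [← Real.exp_sub]; congr 1; ring
    rw [h3, ← mul_div_assoc, le_div_iff₀ (Real.exp_pos _)]
    linarith
  · have := norm_sub_le_sub_of_norm_deriv_le (E := ℝ) (f := fun _ => (0 : ℝ)) (f' := fun _ => 0)
      hτ.1 (fun τ _ => hasDerivAt_const τ 0)
      (fun r hr => (h.hasDerivAt_energy (hm r hr)).mul (hexp (2 * B) r)) (fun r hr => by
        have := (abs_le.1 (key r hr)).2
        have h2 := Real.exp_pos (2 * B * r)
        rw [norm_zero]
        nlinarith)
    simp only [sub_self, norm_zero, Pi.mul_apply] at this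
    have h3 : Real.exp (-(2 * B * (τ - s))) = Real.exp (2 * B * s) / Real.exp (2 * B * τ) := by
      rw [← Real.exp_sub]; congr 1; ring
    rw [h3, ← mul_div_assoc, div_le_iff₀ (Real.exp_pos _)]
    linarith

/-- With `w = v' + i l v`, the logarithm of the energy `|w|²` has the derivative
`-b - b Re (w̄ / w)`, and `w̄ / w` is `e^{-2ilτ}` times a slowly varying function. -/
theorem IsMode.exists_isAmplitude {l s t : ℝ} {v v₁ : ℝ → ℝ} (h : D.IsMode l s t v v₁)
    (hs : 0 ≤ s) {B : ℝ} (hB0 : 0 ≤ B) (hB : ∀ x, |D.σ x| ≤ B)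
    (hN : 0 < l ^ 2 * v s ^ 2 + v₁ s ^ 2) :
    ∃ P P' : ℝ → ℂ, IsAmplitude (2 * B + 1) s t P P' ∧ ∀ τ ∈ Icc s t,
      HasDerivAt (fun τ => Real.log (l ^ 2 * v τ ^ 2 + v₁ τ ^ 2))
        (-D.b τ - D.σ (D.η τ) *
          (Complex.exp (Complex.I * ((-(2 * l * τ) : ℝ) : ℂ)) * P τ).re) τ := by
  have hpos : ∀ τ ∈ Icc s t, 0 < l ^ 2 * v τ ^ 2 + v₁ τ ^ 2 := fun τ hτ =>
    lt_of_lt_of_le (by positivity) (h.energy_le_and_le hs hB0 hB hτ).2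
  set w : ℝ → ℂ := fun τ => v₁ τ + Complex.I * (l * v τ) with hw
  set wc : ℝ → ℂ := fun τ => v₁ τ - Complex.I * (l * v τ) with hwc
  have hconj : ∀ τ, wc τ = starRingEnd ℂ (w τ) := fun τ => by
    simp [hw, hwc, sub_eq_add_neg]
  have hnsq : ∀ τ, ‖w τ‖ ^ 2 = l ^ 2 * v τ ^ 2 + v₁ τ ^ 2 := fun τ => by
    rw [Complex.sq_norm, Complex.normSq_apply]; simp [hw]; ring
  have hnc : ∀ τ, ‖wc τ‖ = ‖w τ‖ := fun τ => by rw [hconj, RCLike.norm_conj]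
  have hnpos : ∀ τ ∈ Icc s t, 0 < ‖w τ‖ := fun τ hτ => by
    have := hpos τ hτ
    rw [← hnsq] at this
    refine (norm_nonneg _).lt_of_ne' fun h0 => ?_
    rw [h0] at this; norm_num at this
  have hw0 : ∀ τ ∈ Icc s t, w τ ≠ 0 := fun τ hτ => norm_pos_iff.1 (hnpos τ hτ)
  have hv₁n : ∀ τ, |v₁ τ| ≤ ‖w τ‖ := fun τ => by
    have := Complex.abs_re_le_norm (w τ)
    simpa [hw] using this
  have hdw : ∀ τ ∈ Icc s t, HasDerivAt w (Complex.I * l * w τ - D.b τ * v₁ τ) τ := fun τ hτ => by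
    convert! ((h.2 τ hτ).ofReal_comp).add
      ((((h.1 τ hτ).ofReal_comp).const_mul (l : ℂ)).const_mul Complex.I) using 1
    simp only [hw]; push_cast
    linear_combination (-(l : ℂ) ^ 2 * v τ + 2 * (l : ℂ) ^ 2 * v τ) * Complex.I_sq
  have hdwc : ∀ τ ∈ Icc s t, HasDerivAt wc (-(Complex.I * l * wc τ) - D.b τ * v₁ τ) τ := fun τ hτ => by
    convert! ((h.2 τ hτ).ofReal_comp).sub
      ((((h.1 τ hτ).ofReal_comp).const_mul (l : ℂ)).const_mul Complex.I) using 1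
    simp only [hwc]; push_cast
    linear_combination (-(l : ℂ) ^ 2 * v τ + 2 * (l : ℂ) ^ 2 * v τ) * Complex.I_sq
  set e : ℝ → ℂ := fun τ => Complex.exp (Complex.I * ((2 * l * τ : ℝ) : ℂ)) with he
  have hen : ∀ τ, ‖e τ‖ = 1 := fun τ => norm_exp_I_mul_ofReal _
  have hde : ∀ τ, HasDerivAt e (e τ * (Complex.I * (2 * l))) τ := fun τ => by
    convert! ((((hasDerivAt_id τ).const_mul (2 * l)).ofReal_comp).const_mul Complex.I).cexp using 1
    simp [he]
  set q : ℝ → ℂ := fun τ => e τ * (wc τ / w τ) with hq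
  set q' : ℝ → ℂ := fun τ => e τ * (D.b τ * v₁ τ * (wc τ / w τ - 1) / w τ) with hq'
  have hqn : ∀ τ ∈ Icc s t, ‖q τ‖ = 1 := fun τ hτ => by
    rw [hq]; simp only [norm_mul, norm_div, hen, hnc, one_mul]
    exact div_self (hnpos τ hτ).ne'
  have hdq : ∀ τ ∈ Icc s t, HasDerivAt q (q' τ) τ := fun τ hτ => by
    have hw0 := hw0 τ hτ
    convert! (hde τ).mul ((hdwc τ hτ).div (hdw τ hτ) hw0) using 1
    simp only [hq', Pi.div_apply]
    field_simp
    ring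
  have hq'n : ∀ τ ∈ Icc s t, ‖q' τ‖ ≤ 2 * B / (1 + τ) := fun τ hτ => by
    have h1 : ‖wc τ / w τ - 1‖ ≤ 2 := by
      refine (norm_sub_le _ _).trans ?_
      rw [norm_div, hnc, div_self (hnpos τ hτ).ne', norm_one]; norm_num
    simp only [hq', norm_mul, norm_div, hen, one_mul, Complex.norm_real, Real.norm_eq_abs]
    have h2 : |v₁ τ| / ‖w τ‖ ≤ 1 := (div_le_one (hnpos τ hτ)).2 (hv₁n τ)
    have h3 := D.abs_b_le hB (hs.trans hτ.1)
    calc |D.b τ| * |v₁ τ| * ‖wc τ / w τ - 1‖ / ‖w τ‖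
        = |D.b τ| * ‖wc τ / w τ - 1‖ * (|v₁ τ| / ‖w τ‖) := by ring
      _ ≤ (B / (1 + τ)) * 2 * 1 := by
        have := hs.trans hτ.1
        gcongr
      _ = _ := by ring
  refine ⟨fun τ => q τ / ((1 + τ : ℝ) : ℂ), fun τ => (q' τ * ((1 + τ : ℝ) : ℂ) - q τ * ((1 : ℝ) : ℂ)) /
    ((1 + τ : ℝ) : ℂ) ^ 2, ⟨?_, ?_, ?_⟩, ?_⟩
  · intro τ hτ
    have h0 : 0 ≤ τ := hs.trans hτ.1
    have h1 : ((1 + τ : ℝ) : ℂ) ≠ 0 := by exact_mod_cast (by positivity : (1 + τ : ℝ) ≠ 0)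
    exact (hdq τ hτ).div (((hasDerivAt_id τ).const_add 1).ofReal_comp) h1
  · intro τ hτ
    have h0 : 0 ≤ τ := hs.trans hτ.1
    rw [norm_div, hqn τ hτ, Complex.norm_real, Real.norm_of_nonneg (by positivity)]
  · intro τ hτ
    have h0 : 0 ≤ τ := hs.trans hτ.1
    rw [norm_div, norm_pow, Complex.norm_real, Real.norm_of_nonneg (by positivity)]
    gcongr
    refine (norm_sub_le _ _).trans ?_
    rw [norm_mul (q' τ), norm_mul (q τ), hqn τ hτ, Complex.norm_real, Complex.norm_real, norm_one, mul_one,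
      Real.norm_of_nonneg (by positivity)]
    have := hq'n τ hτ
    rw [le_div_iff₀ (by positivity)] at this
    linarith
  · intro τ hτ
    have h0 : 0 ≤ τ := hs.trans hτ.1
    have h1 : ((1 + τ : ℝ) : ℂ) ≠ 0 := by exact_mod_cast (by positivity : (1 + τ : ℝ) ≠ 0)
    convert! (h.hasDerivAt_energy hτ).log (hpos τ hτ).ne' using 1
    have h2 : Complex.exp (Complex.I * ((-(2 * l * τ) : ℝ) : ℂ)) * (q τ / ((1 + τ : ℝ) : ℂ)) =
        ((((v₁ τ ^ 2 - l ^ 2 * v τ ^ 2) / (l ^ 2 * v τ ^ 2 + v₁ τ ^ 2) / (1 + τ) : ℝ)) : ℂ) +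
        Complex.I * ((-(2 * l * v τ * v₁ τ) / (l ^ 2 * v τ ^ 2 + v₁ τ ^ 2) / (1 + τ) : ℝ) : ℂ) := by
      have h3 : Complex.exp (Complex.I * ((-(2 * l * τ) : ℝ) : ℂ)) * e τ = 1 := by
        rw [he, ← Complex.exp_add, ← Complex.exp_zero]; congr 1; push_cast; ring
      have h4 : ((l ^ 2 * v τ ^ 2 + v₁ τ ^ 2 : ℝ) : ℂ) = w τ * wc τ := by
        rw [hconj, Complex.mul_conj, ← hnsq, Complex.normSq_eq_norm_sq]
      have h5 : wc τ ≠ 0 := by rw [← norm_pos_iff, hnc]; exact hnpos τ hτ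
      have h6 := hw0 τ hτ
      have h7 : Complex.exp (Complex.I * ((-(2 * l * τ) : ℝ) : ℂ)) * (q τ / ((1 + τ : ℝ) : ℂ)) =
          wc τ / w τ / ((1 + τ : ℝ) : ℂ) := by
        simp only [hq]; linear_combination (wc τ / w τ / ((1 + τ : ℝ) : ℂ)) * h3
      rw [h7, Complex.ofReal_div, Complex.ofReal_div, Complex.ofReal_div, Complex.ofReal_div, h4]
      have h8 : wc τ * wc τ = ((v₁ τ ^ 2 - l ^ 2 * v τ ^ 2 : ℝ) : ℂ) +
          Complex.I * ((-(2 * l * v τ * v₁ τ) : ℝ) : ℂ) := by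
        simp only [hwc]; push_cast
        linear_combination ((l : ℂ) ^ 2 * v τ ^ 2) * Complex.I_sq
      push_cast at h1 h8 ⊢
      field_simp
      linear_combination h8
    have h9 := hpos τ hτ
    rw [h2, b_of_nonneg _ h0]
    simp only [Complex.add_re, Complex.ofReal_re, Complex.I_mul_re, Complex.ofReal_im, neg_zero,
      add_zero]
    field_simp
    ring

theorem isAmplitude_one_div {C s t : ℝ} (hs : 0 ≤ s) (hC : 1 ≤ C) :
    IsAmplitude C s t (fun τ => ((1 / (1 + τ) : ℝ) : ℂ)) (fun τ => ((-(1 / (1 + τ) ^ 2) : ℝ) : ℂ)) := by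
  refine ⟨fun τ hτ => ?_, fun τ hτ => ?_, fun τ hτ => ?_⟩
  · have := (hasDerivAt_neg_div_one_add 1 (hs.trans hτ.1)).neg.ofReal_comp
    convert! this using 1
    ext r; simp
  · have h0 : 0 ≤ τ := hs.trans hτ.1
    rw [Complex.norm_real, Real.norm_of_nonneg (by positivity)]
  · have h0 : 0 ≤ τ := hs.trans hτ.1
    rw [Complex.norm_real, norm_neg, Real.norm_of_nonneg (by positivity)]
    gcongr

theorem norm_integral_exp_mul_amplitude_le {C s t l : ℝ} {P P' : ℝ → ℂ} (hs : 0 ≤ s) (hst : s ≤ t)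
    (hC : 0 ≤ C) (hl : 0 < l) (hP : IsAmplitude C s t P P') :
    ‖∫ τ in s..t, Complex.exp (Complex.I * ((-(2 * l * τ) : ℝ) : ℂ)) * P τ‖ ≤
      (4 + C) / (2 * l * (1 + s)) := by
  refine norm_integral_exp_mul_le_of_le_abs (H := fun τ => -(2 * l * τ)) (G := fun _ => -(2 * l))
    (G₂ := fun _ => 0) (sg := 1) hs hst (by positivity) hC (by simp) (fun τ _ => ?_)
    (fun τ _ => hasDerivAt_const _ _) (by simp) (fun τ _ => ?_) hP.hasDerivAt hP.norm_le
    hP.norm_deriv_le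
  · convert! ((hasDerivAt_id τ).const_mul (2 * l)).neg using 1
    simp
  · rw [abs_neg, abs_of_pos (by positivity)]

theorem integral_one_div_one_add {s t : ℝ} (hs : 0 ≤ s) (hst : s ≤ t) :
    ∫ τ in s..t, 1 / (1 + τ) = Real.log ((1 + t) / (1 + s)) := by
  have h1 : ∀ τ ∈ uIcc s t, HasDerivAt (fun τ => Real.log (1 + τ)) (1 / (1 + τ)) τ := fun τ hτ => by
    rw [uIcc_of_le hst] at hτ
    have : 0 < 1 + τ := by linarith [hτ.1]
    exact ((hasDerivAt_id τ).const_add 1).log this.ne'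
  rw [intervalIntegral.integral_eq_sub_of_hasDerivAt h1, Real.log_div (by linarith) (by linarith)]
  refine ContinuousOn.intervalIntegrable fun τ hτ => ?_
  rw [uIcc_of_le hst] at hτ
  have : (1 + τ) ≠ 0 := by linarith [hτ.1]
  exact ContinuousAt.continuousWithinAt (by fun_prop (disch := assumption))

/-- The integral of the dissipation equals `m log (1 + t)` up to a bounded error. -/
theorem abs_integral_b_sub_le {s t X : ℝ} (hs : 0 ≤ s) (hst : s ≤ t)
    (hX : ‖∫ τ in s..t, ((D.σ (D.η τ) - D.m : ℝ) : ℂ) *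
      (Complex.exp (Complex.I * ((-(2 * 0 * τ) : ℝ) : ℂ)) * ((1 / (1 + τ) : ℝ) : ℂ))‖ ≤ X) :
    |(∫ τ in s..t, D.b τ) - D.m * Real.log ((1 + t) / (1 + s))| ≤ X := by
  have h1 : ∀ τ ∈ uIcc s t, (((D.b τ - D.m * (1 / (1 + τ)) : ℝ)) : ℂ) =
      ((D.σ (D.η τ) - D.m : ℝ) : ℂ) *
      (Complex.exp (Complex.I * ((-(2 * 0 * τ) : ℝ) : ℂ)) * ((1 / (1 + τ) : ℝ) : ℂ)) := by
    intro τ hτ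
    rw [uIcc_of_le hst] at hτ
    rw [b_of_nonneg _ (hs.trans hτ.1)]
    simp; ring
  rw [← intervalIntegral.integral_congr h1, intervalIntegral.integral_ofReal, Complex.norm_real,
    Real.norm_eq_abs, intervalIntegral.integral_sub (D.continuous_b.intervalIntegrable _ _),
    intervalIntegral.integral_const_mul, integral_one_div_one_add hs hst] at hX
  · exact hX
  · refine ContinuousOn.intervalIntegrable fun τ hτ => ?_
    rw [uIcc_of_le hst] at hτ
    have : (1 + τ) ≠ 0 := by linarith [hτ.1]
    exact ContinuousAt.continuousWithinAt (by fun_prop (disch := assumption))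

/-- Energy decay in the hyperbolic zone, where `l (1 + s)` is bounded below. The bound `X` is used for
`l' = l`, in the logarithmic derivative of the energy, and for `l' = 0`, in the integral of `b`. -/
theorem IsMode.energy_le_mul_exp {l s t : ℝ} {v v₁ : ℝ → ℝ} (h : D.IsMode l s t v v₁)
    (hs : 0 ≤ s) (hst : s ≤ t) (hl : 0 < l) (hm : 0 ≤ D.m) {B : ℝ} (hB0 : 0 ≤ B)
    (hB : ∀ x, |D.σ x| ≤ B) {X : ℝ}
    (hX : ∀ (l' : ℝ) (P P' : ℝ → ℂ), 0 ≤ l' → l' ≤ l → IsAmplitude (2 * B + 1) s t P P' →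
      ‖∫ τ in s..t, ((D.σ (D.η τ) - D.m : ℝ) : ℂ) *
        (Complex.exp (Complex.I * ((-(2 * l' * τ) : ℝ) : ℂ)) * P τ)‖ ≤ X) :
    l ^ 2 * v t ^ 2 + v₁ t ^ 2 ≤ (l ^ 2 * v s ^ 2 + v₁ s ^ 2) * ((1 + s) / (1 + t)) ^ D.m *
      Real.exp (2 * X + D.m * ((5 + 2 * B) / (2 * l * (1 + s)))) := by
  have hs1 : 0 < 1 + s := by linarith
  have ht1 : 0 < 1 + t := by linarith
  rcases (by positivity : 0 ≤ l ^ 2 * v s ^ 2 + v₁ s ^ 2).eq_or_lt with h0 | hN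
  · have := (h.energy_le_and_le hs hB0 hB ⟨hst, le_rfl⟩).1
    rw [← h0, zero_mul] at this
    rw [← h0, zero_mul, zero_mul]
    exact this
  obtain ⟨P, P', hP, hlog⟩ := h.exists_isAmplitude hs hB0 hB hN
  set E : ℝ → ℂ := fun τ => Complex.exp (Complex.I * ((-(2 * l * τ) : ℝ) : ℂ)) * P τ with hE
  have hEc : ContinuousOn E (uIcc s t) := by
    rw [uIcc_of_le hst]
    refine ContinuousOn.mul (Continuous.continuousOn ?_) hP.continuousOn
    fun_prop
  have hσc : Continuous fun τ => D.σ (D.η τ) := D.continuous_σ.comp D.continuous_η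
  have hσc' : Continuous fun τ => ((D.σ (D.η τ) - D.m : ℝ) : ℂ) := by fun_prop
  have hEi : IntervalIntegrable E volume s t := hEc.intervalIntegrable
  have hσEi : IntervalIntegrable (fun τ => ((D.σ (D.η τ) - D.m : ℝ) : ℂ) * E τ) volume s t :=
    (hσc'.continuousOn.mul hEc).intervalIntegrable
  have hσRe : IntervalIntegrable (fun τ => D.σ (D.η τ) * (E τ).re) volume s t :=
    (hσc.continuousOn.mul (Complex.continuous_re.comp_continuousOn hEc)).intervalIntegrable
  have hbi : IntervalIntegrable (fun τ => -D.b τ) volume s t :=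
    D.continuous_b.neg.intervalIntegrable _ _
  have h1 := intervalIntegral.integral_eq_sub_of_hasDerivAt
    (fun τ hτ => hlog τ (by rwa [uIcc_of_le hst] at hτ))
    (hbi.sub hσRe)
  rw [intervalIntegral.integral_sub hbi hσRe,
    intervalIntegral.integral_neg] at h1
  have h2 : ∫ τ in s..t, D.σ (D.η τ) * (E τ).re =
      (∫ τ in s..t, ((D.σ (D.η τ) - D.m : ℝ) : ℂ) * E τ).re + D.m * (∫ τ in s..t, E τ).re := by
    rw [← Complex.re_ofReal_mul, ← intervalIntegral.integral_const_mul, ← Complex.add_re,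
      ← intervalIntegral.integral_add hσEi (hEi.const_mul _)]
    have := (Complex.reCLM.intervalIntegral_comp_comm (μ := volume) (a := s) (b := t)
      (f := fun τ => ((D.σ (D.η τ) - D.m : ℝ) : ℂ) * E τ + (D.m : ℂ) * E τ)
      (hσEi.add (hEi.const_mul _)))
    simp only [Complex.reCLM_apply] at this
    rw [← this]
    refine intervalIntegral.integral_congr fun τ _ => ?_
    simp only [Complex.add_re, Complex.re_ofReal_mul]
    ring
  have h3 := abs_integral_b_sub_le hs hst
    (hX 0 _ _ le_rfl hl.le (isAmplitude_one_div hs (by linarith)))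
  have h4 := (Complex.abs_re_le_norm _).trans (hX l P P' hl.le le_rfl hP)
  have h5 := (Complex.abs_re_le_norm _).trans
    (norm_integral_exp_mul_amplitude_le hs hst (by linarith) hl hP)
  have h6 := mul_le_mul_of_nonneg_left (abs_le.1 h5).1 hm
  have h7 : 4 + (2 * B + 1) = 5 + 2 * B := by ring
  rw [h7] at h6
  have hNt : 0 < l ^ 2 * v t ^ 2 + v₁ t ^ 2 :=
    lt_of_lt_of_le (by positivity) (h.energy_le_and_le hs hB0 hB ⟨hst, le_rfl⟩).2
  rw [← Real.log_le_log_iff hNt (by positivity), Real.log_mul (by positivity) (by positivity),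
    Real.log_mul (by positivity) (by positivity), Real.log_exp, Real.log_rpow (by positivity)]
  have h8 : Real.log ((1 + s) / (1 + t)) = -Real.log ((1 + t) / (1 + s)) := by
    rw [← Real.log_inv, inv_div]
  have h3' := (abs_le.1 h3).1
  have h4' := (abs_le.1 h4).1
  rw [h8]
  change -X ≤ (∫ τ in s..t, ((D.σ (D.η τ) - D.m : ℝ) : ℂ) * E τ).re at h4'
  change D.m * -((5 + 2 * B) / (2 * l * (1 + s))) ≤ D.m * (∫ τ in s..t, E τ).re at h6
  rw [h2] at h1
  linarith

end Damping

namespace Damping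

variable {D : Damping}

/-- `τ ↦ (2 (1+τ)^{1-p} - (1+τ)^{1-2p}) / p` grows at least as fast as a primitive of
`(1+τ)^{-2p}`, for all `0 < p ≤ 1`, without logarithms at `p = 1/2`. -/
theorem hasDerivAt_rpow_sub_rpow {p r : ℝ} (hr : 0 ≤ r) :
    HasDerivAt (fun r => 1 / p * (2 * (1 + r) ^ (1 - p) - (1 + r) ^ (1 - 2 * p)))
      (1 / p * (2 * (1 - p) * (1 + r) ^ (-p) - (1 - 2 * p) * (1 + r) ^ (-(2 * p)))) r := by
  have h0 : (1 + r) ≠ 0 := by positivity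
  have hd : HasDerivAt (fun r : ℝ => 1 + r) 1 r := (hasDerivAt_id r).const_add 1
  have e1 := hd.rpow_const (p := 1 - p) (Or.inl h0)
  have e2 := hd.rpow_const (p := 1 - 2 * p) (Or.inl h0)
  convert! ((e1.const_mul 2).sub e2).const_mul (1 / p) using 1
  rw [show 1 - p - 1 = -p by ring, show 1 - 2 * p - 1 = -(2 * p) by ring]
  ring

theorem rpow_neg_le_deriv {p m r : ℝ} (hr : 0 ≤ r) (hp : 0 < p) (hp1 : p ≤ 1) (hm : 2 * p ≤ m) :
    (1 + r) ^ (-m) ≤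
      1 / p * (2 * (1 - p) * (1 + r) ^ (-p) - (1 - 2 * p) * (1 + r) ^ (-(2 * p))) := by
  have h1 : (1 : ℝ) ≤ 1 + r := by linarith
  have e1 : (1 + r) ^ (-m) ≤ (1 + r) ^ (-(2 * p)) :=
    Real.rpow_le_rpow_of_exponent_le h1 (by linarith)
  have e2 : (1 + r) ^ (-(2 * p)) ≤ (1 + r) ^ (-p) :=
    Real.rpow_le_rpow_of_exponent_le h1 (by linarith)
  have e3 : 0 < (1 + r) ^ (-(2 * p)) := Real.rpow_pos_of_pos (by linarith) _
  rw [one_div, ← div_eq_inv_mul, le_div_iff₀ hp]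
  nlinarith [mul_le_mul_of_nonneg_right e1 hp.le, mul_le_mul_of_nonneg_left e2 (by linarith : 0 ≤ 1 - p)]

/-- Bounds for a mode in the dissipative zone `l (1 + t) ≲ 1`. -/
theorem IsMode.low_frequency_bounds {l t p X V : ℝ} {v v₁ : ℝ → ℝ} (h : D.IsMode l 0 t v v₁)
    (ht : 0 ≤ t) (hm : 0 ≤ D.m) (hp : 0 < p) (hp1 : p ≤ 1) (hpm : 2 * p ≤ D.m)
    (hX : ∀ s τ, 0 ≤ s → s ≤ τ →
      |(∫ r in s..τ, D.b r) - D.m * Real.log ((1 + τ) / (1 + s))| ≤ X)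
    (hV : ∀ τ ∈ Icc 0 t, |v τ| ≤ V) :
    (∀ τ ∈ Icc 0 t, |v₁ τ| ≤
      Real.exp X * ((1 + τ) ^ (-D.m) * |v₁ 0| + l ^ 2 * (1 + t) * V)) ∧
    ∀ τ ∈ Icc 0 t, |v τ| ≤ |v 0| + Real.exp X *
      (2 / p * (1 + t) ^ (1 - p) * |v₁ 0| + l ^ 2 * (1 + t) ^ 2 * V) := by
  have hV0 : 0 ≤ V := (abs_nonneg _).trans (hV 0 ⟨le_rfl, ht⟩)
  set A : ℝ → ℝ := fun τ => ∫ r in (0 : ℝ)..τ, D.b r with hA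
  have hA0 : A 0 = 0 := intervalIntegral.integral_same
  have hAd : ∀ τ, HasDerivAt A (D.b τ) τ := fun τ =>
    (D.continuous_b.integral_hasStrictDerivAt 0 τ).hasDerivAt
  have hAs : ∀ s τ, A τ - A s = ∫ r in s..τ, D.b r := fun s τ =>
    intervalIntegral.integral_interval_sub_left (D.continuous_b.intervalIntegrable _ _)
      (D.continuous_b.intervalIntegrable _ _)
  have hratio : ∀ s τ, 0 ≤ s → s ≤ τ → A s - A τ ≤ X := fun s τ hs hsτ => by
    have h1 := (abs_le.1 (hX s τ hs hsτ)).1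
    have h2 : 0 ≤ Real.log ((1 + τ) / (1 + s)) :=
      Real.log_nonneg ((one_le_div (by linarith)).2 (by linarith))
    have := mul_nonneg hm h2
    linarith [hAs s τ]
  have hinv : ∀ τ, 0 ≤ τ → Real.exp (-A τ) ≤ Real.exp X * (1 + τ) ^ (-D.m) := fun τ hτ => by
    have h1 := (abs_le.1 (hX 0 τ le_rfl hτ)).1
    rw [Real.rpow_def_of_pos (by linarith), ← Real.exp_add]
    refine Real.exp_le_exp.2 ?_
    rw [add_zero, div_one] at h1
    have : A τ = ∫ r in (0 : ℝ)..τ, D.b r := rfl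
    linarith
  have first : ∀ τ ∈ Icc 0 t, |v₁ τ| ≤
      Real.exp X * ((1 + τ) ^ (-D.m) * |v₁ 0| + l ^ 2 * (1 + t) * V) := by
    intro τ hτ
    have key := norm_sub_le_sub_of_norm_deriv_le (f := fun r => Real.exp (A r) * v₁ r)
      (f' := fun r => Real.exp (A r) * D.b r * v₁ r + Real.exp (A r) *
        (-(l ^ 2 * v r) - D.b r * v₁ r))
      (g := fun r => l ^ 2 * V * (Real.exp X * Real.exp (A τ)) * r)
      (g' := fun r => l ^ 2 * V * (Real.exp X * Real.exp (A τ)))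
      hτ.1 (fun r hr => ((hAd r).exp).mul (h.2 r ⟨hr.1, hr.2.trans hτ.2⟩))
      (fun r _ => by simpa using (hasDerivAt_id r).const_mul (l ^ 2 * V * (Real.exp X * Real.exp (A τ))))
      (fun r hr => by
        rw [show Real.exp (A r) * D.b r * v₁ r + Real.exp (A r) *
          (-(l ^ 2 * v r) - D.b r * v₁ r) = -(l ^ 2 * v r * Real.exp (A r)) by ring, norm_neg,
          norm_mul, norm_mul, Real.norm_of_nonneg (sq_nonneg l), Real.norm_of_nonneg (Real.exp_pos _).le,
          ← Real.exp_add]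
        gcongr
        · exact hV r ⟨hr.1, hr.2.trans hτ.2⟩
        · linarith [hratio r τ hr.1 hr.2])
    simp only [hA0, Real.exp_zero, one_mul, mul_zero, sub_zero] at key
    have h1 : |Real.exp (A τ) * v₁ τ| ≤ |v₁ 0| + l ^ 2 * V * (Real.exp X * Real.exp (A τ)) * τ := by
      have := abs_sub_abs_le_abs_sub (Real.exp (A τ) * v₁ τ) (v₁ 0)
      rw [Real.norm_eq_abs] at key
      linarith
    rw [abs_mul, abs_of_pos (Real.exp_pos _)] at h1
    have h2 : |v₁ τ| = Real.exp (-A τ) * (Real.exp (A τ) * |v₁ τ|) := by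
      rw [← mul_assoc, ← Real.exp_add, neg_add_cancel, Real.exp_zero, one_mul]
    rw [h2]
    calc _ ≤ Real.exp (-A τ) * (|v₁ 0| + l ^ 2 * V * (Real.exp X * Real.exp (A τ)) * τ) := by gcongr
      _ = Real.exp (-A τ) * |v₁ 0| + Real.exp X * (l ^ 2 * τ * V) *
          (Real.exp (-A τ) * Real.exp (A τ)) := by ring
      _ = Real.exp (-A τ) * |v₁ 0| + Real.exp X * (l ^ 2 * τ * V) := by
          rw [← Real.exp_add, neg_add_cancel, Real.exp_zero, mul_one]
      _ ≤ Real.exp X * (1 + τ) ^ (-D.m) * |v₁ 0| + Real.exp X * (l ^ 2 * (1 + t) * V) := by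
          gcongr
          · exact hinv τ hτ.1
          · linarith [hτ.2]
      _ = _ := by ring
  refine ⟨first, fun τ hτ => ?_⟩
  have key := norm_sub_le_sub_of_norm_deriv_le (f := v) (f' := v₁)
    (g := fun r => Real.exp X * (1 / p * (2 * (1 + r) ^ (1 - p) - (1 + r) ^ (1 - 2 * p)) * |v₁ 0| +
      l ^ 2 * (1 + t) * V * r))
    (g' := fun r => Real.exp X * (1 / p * (2 * (1 - p) * (1 + r) ^ (-p) -
      (1 - 2 * p) * (1 + r) ^ (-(2 * p))) * |v₁ 0| + l ^ 2 * (1 + t) * V))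
    hτ.1 (fun r hr => h.1 r ⟨hr.1, hr.2.trans hτ.2⟩)
    (fun r hr => (((hasDerivAt_rpow_sub_rpow hr.1).mul_const _).add
      (by simpa using (hasDerivAt_id r).const_mul (l ^ 2 * (1 + t) * V))).const_mul _)
    (fun r hr => (first r ⟨hr.1, hr.2.trans hτ.2⟩).trans (by
      gcongr
      exact rpow_neg_le_deriv hr.1 hp hp1 hpm))
  have h1 := abs_sub_abs_le_abs_sub (v τ) (v 0)
  rw [Real.norm_eq_abs] at key
  simp only [add_zero, Real.one_rpow, mul_zero] at key
  have h2 : (1 + τ) ^ (1 - p) ≤ (1 + t) ^ (1 - p) :=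
    Real.rpow_le_rpow (by linarith [hτ.1]) (by linarith [hτ.2]) (by linarith)
  have h3 : 0 ≤ (1 + τ) ^ (1 - 2 * p) := Real.rpow_nonneg (by linarith [hτ.1]) _
  have h4 : 1 / p * (2 * (1 + τ) ^ (1 - p) - (1 + τ) ^ (1 - 2 * p)) - 1 / p * (2 * 1 - 1) ≤
      2 / p * (1 + t) ^ (1 - p) := by
    rw [← mul_sub, show 2 / p * (1 + t) ^ (1 - p) = 1 / p * (2 * (1 + t) ^ (1 - p)) by ring]
    exact mul_le_mul_of_nonneg_left (by linarith) (by positivity)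
  have h5 : l ^ 2 * (1 + t) * V * τ ≤ l ^ 2 * (1 + t) ^ 2 * V := by
    rw [sq (1 + t), ← mul_assoc, mul_assoc _ V, mul_assoc _ (1 + t) V, mul_comm V]
    gcongr
    linarith [hτ.2]
  calc |v τ| ≤ |v 0| + Real.exp X * ((1 / p * (2 * (1 + τ) ^ (1 - p) - (1 + τ) ^ (1 - 2 * p)) -
        1 / p * (2 * 1 - 1)) * |v₁ 0| + l ^ 2 * (1 + t) * V * τ) := by linarith
    _ ≤ _ := by gcongr

/-- Energy decay in the dissipative zone. -/
theorem IsMode.energy_le_of_low_frequency {l t p X : ℝ} {v v₁ : ℝ → ℝ} (h : D.IsMode l 0 t v v₁)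
    (ht : 0 ≤ t) (hl : 0 < l) (hp : 0 < p) (hp1 : p ≤ 1) (hpm : 2 * p ≤ D.m)
    (hX0 : 0 ≤ X) (hX : ∀ s τ, 0 ≤ s → s ≤ τ →
      |(∫ r in s..τ, D.b r) - D.m * Real.log ((1 + τ) / (1 + s))| ≤ X)
    (hlt : 2 * Real.exp X * (l * (1 + t)) ≤ 1) :
    l ^ 2 * v t ^ 2 + v₁ t ^ 2 ≤ 2 * (4 + 9 * Real.exp X ^ 2) * (Real.exp X * (2 / p) + 1) ^ 2 *
      (1 + t) ^ (-(2 * p)) * (l ^ (2 - 2 * p) * v 0 ^ 2 + v₁ 0 ^ 2) := by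
  have hc : ContinuousOn (fun τ => |v τ|) (Icc 0 t) := fun τ hτ =>
    (h.1 τ hτ).continuousAt.abs.continuousWithinAt
  obtain ⟨τ₀, hτ₀, hmax⟩ := isCompact_Icc.exists_isMaxOn ⟨0, ⟨le_rfl, ht⟩⟩ hc
  set V := |v τ₀| with hV
  have hV0 : 0 ≤ V := abs_nonneg _
  obtain ⟨b1, b2⟩ := h.low_frequency_bounds ht (by linarith) hp hp1 hpm hX (V := V)
    (fun τ hτ => hmax hτ)
  set y := 1 + t with hy
  have hy1 : 1 ≤ y := by linarith
  have hy0 : 0 < y := by linarith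
  have heX : 1 ≤ Real.exp X := Real.one_le_exp hX0
  set c := Real.exp X * (2 / p) with hc'
  have hc0 : 0 ≤ c := by positivity
  have hly : l * y ≤ 1 := by nlinarith [mul_pos hl hy0]
  have hly0 : 0 < l * y := by positivity
  -- the term with `V` on the right is absorbed
  have hVle : V ≤ 2 * (|v 0| + c * y ^ (1 - p) * |v₁ 0|) := by
    have h1 := b2 τ₀ hτ₀
    have h2 : Real.exp X * (l ^ 2 * y ^ 2 * V) ≤ V / 2 := by
      have : Real.exp X * (l ^ 2 * y ^ 2) ≤ 1 / 2 := by nlinarith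
      nlinarith
    have h3 : Real.exp X * (2 / p * y ^ (1 - p) * |v₁ 0| + l ^ 2 * y ^ 2 * V) =
      c * y ^ (1 - p) * |v₁ 0| + Real.exp X * (l ^ 2 * y ^ 2 * V) := by rw [hc']; ring
    rw [h3] at h1
    linarith
  set W := y ^ (-p) * (l ^ (1 - p) * |v 0| + (c + 1) * |v₁ 0|) with hW
  have hlp : l ^ p ≤ y ^ (-p) := by
    rw [Real.rpow_neg hy0.le, ← Real.inv_rpow hy0.le]
    refine Real.rpow_le_rpow hl.le ?_ hp.le
    rw [← one_div, le_div_iff₀ hy0]; exact hly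
  have hyp : 0 < y ^ (-p) := Real.rpow_pos_of_pos hy0 _
  have hlp1 : 0 < l ^ (1 - p) := Real.rpow_pos_of_pos hl _
  have hW0 : 0 ≤ W := by positivity
  have hlV : l * V ≤ 2 * W := by
    have e1 : l = l ^ (1 - p) * l ^ p := by rw [← Real.rpow_add hl]; simp
    have e2 : l * |v 0| ≤ y ^ (-p) * (l ^ (1 - p) * |v 0|) := by
      calc l * |v 0| = l ^ (1 - p) * l ^ p * |v 0| := by rw [← e1]
        _ ≤ l ^ (1 - p) * y ^ (-p) * |v 0| := by gcongr
        _ = _ := by ring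
    have e3 : l * y ^ (1 - p) ≤ y ^ (-p) := by
      rw [sub_eq_add_neg, Real.rpow_add hy0, Real.rpow_one, ← mul_assoc]
      exact mul_le_of_le_one_left hyp.le hly
    have e4 : l * (c * y ^ (1 - p) * |v₁ 0|) ≤ y ^ (-p) * ((c + 1) * |v₁ 0|) := by
      calc l * (c * y ^ (1 - p) * |v₁ 0|) = l * y ^ (1 - p) * (c * |v₁ 0|) := by ring
        _ ≤ y ^ (-p) * ((c + 1) * |v₁ 0|) := by gcongr; linarith
    calc l * V ≤ l * (2 * (|v 0| + c * y ^ (1 - p) * |v₁ 0|)) := by gcongr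
      _ = 2 * (l * |v 0| + l * (c * y ^ (1 - p) * |v₁ 0|)) := by ring
      _ ≤ 2 * (y ^ (-p) * (l ^ (1 - p) * |v 0|) + y ^ (-p) * ((c + 1) * |v₁ 0|)) := by gcongr
      _ = 2 * W := by rw [hW]; ring
  have hvt : |l * v t| ≤ 2 * W := by
    rw [abs_mul, abs_of_pos hl]
    exact (mul_le_mul_of_nonneg_left (hmax ⟨ht, le_rfl⟩) hl.le).trans hlV
  have hv₁t : |v₁ t| ≤ 3 * Real.exp X * W := by
    have h1 := b1 t ⟨ht, le_rfl⟩
    have h2 : y ^ (-D.m) * |v₁ 0| ≤ W := by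
      have : y ^ (-D.m) ≤ y ^ (-p) := Real.rpow_le_rpow_of_exponent_le hy1 (by linarith)
      calc y ^ (-D.m) * |v₁ 0| ≤ y ^ (-p) * |v₁ 0| := by gcongr
        _ ≤ W := by
          rw [hW]; gcongr
          have : 0 ≤ c * |v₁ 0| := by positivity
          have : 0 ≤ l ^ (1 - p) * |v 0| := by positivity
          linarith
    have h3 : l ^ 2 * y * V ≤ 2 * W := by
      calc l ^ 2 * y * V = (l * y) * (l * V) := by ring
        _ ≤ 1 * (2 * W) := by gcongr
        _ = _ := one_mul _
    calc |v₁ t| ≤ _ := h1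
      _ ≤ Real.exp X * (W + 2 * W) := by gcongr
      _ = _ := by ring
  have hNW : l ^ 2 * v t ^ 2 + v₁ t ^ 2 ≤ (4 + 9 * Real.exp X ^ 2) * W ^ 2 := by
    have h1 : (l * v t) ^ 2 ≤ (2 * W) ^ 2 := sq_le_sq' (by linarith [(abs_le.1 hvt).1]) (abs_le.1 hvt).2
    have h2 : v₁ t ^ 2 ≤ (3 * Real.exp X * W) ^ 2 :=
      sq_le_sq' (by linarith [(abs_le.1 hv₁t).1]) (abs_le.1 hv₁t).2
    linear_combination h1 + h2
  have hW2 : W ^ 2 ≤ y ^ (-(2 * p)) * (2 * (c + 1) ^ 2 * (l ^ (2 - 2 * p) * v 0 ^ 2 + v₁ 0 ^ 2)) := by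
    have e1 : (y ^ (-p)) ^ 2 = y ^ (-(2 * p)) := by
      rw [← Real.rpow_natCast, ← Real.rpow_mul hy0.le]; congr 1; push_cast; ring
    have e2 : (l ^ (1 - p)) ^ 2 = l ^ (2 - 2 * p) := by
      rw [← Real.rpow_natCast, ← Real.rpow_mul hl.le]; congr 1; push_cast; ring
    rw [hW, mul_pow, e1]
    gcongr
    have e3 := add_sq_le (a := l ^ (1 - p) * |v 0|) (b := (c + 1) * |v₁ 0|)
    rw [mul_pow, mul_pow, e2, sq_abs, sq_abs] at e3
    have e4 : 0 ≤ l ^ (2 - 2 * p) * v 0 ^ 2 := by positivity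
    have e5 : l ^ (2 - 2 * p) * v 0 ^ 2 ≤ (c + 1) ^ 2 * (l ^ (2 - 2 * p) * v 0 ^ 2) :=
      le_mul_of_one_le_left e4 (one_le_pow₀ (by linarith))
    linear_combination e3 + 2 * e5
  calc _ ≤ _ := hNW
    _ ≤ (4 + 9 * Real.exp X ^ 2) * (y ^ (-(2 * p)) *
        (2 * (c + 1) ^ 2 * (l ^ (2 - 2 * p) * v 0 ^ 2 + v₁ 0 ^ 2))) := by gcongr
    _ = _ := by ring

/-- The decay estimate for a single frequency. A mode of frequency `l` passes from the dissipative
to the hyperbolic zone when `1 + t` is comparable to `1 / l`. Low frequencies suffer no resonance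
afterwards; the other ones enter the hyperbolic zone before a fixed time. -/
theorem exists_energy_le {p ε : ℝ} (hp : 0 < p) (hp1 : p ≤ 1) (hpm : 2 * p ≤ D.m) (hε : 0 < ε) :
    ∃ C : ℝ, 0 < C ∧ ∀ (l t μ : ℝ) (v v₁ : ℝ → ℝ), 0 < l → 0 ≤ t → 0 ≤ μ →
      (∀ τ ∈ Icc 0 t, 1 / (1 + τ) ≤ μ * D.η₂ τ) → D.IsMode l 0 t v v₁ →
      l ^ 2 * v t ^ 2 + v₁ t ^ 2 ≤
        C * ((1 + t) ^ (-(2 * p)) + Real.exp (ε * μ) * (1 + t) ^ (-D.m)) *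
          (l ^ (2 - 2 * p) * v 0 ^ 2 + l ^ 2 * v 0 ^ 2 + v₁ 0 ^ 2) := by
  have hm : 0 ≤ D.m := by linarith
  obtain ⟨B, hB0, hB⟩ := D.exists_abs_σ_le
  have hC : (0 : ℝ) ≤ 2 * B + 1 := by positivity
  obtain ⟨l₀, hl₀, X, hX0, hX⟩ := D.exists_norm_integral_sub_m_le_of_small hC
  obtain ⟨C₁, hC₁, hY⟩ := D.exists_norm_integral_sub_m_le_add hC (half_pos hε)
  have hXb : ∀ s τ, 0 ≤ s → s ≤ τ →
      |(∫ r in s..τ, D.b r) - D.m * Real.log ((1 + τ) / (1 + s))| ≤ X := fun s τ hs hsτ =>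
    abs_integral_b_sub_le hs hsτ (hX s τ 0 _ _ hs hsτ le_rfl hl₀.le
      (isAmplitude_one_div hs (by linarith)))
  set N := 1 / (2 * Real.exp X) with hN
  have hN0 : 0 < N := by positivity
  have hNX : 2 * Real.exp X * N = 1 := by rw [hN]; field_simp
  set Z := D.m * ((5 + 2 * B) / (2 * N)) with hZ
  set C₂ := 2 * (4 + 9 * Real.exp X ^ 2) * (Real.exp X * (2 / p) + 1) ^ 2 with hC₂
  have hC₂0 : 0 < C₂ := by positivity
  set Q := (N / l₀) ^ (D.m - 2 * p) with hQ
  have hQ0 : 0 < Q := Real.rpow_pos_of_pos (by positivity) _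
  refine ⟨C₂ + C₂ * Real.exp (2 * X + Z) + C₂ * Real.exp (2 * C₁ + Z) * Q + Real.exp (2 * C₁ + Z),
    by positivity, fun l t μ v v₁ hl ht hμ hη h => ?_⟩
  set y := 1 + t with hy
  have hy1 : 1 ≤ y := by linarith
  have hy0 : 0 < y := by linarith
  set d := l ^ (2 - 2 * p) * v 0 ^ 2 + l ^ 2 * v 0 ^ 2 + v₁ 0 ^ 2 with hd
  have hlp : 0 < l ^ (2 - 2 * p) := Real.rpow_pos_of_pos hl _
  have hd0 : 0 ≤ d := by positivity
  set a := y ^ (-(2 * p)) with ha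
  set e := Real.exp (ε * μ) * y ^ (-D.m) with he
  have ha0 : 0 < a := Real.rpow_pos_of_pos hy0 _
  have he0 : 0 < e := mul_pos (Real.exp_pos _) (Real.rpow_pos_of_pos hy0 _)
  set E₁ := Real.exp (2 * X + Z) with hE₁
  set E₂ := Real.exp (2 * C₁ + Z) with hE₂
  have hE₁0 : 0 < E₁ := Real.exp_pos _
  have hE₂0 : 0 < E₂ := Real.exp_pos _
  have expand : (C₂ + C₂ * E₁ + C₂ * E₂ * Q + E₂) * (a + e) * d =
      C₂ * a * d + C₂ * E₁ * a * d + C₂ * E₂ * Q * e * d + E₂ * e * d +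
      (C₂ * e * d + C₂ * E₁ * e * d + C₂ * E₂ * Q * a * d + E₂ * a * d) := by ring
  rw [expand]
  have n1 : 0 ≤ C₂ * a * d := by positivity
  have n2 : 0 ≤ C₂ * E₁ * a * d := by positivity
  have n3 : 0 ≤ C₂ * E₂ * Q * e * d := by positivity
  have n4 : 0 ≤ E₂ * e * d := by positivity
  have n5 : 0 ≤ C₂ * e * d + C₂ * E₁ * e * d + C₂ * E₂ * Q * a * d + E₂ * a * d := by positivity
  -- the bound in the dissipative zone, up to its end
  have low : ∀ s, 0 ≤ s → s ≤ t → l * (1 + s) ≤ N →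
      l ^ 2 * v s ^ 2 + v₁ s ^ 2 ≤ C₂ * (1 + s) ^ (-(2 * p)) * d := fun s hs hst hls => by
    have := (h.mono le_rfl hst).energy_le_of_low_frequency hs hl hp hp1 hpm hX0 hXb
      ((mul_le_mul_of_nonneg_left hls (by positivity)).trans hNX.le)
    refine this.trans ?_
    have : 0 ≤ (1 + s) ^ (-(2 * p)) := Real.rpow_nonneg (by linarith) _
    gcongr
    have : 0 ≤ l ^ 2 * v 0 ^ 2 := by positivity
    linarith
  -- the bound in the hyperbolic zone, from its beginning
  have high : ∀ s Y, 0 ≤ s → s ≤ t → N ≤ l * (1 + s) →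
      (∀ (l' : ℝ) (P P' : ℝ → ℂ), 0 ≤ l' → l' ≤ l → IsAmplitude (2 * B + 1) s t P P' →
      ‖∫ τ in s..t, ((D.σ (D.η τ) - D.m : ℝ) : ℂ) *
        (Complex.exp (Complex.I * ((-(2 * l' * τ) : ℝ) : ℂ)) * P τ)‖ ≤ Y) →
      l ^ 2 * v t ^ 2 + v₁ t ^ 2 ≤ (l ^ 2 * v s ^ 2 + v₁ s ^ 2) * ((1 + s) ^ D.m * y ^ (-D.m)) *
        Real.exp (2 * Y + Z) := fun s Y hs hst hls hY' => by
    have := (h.mono hs le_rfl).energy_le_mul_exp hs hst hl hm hB0 hB hY'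
    refine this.trans ?_
    rw [Real.div_rpow (by linarith) hy0.le, Real.rpow_neg hy0.le, ← div_eq_mul_inv]
    have : 0 ≤ (1 + s) ^ D.m / y ^ D.m :=
      div_nonneg (Real.rpow_nonneg (by linarith) _) (Real.rpow_nonneg hy0.le _)
    rw [hZ]
    gcongr _ * _ * Real.exp (_ + _ * (_ / ?_))
    rw [mul_assoc]; gcongr
  have hYs : ∀ s, 0 ≤ s → s ≤ t → ∀ (l' : ℝ) (P P' : ℝ → ℂ), 0 ≤ l' → l' ≤ l →
      IsAmplitude (2 * B + 1) s t P P' →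
      ‖∫ τ in s..t, ((D.σ (D.η τ) - D.m : ℝ) : ℂ) *
        (Complex.exp (Complex.I * ((-(2 * l' * τ) : ℝ) : ℂ)) * P τ)‖ ≤ C₁ + ε / 2 * μ :=
    fun s hs hst l' P P' _ _ hP => hY s t l' μ P P' hs hst hμ
      (fun τ hτ => hη τ ⟨hs.trans hτ.1, hτ.2⟩) hP
  have hexp : Real.exp (2 * (C₁ + ε / 2 * μ) + Z) = E₂ * Real.exp (ε * μ) := by
    rw [hE₂, ← Real.exp_add]; congr 1; ring
  by_cases h1 : l * y ≤ N
  · linarith [low t ht le_rfl h1]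
  by_cases h2 : N ≤ l
  · have := high 0 _ le_rfl ht (by linarith) (hYs 0 le_rfl ht)
    rw [hexp, add_zero, Real.one_rpow, one_mul] at this
    have h3 : l ^ 2 * v 0 ^ 2 + v₁ 0 ^ 2 ≤ d := by
      have : 0 ≤ l ^ (2 - 2 * p) * v 0 ^ 2 := by positivity
      rw [hd]; linarith
    have h4 : (l ^ 2 * v 0 ^ 2 + v₁ 0 ^ 2) * y ^ (-D.m) * (E₂ * Real.exp (ε * μ)) ≤ E₂ * e * d := by
      calc _ = (l ^ 2 * v 0 ^ 2 + v₁ 0 ^ 2) * (E₂ * e) := by rw [he]; ring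
        _ ≤ d * (E₂ * e) := by gcongr
        _ = _ := by ring
    linarith
  push Not at h1 h2
  set s := N / l - 1 with hs
  have hs1 : 1 + s = N / l := by rw [hs]; ring
  have hls : l * (1 + s) = N := by rw [hs1]; field_simp
  have hs0 : 0 ≤ s := by
    have := (one_lt_div hl).2 h2
    rw [hs]; linarith
  have hst : s ≤ t := by
    have : N / l < y := (div_lt_iff₀ hl).2 (by linarith)
    linarith
  have hs10 : 0 < 1 + s := by linarith
  have lows := low s hs0 hst hls.le
  have hpow : (1 + s) ^ (-(2 * p)) * (1 + s) ^ D.m = (1 + s) ^ (D.m - 2 * p) := by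
    rw [← Real.rpow_add hs10]; congr 1; ring
  have hym : 0 < y ^ (-D.m) := Real.rpow_pos_of_pos hy0 _
  have hsm : 0 < (1 + s) ^ D.m := Real.rpow_pos_of_pos hs10 _
  rcases le_or_gt l l₀ with h3 | h3
  · have := high s X hs0 hst hls.ge fun l' P P' hl' hl'l hP =>
      hX s t l' P P' hs0 hst hl' (hl'l.trans h3) hP
    have h4 : (1 + s) ^ (D.m - 2 * p) * y ^ (-D.m) ≤ a := by
      calc _ ≤ y ^ (D.m - 2 * p) * y ^ (-D.m) := by
            gcongr
            linarith
        _ = a := by rw [← Real.rpow_add hy0, ha]; congr 1; ring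
    have h5 : (l ^ 2 * v s ^ 2 + v₁ s ^ 2) * ((1 + s) ^ D.m * y ^ (-D.m)) * E₁ ≤
        C₂ * E₁ * a * d := by
      calc _ ≤ (C₂ * (1 + s) ^ (-(2 * p)) * d) * ((1 + s) ^ D.m * y ^ (-D.m)) * E₁ := by gcongr
        _ = C₂ * E₁ * (((1 + s) ^ (-(2 * p)) * (1 + s) ^ D.m) * y ^ (-D.m)) * d := by ring
        _ ≤ _ := by rw [hpow]; gcongr
    linarith
  · have := high s _ hs0 hst hls.ge (hYs s hs0 hst)
    rw [hexp] at this
    have h4 : (1 + s) ^ (D.m - 2 * p) ≤ Q := by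
      rw [hs1, hQ]
      gcongr
    have h5 : (l ^ 2 * v s ^ 2 + v₁ s ^ 2) * ((1 + s) ^ D.m * y ^ (-D.m)) *
        (E₂ * Real.exp (ε * μ)) ≤ C₂ * E₂ * Q * e * d := by
      calc _ ≤ (C₂ * (1 + s) ^ (-(2 * p)) * d) * ((1 + s) ^ D.m * y ^ (-D.m)) *
            (E₂ * Real.exp (ε * μ)) := by gcongr
        _ = C₂ * E₂ * ((1 + s) ^ (-(2 * p)) * (1 + s) ^ D.m) * e * d := by rw [he]; ring
        _ ≤ _ := by rw [hpow]; gcongr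
    linarith

end Damping

open scoped BoundedContinuousFunction

/-! ### Linear differential equations in Banach spaces -/

section LinearODE

variable {V : Type*} [NormedAddCommGroup V] [NormedSpace ℝ V]

/-- The radial retraction onto the ball of radius `R`. -/
noncomputable def radialRetraction (R : ℝ) (x : V) : V := (R / max R ‖x‖) • x

theorem radialRetraction_of_norm_le {R : ℝ} (hR : 0 < R) {x : V} (hx : ‖x‖ ≤ R) :
    radialRetraction R x = x := by
  rw [radialRetraction, max_eq_left hx, div_self hR.ne', one_smul]

theorem norm_radialRetraction_le {R : ℝ} (hR : 0 < R) (x : V) :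
    ‖radialRetraction R x‖ ≤ ‖x‖ ∧ ‖radialRetraction R x‖ ≤ R := by
  have h1 : 0 < max R ‖x‖ := lt_max_of_lt_left hR
  rw [radialRetraction, norm_smul, Real.norm_of_nonneg (by positivity)]
  constructor
  · exact mul_le_of_le_one_left (norm_nonneg _) ((div_le_one h1).2 (le_max_left _ _))
  · rw [div_mul_eq_mul_div, div_le_iff₀ h1]
    gcongr
    exact le_max_right _ _

theorem norm_radialRetraction_sub_le {R : ℝ} (hR : 0 < R) (x y : V) :
    ‖radialRetraction R x - radialRetraction R y‖ ≤ 2 * ‖x - y‖ := by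
  have hx : 0 < max R ‖x‖ := lt_max_of_lt_left hR
  have hy : 0 < max R ‖y‖ := lt_max_of_lt_left hR
  have e : radialRetraction R x - radialRetraction R y =
      (R / max R ‖x‖) • (x - y) + (R / max R ‖x‖ - R / max R ‖y‖) • y := by
    rw [radialRetraction, radialRetraction, smul_sub, sub_smul]; abel
  have h1 : R / max R ‖x‖ ≤ 1 := (div_le_one hx).2 (le_max_left _ _)
  have h2 : |max R ‖y‖ - max R ‖x‖| ≤ ‖x - y‖ := by
    refine (abs_max_sub_max_le_max R ‖y‖ R ‖x‖).trans ?_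
    rw [sub_self, abs_zero, max_eq_right (abs_nonneg _), abs_sub_comm]
    exact abs_norm_sub_norm_le x y
  have h3 : |R / max R ‖x‖ - R / max R ‖y‖| * ‖y‖ ≤ ‖x - y‖ := by
    rw [div_sub_div _ _ hx.ne' hy.ne', show R * max R ‖y‖ - max R ‖x‖ * R =
      (max R ‖y‖ - max R ‖x‖) * R by ring, abs_div, abs_mul, abs_of_pos hR, abs_of_pos (mul_pos hx hy)]
    calc |max R ‖y‖ - max R ‖x‖| * R / (max R ‖x‖ * max R ‖y‖) * ‖y‖
        = |max R ‖y‖ - max R ‖x‖| * (R / max R ‖x‖) * (‖y‖ / max R ‖y‖) := by ring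
      _ ≤ ‖x - y‖ * 1 * 1 := by
          gcongr
          exact (div_le_one hy).2 (le_max_right _ _)
      _ = _ := by ring
  rw [e]
  refine (norm_add_le _ _).trans ?_
  rw [norm_smul, norm_smul, Real.norm_of_nonneg (by positivity), Real.norm_eq_abs]
  have := mul_le_of_le_one_left (norm_nonneg (x - y)) h1
  linarith

/-- Global existence for linear equations with continuous coefficients. The Picard–Lindelöf theorem
is applied to the equation truncated outside a ball which, by Grönwall's inequality, the solution
does not leave. -/
theorem exists_hasDerivAt_linear [CompleteSpace V] {A : ℝ → V →L[ℝ] V} (hA : Continuous A) (x₀ : V)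
    {T : ℝ} (hT : 0 ≤ T) :
    ∃ x : ℝ → V, x 0 = x₀ ∧ ∀ t ∈ Icc 0 T, HasDerivAt x (A t (x t)) t := by
  obtain ⟨K, hK⟩ := isCompact_Icc.exists_bound_of_continuousOn (hA.continuousOn (s := Icc 0 T))
  have hK0 : 0 ≤ K := (norm_nonneg _).trans (hK 0 ⟨le_rfl, hT⟩)
  set R : ℝ := ‖x₀‖ * Real.exp (K * T) + 1 with hR
  have hR0 : 0 < R := by positivity
  have hlip : ∀ t ∈ Icc 0 T, ∀ x y : V, ‖A t (radialRetraction R x) - A t (radialRetraction R y)‖ ≤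
      K * 2 * ‖x - y‖ := fun t ht x y => by
    rw [← map_sub]
    refine ((A t).le_opNorm _).trans ?_
    rw [mul_assoc]
    exact mul_le_mul (hK t ht) (norm_radialRetraction_sub_le hR0 x y) (norm_nonneg _) hK0
  have hPL : IsPicardLindelof (fun t x => A t (radialRetraction R x)) (tmin := 0) (tmax := T)
      ⟨0, le_rfl, hT⟩ x₀ (K * R * T).toNNReal 0 (K * R).toNNReal (K * 2).toNNReal := by
    refine ⟨fun t ht => ?_, fun x _ => ?_, fun t ht x _ => ?_, ?_⟩
    · refine (LipschitzWith.of_dist_le_mul fun x y => ?_).lipschitzOnWith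
      rw [dist_eq_norm, dist_eq_norm, Real.coe_toNNReal _ (by positivity)]
      exact hlip t ht x y
    · exact (hA.clm_apply continuous_const).continuousOn
    · rw [Real.coe_toNNReal _ (by positivity)]
      refine ((A t).le_opNorm _).trans ?_
      exact mul_le_mul (hK t ht) (norm_radialRetraction_le hR0 x).2 (norm_nonneg _) hK0
    · rw [Real.coe_toNNReal _ (by positivity), Real.coe_toNNReal _ (by positivity)]
      simp [hT]
  obtain ⟨α, hα0, hα⟩ := hPL.exists_eq_forall_mem_Icc_hasDerivWithinAt₀
  have hαc : ContinuousOn α (Icc 0 T) := fun t ht => (hα t ht).continuousWithinAt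
  have hbound : ∀ t ∈ Icc 0 T, ‖α t‖ ≤ R := fun t ht => by
    have := norm_le_gronwallBound_of_norm_deriv_right_le (δ := ‖x₀‖) (K := K) (ε := 0) hαc
      (fun t ht => (hα t (Ico_subset_Icc_self ht)).mono_of_mem_nhdsWithin
        (Icc_mem_nhdsGE_of_mem ht)) (by rw [show α 0 = x₀ from hα0]) (fun t ht => by
        rw [add_zero]
        refine ((A t).le_opNorm _).trans ?_
        exact mul_le_mul (hK t (Ico_subset_Icc_self ht)) (norm_radialRetraction_le hR0 _).1
          (norm_nonneg _) hK0) t ht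
    rw [gronwallBound_ε0, sub_zero] at this
    have h2 : Real.exp (K * t) ≤ Real.exp (K * T) := by
      gcongr
      exact ht.2
    have := mul_le_mul_of_nonneg_left h2 (norm_nonneg x₀)
    linarith
  have hα' : ∀ t ∈ Icc 0 T, HasDerivWithinAt α (A t (α t)) (Icc 0 T) t := fun t ht => by
    have := hα t ht
    rwa [radialRetraction_of_norm_le hR0 (hbound t ht)] at this
  -- extension beyond `[0, T]` as a primitive, to have two-sided derivatives
  set β : ℝ → V := fun t => A t (IccExtend hT ((Icc 0 T).domRestrict α) t) with hβ
  have hβc : Continuous β :=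
    hA.clm_apply (continuousOn_iff_continuous_domRestrict.1 hαc).Icc_extend'
  have hβα : ∀ t ∈ Icc 0 T, β t = A t (α t) := fun t ht => by
    simp only [hβ]; rw [IccExtend_of_mem hT _ ht]; rfl
  have hx : ∀ t ∈ Icc 0 T, x₀ + ∫ s in (0 : ℝ)..t, β s = α t := fun t ht => by
    have h1 := intervalIntegral.integral_eq_sub_of_hasDeriv_right_of_le ht.1
      (hαc.mono (Icc_subset_Icc_right ht.2)) (f' := β) (fun s hs => by
        have hs' : s ∈ Ico 0 T := ⟨hs.1.le, hs.2.trans_le ht.2⟩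
        rw [hβα s (Ico_subset_Icc_self hs')]
        exact ((hα' s (Ico_subset_Icc_self hs')).mono_of_mem_nhdsWithin
          (Icc_mem_nhdsGE_of_mem hs')).mono Ioi_subset_Ici_self)
      (hβc.intervalIntegrable _ _)
    rw [h1, show α 0 = x₀ from hα0]; abel
  refine ⟨fun t => x₀ + ∫ s in (0 : ℝ)..t, β s, by simp, fun t ht => ?_⟩
  simp only [hx t ht]
  rw [← hβα t ht]
  exact (hβc.integral_hasStrictDerivAt 0 t).hasDerivAt.const_add x₀

theorem eqOn_of_hasDerivAt_linear {A : ℝ → V →L[ℝ] V} (hA : Continuous A) {T : ℝ} (hT : 0 ≤ T)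
    {x y : ℝ → V} (hx : ∀ t ∈ Icc 0 T, HasDerivAt x (A t (x t)) t)
    (hy : ∀ t ∈ Icc 0 T, HasDerivAt y (A t (y t)) t) (h0 : x 0 = y 0) : EqOn x y (Icc 0 T) := by
  obtain ⟨K, hK⟩ := isCompact_Icc.exists_bound_of_continuousOn (hA.continuousOn (s := Icc 0 T))
  have hK0 : 0 ≤ K := (norm_nonneg _).trans (hK 0 ⟨le_rfl, hT⟩)
  refine ODE_solution_unique_of_mem_Icc_right (v := fun t x => A t x) (s := fun _ => univ)
    (K := K.toNNReal) (fun t ht => ?_) (fun t ht => (hx t ht).continuousAt.continuousWithinAt)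
    (fun t ht => (hx t (Ico_subset_Icc_self ht)).hasDerivWithinAt) (fun _ _ => mem_univ _)
    (fun t ht => (hy t ht).continuousAt.continuousWithinAt)
    (fun t ht => (hy t (Ico_subset_Icc_self ht)).hasDerivWithinAt) (fun _ _ => mem_univ _) h0
  refine (LipschitzWith.of_dist_le_mul fun x y => ?_).lipschitzOnWith
  rw [dist_eq_norm, dist_eq_norm, ← map_sub, Real.coe_toNNReal _ hK0]
  exact (A t).le_of_opNorm_le (hK t (Ico_subset_Icc_self ht)) _

/-- The generator of the first-order system for `x'' + b x' + M x = 0`. -/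
noncomputable def waveGenerator (M : V →L[ℝ] V) (b : ℝ) : V × V →L[ℝ] V × V :=
  (ContinuousLinearMap.snd ℝ V V).prod (-(M.comp (ContinuousLinearMap.fst ℝ V V))) -
    b • (0 : V × V →L[ℝ] V).prod (ContinuousLinearMap.snd ℝ V V)

theorem waveGenerator_apply (M : V →L[ℝ] V) (b : ℝ) (z : V × V) :
    waveGenerator M b z = (z.2, -M z.1 - b • z.2) := by
  simp [waveGenerator]

theorem continuous_waveGenerator (M : V →L[ℝ] V) {b : ℝ → ℝ} (hb : Continuous b) :
    Continuous fun t => waveGenerator M (b t) :=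
  continuous_const.sub (hb.smul continuous_const)

theorem exists_hasDerivAt_wave [CompleteSpace V] (M : V →L[ℝ] V) {b : ℝ → ℝ} (hb : Continuous b)
    (x₀ y₀ : V) {T : ℝ} (hT : 0 ≤ T) :
    ∃ x y : ℝ → V, x 0 = x₀ ∧ y 0 = y₀ ∧ (∀ t ∈ Icc 0 T, HasDerivAt x (y t) t) ∧
      ∀ t ∈ Icc 0 T, HasDerivAt y (-M (x t) - b t • y t) t := by
  obtain ⟨z, hz0, hz⟩ := exists_hasDerivAt_linear (continuous_waveGenerator M hb) (x₀, y₀) hT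
  simp only [waveGenerator_apply] at hz
  refine ⟨fun t => (z t).1, fun t => (z t).2, by simp [hz0], by simp [hz0], fun t ht => ?_,
    fun t ht => ?_⟩
  · exact ((ContinuousLinearMap.fst ℝ V V).hasFDerivAt.comp_hasDerivAt t (hz t ht))
  · exact ((ContinuousLinearMap.snd ℝ V V).hasFDerivAt.comp_hasDerivAt t (hz t ht))

theorem eq_of_hasDerivAt_wave {M : V →L[ℝ] V} {b : ℝ → ℝ} (hb : Continuous b) {T : ℝ} (hT : 0 ≤ T)
    {x y x' y' : ℝ → V} (hx : ∀ t ∈ Icc 0 T, HasDerivAt x (y t) t)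
    (hy : ∀ t ∈ Icc 0 T, HasDerivAt y (-M (x t) - b t • y t) t)
    (hx' : ∀ t ∈ Icc 0 T, HasDerivAt x' (y' t) t)
    (hy' : ∀ t ∈ Icc 0 T, HasDerivAt y' (-M (x' t) - b t • y' t) t)
    (h0 : x 0 = x' 0) (h1 : y 0 = y' 0) : x T = x' T ∧ y T = y' T := by
  have := eqOn_of_hasDerivAt_linear (continuous_waveGenerator M hb) hT
    (x := fun t => (x t, y t)) (y := fun t => (x' t, y' t))
    (fun t ht => by rw [waveGenerator_apply]; exact (hx t ht).prodMk (hy t ht))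
    (fun t ht => by rw [waveGenerator_apply]; exact (hx' t ht).prodMk (hy' t ht))
    (by simp [h0, h1]) ⟨hT, le_rfl⟩
  simpa using this

end LinearODE

/-! ### Multiplication of square-integrable functions by bounded continuous functions -/

section Multiplier

variable {d : ℕ}

/-- Bounded continuous multipliers. -/
abbrev Mult (d : ℕ) := EuclideanSpace ℝ (Fin d) →ᵇ ℂ

theorem memLp_mul (f : Mult d) (g : L2 d) : MemLp (fun ξ => f ξ * g ξ) 2 volume := by
  refine (Lp.memLp g).of_le_mul (c := ‖f‖)
    (f.continuous.aestronglyMeasurable.mul (Lp.memLp g).1) (Filter.Eventually.of_forall fun ξ => ?_)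
  rw [norm_mul]
  gcongr
  exact f.norm_coe_le_norm ξ

/-- The product of a bounded continuous function and a square-integrable function, as a continuous
bilinear map. -/
noncomputable def mulL2 : Mult d →L[ℝ] L2 d →L[ℝ] L2 d :=
  LinearMap.mkContinuous₂ (LinearMap.mk₂ ℝ (fun f g => (memLp_mul f g).toLp)
    (fun f f' g => by
      rw [← MemLp.toLp_add]
      exact MemLp.toLp_congr _ _ (Filter.Eventually.of_forall fun ξ => by simp [add_mul]))
    (fun c f g => by
      rw [← MemLp.toLp_const_smul]
      exact MemLp.toLp_congr _ _ (Filter.Eventually.of_forall fun ξ => by simp [mul_assoc]))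
    (fun f g g' => by
      rw [← MemLp.toLp_add]
      refine MemLp.toLp_congr _ _ ?_
      filter_upwards [Lp.coeFn_add g g'] with ξ h
      simp only [h, Pi.add_apply, mul_add])
    (fun c f g => by
      rw [← MemLp.toLp_const_smul]
      refine MemLp.toLp_congr _ _ ?_
      filter_upwards [Lp.coeFn_smul c g] with ξ h
      simp only [h, Pi.smul_apply, Complex.real_smul]; ring)) 1 fun f g => by
    rw [one_mul, LinearMap.mk₂_apply]
    refine Lp.norm_le_mul_norm_of_ae_le_mul ?_
    filter_upwards [(memLp_mul f g).coeFn_toLp] with ξ h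
    rw [h, norm_mul]
    gcongr
    exact f.norm_coe_le_norm ξ

theorem coeFn_mulL2 (f : Mult d) (g : L2 d) : mulL2 f g =ᵐ[volume] fun ξ => f ξ * g ξ :=
  (memLp_mul f g).coeFn_toLp

theorem mulL2_mulL2 (f f' : Mult d) (g : L2 d) : mulL2 f (mulL2 f' g) = mulL2 (f * f') g := by
  refine Lp.ext ?_
  filter_upwards [coeFn_mulL2 f (mulL2 f' g), coeFn_mulL2 f' g, coeFn_mulL2 (f * f') g]
    with ξ h1 h2 h3
  rw [h1, h2, h3, BoundedContinuousFunction.mul_apply, mul_assoc]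

theorem mulL2_one (g : L2 d) : mulL2 (1 : Mult d) g = g := by
  refine Lp.ext ?_
  filter_upwards [coeFn_mulL2 1 g] with ξ h1
  rw [h1, BoundedContinuousFunction.coe_one, Pi.one_apply, one_mul]

end Multiplier

/-! ### The Fourier transform of a solution -/

section Pairing

variable {d : ℕ}

/-- The pairing of square-integrable functions with a Schwartz function. -/
noncomputable def pairing (φ : 𝓢(EuclideanSpace ℝ (Fin d), ℂ)) : L2 d →L[ℂ] ℂ :=
  (PointwiseConvergenceCLM.evalCLM (RingHom.id ℂ) ℂ φ).comp
    (Lp.toTemperedDistributionCLM ℂ (volume : Measure (EuclideanSpace ℝ (Fin d))) 2)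

theorem pairing_eq (φ : 𝓢(EuclideanSpace ℝ (Fin d), ℂ)) (f : L2 d) :
    pairing φ f = Lp.toTemperedDistribution f φ := rfl

theorem pairing_apply (φ : 𝓢(EuclideanSpace ℝ (Fin d), ℂ)) (f : L2 d) :
    pairing φ f = ∫ ξ, φ ξ * f ξ := by
  rw [pairing_eq, Lp.toTemperedDistribution_apply]; rfl

theorem pairing_fourier (φ : 𝓢(EuclideanSpace ℝ (Fin d), ℂ)) (f : L2 d) :
    pairing φ (𝓕 f) = Lp.toTemperedDistribution f (𝓕 φ) := by
  rw [pairing_eq, ← Lp.fourier_toTemperedDistribution_eq]; rfl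

theorem integrable_schwartz_mul (φ : 𝓢(EuclideanSpace ℝ (Fin d), ℂ)) (f : L2 d) :
    Integrable (fun ξ => φ ξ * f ξ) :=
  (SchwartzMap.memLp φ 2 volume).integrable_mul (Lp.memLp f)

theorem integrable_fun_sub {f g : EuclideanSpace ℝ (Fin d) → ℂ} (hf : Integrable f)
    (hg : Integrable g) : Integrable fun ξ => f ξ - g ξ := hf.sub hg

/-- Multiplication of a Schwartz function by a coordinate. -/
noncomputable def coordMul (j : Fin d) (φ : 𝓢(EuclideanSpace ℝ (Fin d), ℂ)) :
    𝓢(EuclideanSpace ℝ (Fin d), ℂ) :=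
  SchwartzMap.smulLeftCLM ℂ
    (fun ξ => ((inner ℝ ξ (EuclideanSpace.single j (1 : ℝ)) : ℝ) : ℂ)) φ

theorem coordMul_apply (j : Fin d) (φ : 𝓢(EuclideanSpace ℝ (Fin d), ℂ))
    (ξ : EuclideanSpace ℝ (Fin d)) : coordMul j φ ξ = (ξ j : ℂ) * φ ξ := by
  rw [coordMul, SchwartzMap.smulLeftCLM_apply_apply (by fun_prop)]
  simp [EuclideanSpace.inner_single_right]

/-- The multiplier of the derivative `∂_j`. -/
noncomputable def freq (j : Fin d) (ξ : EuclideanSpace ℝ (Fin d)) : ℂ :=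
  2 * Real.pi * Complex.I * (ξ j : ℂ)

theorem continuous_freq (j : Fin d) : Continuous (freq j) := by
  unfold freq; fun_prop

theorem ae_eq_zero_of_integral_schwartz {f : EuclideanSpace ℝ (Fin d) → ℂ}
    (hf : LocallyIntegrable f volume)
    (h : ∀ φ : 𝓢(EuclideanSpace ℝ (Fin d), ℂ), ∫ ξ, φ ξ * f ξ = 0) : ∀ᵐ ξ, f ξ = 0 := by
  refine ae_eq_zero_of_integral_contDiff_smul_eq_zero hf fun g hg hgc => ?_
  have hg₁ : HasCompactSupport (Complex.ofRealCLM ∘ g) := hgc.comp_left rfl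
  have hg₂ : ContDiff ℝ ((⊤ : ℕ∞) : WithTop ℕ∞) (Complex.ofRealCLM ∘ g) := by fun_prop
  exact h (hg₁.toSchwartzMap hg₂)

theorem locallyIntegrable_L2 (f : L2 d) : LocallyIntegrable f volume :=
  (Lp.memLp f).locallyIntegrable (by norm_num)

theorem locallyIntegrable_mul {g f : EuclideanSpace ℝ (Fin d) → ℂ} (hg : Continuous g)
    (hf : LocallyIntegrable f volume) : LocallyIntegrable (fun ξ => g ξ * f ξ) volume := by
  rw [← locallyIntegrableOn_univ] at hf ⊢
  exact hf.continuousOn_mul hg.continuousOn isOpen_univ.isLocallyClosed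

/-- The Fourier density of a tempered distribution is unique. -/
theorem HasFourierDensity.ae_eq {f : 𝓢'(EuclideanSpace ℝ (Fin d), ℂ)}
    {g g' : EuclideanSpace ℝ (Fin d) → ℂ} (h : HasFourierDensity f g)
    (h' : HasFourierDensity f g') : g =ᵐ[volume] g' := by
  have := ae_eq_zero_of_integral_schwartz (h.1.sub h'.1) fun φ => by
    simp only [Pi.sub_apply, mul_sub]
    rw [integral_sub (h.2 φ).1 (h'.2 φ).1, ← (h.2 φ).2, ← (h'.2 φ).2, sub_self]
  filter_upwards [this] with ξ hξ
  exact sub_eq_zero.1 hξ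

theorem homSobolevENorm_eq {f : 𝓢'(EuclideanSpace ℝ (Fin d), ℂ)} (s : ℝ)
    {g : EuclideanSpace ℝ (Fin d) → ℂ} (h : HasFourierDensity f g) :
    homSobolevENorm s f =
      eLpNorm (fun ξ => (((2 * Real.pi * ‖ξ‖) ^ s : ℝ) : ℂ) * g ξ) 2 volume := by
  refine le_antisymm (iInf₂_le g h) (le_iInf₂ fun g' h' => le_of_eq (eLpNorm_congr_ae ?_))
  filter_upwards [h.ae_eq h'] with ξ hξ
  rw [hξ]

end Pairing

namespace FiniteEnergySolution

variable {d : ℕ} {b : ℝ → ℝ} (S : FiniteEnergySolution d b)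

/-- The Fourier transform of `∂_t u(t)`, extended to negative times as a constant. -/
noncomputable def dtHat (t : ℝ) : L2 d := 𝓕 (S.dt (max t 0))

/-- The Fourier transform of `∂_j u(t)`, extended to negative times as a constant. -/
noncomputable def gradHat (t : ℝ) (j : Fin d) : L2 d := 𝓕 (S.grad (max t 0) j)

theorem continuous_dtHat : Continuous S.dtHat :=
  (FourierTransform.continuous_fourier (E := L2 d) (F := L2 d)).comp
    (S.continuousOn_dt.comp_continuous (by fun_prop) fun t => le_max_right t 0)

theorem continuous_gradHat (j : Fin d) : Continuous fun t => S.gradHat t j :=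
  (FourierTransform.continuous_fourier (E := L2 d) (F := L2 d)).comp
    ((S.continuousOn_grad j).comp_continuous (by fun_prop) fun t => le_max_right t 0)

theorem energy_eq {t : ℝ} (ht : 0 ≤ t) :
    S.energy t = ∑ j, ‖S.gradHat t j‖ ^ 2 + ‖S.dtHat t‖ ^ 2 := by
  simp only [energy, gradHat, dtHat, max_eq_left ht, Lp.norm_fourier_eq]

theorem pairing_gradHat {t : ℝ} (ht : 0 ≤ t) (j : Fin d)
    (φ : 𝓢(EuclideanSpace ℝ (Fin d), ℂ)) :
    pairing φ (S.gradHat t j) = 2 * Real.pi * Complex.I * (𝓕 (S.u t)) (coordMul j φ) := by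
  rw [gradHat, max_eq_left ht, pairing_eq, ← Lp.fourier_toTemperedDistribution_eq,
    ← S.grad_eq t ht j, TemperedDistribution.fourier_lineDerivOp_eq]
  rfl

theorem hasDerivWithinAt_pairing_gradHat {t : ℝ} (ht : 0 ≤ t) (j : Fin d)
    (φ : 𝓢(EuclideanSpace ℝ (Fin d), ℂ)) :
    HasDerivWithinAt (fun s => pairing φ (S.gradHat s j))
      (2 * Real.pi * Complex.I * pairing (coordMul j φ) (S.dtHat t)) (Ici 0) t := by
  have h := (S.dt_eq t ht (𝓕 (coordMul j φ))).const_mul (2 * Real.pi * Complex.I)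
  rw [← pairing_fourier] at h
  rw [dtHat, max_eq_left ht]
  refine h.congr_of_mem (fun s hs => ?_) ht
  rw [S.pairing_gradHat hs]
  rfl

theorem hasDerivAt_pairing_dtHat {t : ℝ} (ht : 0 < t) (φ : 𝓢(EuclideanSpace ℝ (Fin d), ℂ)) :
    HasDerivAt (fun s => pairing φ (S.dtHat s))
      (∑ j, 2 * Real.pi * Complex.I * pairing (coordMul j φ) (S.gradHat t j) -
        b t * pairing φ (S.dtHat t)) t := by
  have h := S.equation t ht (𝓕 φ)
  have h1 : (Δ (S.u t)) (𝓕 φ) =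
      ∑ j, 2 * Real.pi * Complex.I * pairing (coordMul j φ) (S.gradHat t j) := by
    rw [TemperedDistribution.laplacian_eq_sum (EuclideanSpace.basisFun (Fin d) ℝ)]
    have h2 : ∀ j : Fin d, (∂_{EuclideanSpace.basisFun (Fin d) ℝ j}
        (∂_{EuclideanSpace.basisFun (Fin d) ℝ j} (S.u t))) (𝓕 φ) =
        2 * Real.pi * Complex.I * pairing (coordMul j φ) (S.gradHat t j) := fun j => by
      rw [EuclideanSpace.basisFun_apply, S.grad_eq t ht.le j, gradHat, max_eq_left ht.le,
        ← TemperedDistribution.fourier_apply, TemperedDistribution.fourier_lineDerivOp_eq,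
        Lp.fourier_toTemperedDistribution_eq]
      rfl
    rw [← Finset.sum_congr rfl fun j _ => h2 j]
    simp
  rw [h1, ← pairing_fourier] at h
  have h3 : S.dtHat t = 𝓕 (S.dt t) := by rw [dtHat, max_eq_left ht.le]
  rw [h3]
  refine h.congr_of_eventuallyEq ?_
  filter_upwards [lt_mem_nhds ht] with s hs
  rw [dtHat, max_eq_left hs.le, pairing_fourier]

/-- The primitive of `∂_t û`. -/
noncomputable def intDtHat (t : ℝ) : L2 d := ∫ s in (0 : ℝ)..t, S.dtHat s

/-- The primitive of the Fourier transform of `∂_j u`. -/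
noncomputable def intGradHat (t : ℝ) (j : Fin d) : L2 d := ∫ s in (0 : ℝ)..t, S.gradHat s j

theorem hasDerivAt_intDtHat (t : ℝ) : HasDerivAt S.intDtHat (S.dtHat t) t :=
  (S.continuous_dtHat.integral_hasStrictDerivAt 0 t).hasDerivAt

theorem hasDerivAt_intGradHat (j : Fin d) (t : ℝ) :
    HasDerivAt (fun t => S.intGradHat t j) (S.gradHat t j) t :=
  ((S.continuous_gradHat j).integral_hasStrictDerivAt 0 t).hasDerivAt

theorem pairing_integral (φ : 𝓢(EuclideanSpace ℝ (Fin d), ℂ)) {f : ℝ → L2 d} (hf : Continuous f)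
    (t : ℝ) : pairing φ (∫ s in (0 : ℝ)..t, f s) = ∫ s in (0 : ℝ)..t, pairing φ (f s) :=
  (ContinuousLinearMap.intervalIntegral_comp_comm _ (hf.intervalIntegrable _ _)).symm

theorem integral_mul_freq (φ : 𝓢(EuclideanSpace ℝ (Fin d), ℂ)) (j : Fin d) (f : L2 d) :
    Integrable (fun ξ => φ ξ * (freq j ξ * f ξ)) ∧
    ∫ ξ, φ ξ * (freq j ξ * f ξ) = 2 * Real.pi * Complex.I * pairing (coordMul j φ) f := by
  have h1 : (fun ξ => φ ξ * (freq j ξ * f ξ)) =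
      fun ξ => 2 * Real.pi * Complex.I * (coordMul j φ ξ * f ξ) := by
    ext ξ; rw [coordMul_apply, freq]; ring
  rw [h1, integral_const_mul, pairing_apply]
  exact ⟨(integrable_schwartz_mul _ _).const_mul _, rfl⟩

theorem gradHat_ae_eq {t : ℝ} (ht : 0 ≤ t) (j : Fin d) :
    ∀ᵐ ξ, S.gradHat t j ξ = S.gradHat 0 j ξ + freq j ξ * S.intDtHat t ξ := by
  have key := ae_eq_zero_of_integral_schwartz
    (f := fun ξ => S.gradHat t j ξ - S.gradHat 0 j ξ - freq j ξ * S.intDtHat t ξ)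
    (((locallyIntegrable_L2 _).sub (locallyIntegrable_L2 _)).sub
      (locallyIntegrable_mul (continuous_freq j) (locallyIntegrable_L2 _))) fun φ => by
    obtain ⟨i1, e1⟩ := integral_mul_freq φ j (S.intDtHat t)
    simp only [mul_sub]
    rw [integral_sub (integrable_fun_sub (integrable_schwartz_mul _ _) (integrable_schwartz_mul _ _)) i1,
      integral_sub (integrable_schwartz_mul _ _) (integrable_schwartz_mul _ _), e1,
      ← pairing_apply, ← pairing_apply, intDtHat, pairing_integral _ S.continuous_dtHat,
      ← intervalIntegral.integral_const_mul]
    rw [intervalIntegral.integral_eq_sub_of_hasDeriv_right_of_le ht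
      (f := fun s => pairing φ (S.gradHat s j)), sub_self]
    · exact ((pairing φ).continuous.comp (S.continuous_gradHat j)).continuousOn
    · exact fun s hs => (S.hasDerivWithinAt_pairing_gradHat hs.1.le j φ).mono
        fun r hr => (hs.1.trans hr).le
    · exact (continuous_const.mul ((pairing _).continuous.comp
        S.continuous_dtHat)).intervalIntegrable _ _
  filter_upwards [key] with ξ h
  linear_combination h

theorem gradHat_zero_ae_eq {g : EuclideanSpace ℝ (Fin d) → ℂ} (hg : HasFourierDensity (S.u 0) g)
    (j : Fin d) : ∀ᵐ ξ, S.gradHat 0 j ξ = freq j ξ * g ξ := by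
  have key := ae_eq_zero_of_integral_schwartz
    (f := fun ξ => S.gradHat 0 j ξ - freq j ξ * g ξ)
    ((locallyIntegrable_L2 _).sub (locallyIntegrable_mul (continuous_freq j) hg.1)) fun φ => by
    obtain ⟨i1, e1⟩ := hg.2 (coordMul j φ)
    have h1 : (fun ξ => φ ξ * (freq j ξ * g ξ)) =
        fun ξ => 2 * Real.pi * Complex.I * (coordMul j φ ξ * g ξ) := by
      ext ξ; rw [coordMul_apply, freq]; ring
    have i2 : Integrable (fun ξ => φ ξ * (freq j ξ * g ξ)) := by
      rw [h1]; exact i1.const_mul _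
    simp only [mul_sub]
    rw [integral_sub (integrable_schwartz_mul _ _) i2, h1, integral_const_mul, ← e1,
      ← pairing_apply, S.pairing_gradHat le_rfl, sub_self]
  filter_upwards [key] with ξ h
  linear_combination h

theorem dtHat_ae_eq {b' : ℝ → ℝ} (hb' : Continuous b') (hbb' : ∀ t, 0 ≤ t → b' t = b t) {t : ℝ}
    (ht : 0 ≤ t) :
    ∀ᵐ ξ, S.dtHat t ξ = S.dtHat 0 ξ + ∑ j, freq j ξ * S.intGradHat t j ξ -
      (∫ s in (0 : ℝ)..t, (b' s : ℂ) • S.dtHat s : L2 d) ξ := by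
  have hbd : Continuous fun s => (b' s : ℂ) • S.dtHat s :=
    (Complex.continuous_ofReal.comp hb').smul S.continuous_dtHat
  have key := ae_eq_zero_of_integral_schwartz
    (f := fun ξ => S.dtHat t ξ - S.dtHat 0 ξ - (∑ j, freq j ξ * S.intGradHat t j ξ -
      (∫ s in (0 : ℝ)..t, (b' s : ℂ) • S.dtHat s : L2 d) ξ))
    (((locallyIntegrable_L2 _).sub (locallyIntegrable_L2 _)).sub (LocallyIntegrable.sub
      (by
        have := locallyIntegrable_finsetSum' Finset.univ fun (j : Fin d) _ =>
          locallyIntegrable_mul (continuous_freq j) (locallyIntegrable_L2 (S.intGradHat t j))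
        convert! this using 1
        ext ξ; simp) (locallyIntegrable_L2 _))) fun φ => by
    have i1 : ∀ j, Integrable (fun ξ => φ ξ * (freq j ξ * S.intGradHat t j ξ)) := fun j =>
      (integral_mul_freq φ j _).1
    simp only [mul_sub, Finset.mul_sum]
    rw [integral_sub (integrable_fun_sub (integrable_schwartz_mul _ _) (integrable_schwartz_mul _ _))
        (integrable_fun_sub (integrable_finsetSum _ fun j _ => i1 j) (integrable_schwartz_mul _ _)),
      integral_sub (integrable_schwartz_mul _ _) (integrable_schwartz_mul _ _),
      integral_sub (integrable_finsetSum _ fun j _ => i1 j) (integrable_schwartz_mul _ _),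
      integral_finsetSum _ fun j _ => i1 j]
    simp only [(integral_mul_freq φ _ _).2, ← pairing_apply, intGradHat]
    rw [pairing_integral _ hbd]
    have h1 : ∀ j, 2 * Real.pi * Complex.I * pairing (coordMul j φ)
        (∫ s in (0 : ℝ)..t, S.gradHat s j) =
        ∫ s in (0 : ℝ)..t, 2 * Real.pi * Complex.I * pairing (coordMul j φ) (S.gradHat s j) :=
      fun j => by
        rw [pairing_integral _ (S.continuous_gradHat j), intervalIntegral.integral_const_mul]
    have c1 : ∀ j, Continuous fun s =>
        2 * Real.pi * Complex.I * pairing (coordMul j φ) (S.gradHat s j) := fun j =>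
      continuous_const.mul ((pairing _).continuous.comp (S.continuous_gradHat j))
    have c2 : Continuous fun s => pairing φ ((b' s : ℂ) • S.dtHat s) :=
      (pairing _).continuous.comp hbd
    simp only [h1]
    rw [← intervalIntegral.integral_finsetSum fun j _ => (c1 j).intervalIntegrable _ _,
      ← intervalIntegral.integral_sub
        ((continuous_finsetSum _ fun j _ => c1 j).intervalIntegrable _ _)
        (c2.intervalIntegrable _ _),
      intervalIntegral.integral_eq_sub_of_hasDerivAt_of_le ht
        (f := fun s => pairing φ (S.dtHat s)), sub_self]
    · exact ((pairing φ).continuous.comp S.continuous_dtHat).continuousOn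
    · intro s hs
      have := S.hasDerivAt_pairing_dtHat hs.1 φ
      rwa [← hbb' s hs.1.le, ← smul_eq_mul (b' s : ℂ), ← map_smul] at this
    · exact ((continuous_finsetSum _ fun j _ => c1 j).sub c2).intervalIntegrable _ _
  filter_upwards [key] with ξ h
  linear_combination h

end FiniteEnergySolution

/-! ### Representation of a solution by scalar modes -/

section Action

variable {A V : Type*} [NormedRing A] [NormedAlgebra ℝ A] [NormedAddCommGroup V] [NormedSpace ℝ V]

/-- If an algebra acts on a Banach space and `f` is an element of the algebra, then the equation
`u'' + b u' + f u = 0` in the space is solved by the fundamental solutions in the algebra. -/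
theorem eq_action_of_hasDerivAt_wave (B : A →L[ℝ] V →L[ℝ] V)
    (hmul : ∀ f f' g, B f (B f' g) = B (f * f') g) (hone : ∀ g, B 1 g = g) (f : A) {b : ℝ → ℝ}
    (hb : Continuous b) {t : ℝ} (ht : 0 ≤ t) {x x₁ y y₁ : ℝ → A} (hx0 : x 0 = 1) (hx₁0 : x₁ 0 = 0)
    (hy0 : y 0 = 0) (hy₁0 : y₁ 0 = 1)
    (hx : ∀ s ∈ Icc 0 t, HasDerivAt x (x₁ s) s)
    (hx₁ : ∀ s ∈ Icc 0 t, HasDerivAt x₁ (-(f * x s) - b s • x₁ s) s)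
    (hy : ∀ s ∈ Icc 0 t, HasDerivAt y (y₁ s) s)
    (hy₁ : ∀ s ∈ Icc 0 t, HasDerivAt y₁ (-(f * y s) - b s • y₁ s) s)
    {U W : ℝ → V} (hU : ∀ s ∈ Icc 0 t, HasDerivAt U (W s) s)
    (hW : ∀ s ∈ Icc 0 t, HasDerivAt W (-B f (U s) - b s • W s) s) :
    U t = B (x t) (U 0) + B (y t) (W 0) ∧ W t = B (x₁ t) (U 0) + B (y₁ t) (W 0) := by
  have hB : ∀ {z : ℝ → A} {z' : A} {s : ℝ} (g : V), HasDerivAt z z' s →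
      HasDerivAt (fun s => B (z s) g) (B z' g) s := fun g h =>
    (B.flip g).hasFDerivAt.comp_hasDerivAt _ h
  refine eq_of_hasDerivAt_wave (M := B f) hb ht hU hW
    (x' := fun s => B (x s) (U 0) + B (y s) (W 0)) (y' := fun s => B (x₁ s) (U 0) + B (y₁ s) (W 0))
    (fun s hs => (hB _ (hx s hs)).fun_add (hB _ (hy s hs)))
    (fun s hs => ((hB _ (hx₁ s hs)).fun_add (hB _ (hy₁ s hs))).congr_deriv ?_)
    (by simp [hx0, hy0, hone]) (by simp [hx₁0, hy₁0, hone])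
  simp only [map_sub, map_neg, map_smul, map_add, sub_apply, neg_apply, smul_apply, smul_add, hmul]
  abel

end Action

section Cutoff

variable {d : ℕ}

/-- A continuous cutoff which is positive exactly where `2π|ξ| < R`. -/
noncomputable def cutoff (R : ℝ) (ξ : EuclideanSpace ℝ (Fin d)) : ℝ :=
  max 0 (R - 2 * Real.pi * ‖ξ‖)

theorem continuous_cutoff (R : ℝ) : Continuous (cutoff (d := d) R) := by
  unfold cutoff; fun_prop

theorem cutoff_of_le {R : ℝ} {ξ : EuclideanSpace ℝ (Fin d)} (h : R ≤ 2 * Real.pi * ‖ξ‖) :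
    cutoff R ξ = 0 := max_eq_left (by linarith)

theorem cutoff_pos {R : ℝ} {ξ : EuclideanSpace ℝ (Fin d)} (h : 2 * Real.pi * ‖ξ‖ < R) :
    0 < cutoff R ξ := lt_max_of_lt_right (by linarith)

/-- The product of a continuous function with the cutoff, as a bounded multiplier. -/
noncomputable def cutMul (R : ℝ) (f : EuclideanSpace ℝ (Fin d) → ℂ) (hf : Continuous f) : Mult d :=
  ofCompactSupport (fun ξ => f ξ * (cutoff R ξ : ℂ))
    (hf.mul (Complex.continuous_ofReal.comp (continuous_cutoff R)))
    (HasCompactSupport.intro (isCompact_closedBall 0 R) fun ξ hξ => by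
      rw [mem_closedBall_zero_iff, not_le] at hξ
      have h1 : 1 ≤ 2 * Real.pi := by linarith [Real.pi_gt_three]
      rw [cutoff_of_le (hξ.le.trans (le_mul_of_one_le_left (norm_nonneg _) h1)), Complex.ofReal_zero,
        mul_zero])

/-- The symbol `(2π|ξ|)²` of `-Δ`, truncated at `R²`. -/
noncomputable def truncSymbol (R : ℝ) : Mult d :=
  BoundedContinuousFunction.ofNormedAddCommGroup
    (fun ξ => (((min (2 * Real.pi * ‖ξ‖) |R|) ^ 2 : ℝ) : ℂ)) (by fun_prop) (|R| ^ 2) fun ξ => by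
    have : 0 ≤ min (2 * Real.pi * ‖ξ‖) |R| := le_min (by positivity) (abs_nonneg R)
    rw [Complex.norm_real, Real.norm_of_nonneg (by positivity)]
    gcongr
    exact min_le_right _ _

theorem truncSymbol_apply {R : ℝ} {ξ : EuclideanSpace ℝ (Fin d)} (h : 2 * Real.pi * ‖ξ‖ ≤ R) :
    truncSymbol R ξ = (((2 * Real.pi * ‖ξ‖) ^ 2 : ℝ) : ℂ) := by
  rw [← min_eq_left (h.trans (le_abs_self R))]; rfl

/-- `∑_j ξ_j ∂_j` has the symbol `2πi|ξ|²`. -/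
noncomputable def radialFreq (ξ : EuclideanSpace ℝ (Fin d)) : ℂ :=
  2 * Real.pi * Complex.I * ((‖ξ‖ ^ 2 : ℝ) : ℂ)

theorem continuous_radialFreq : Continuous (radialFreq (d := d)) := by
  unfold radialFreq; fun_prop

theorem continuous_coord (j : Fin d) :
    Continuous fun ξ : EuclideanSpace ℝ (Fin d) => ((ξ j : ℝ) : ℂ) := by fun_prop

theorem sum_coord_mul_freq (ξ : EuclideanSpace ℝ (Fin d)) :
    ∑ j, ((ξ j : ℝ) : ℂ) * freq j ξ = radialFreq ξ := by
  rw [radialFreq, EuclideanSpace.norm_sq_eq]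
  push_cast
  rw [Finset.mul_sum]
  refine Finset.sum_congr rfl fun j _ => ?_
  rw [freq, Real.norm_eq_abs, ← Complex.ofReal_pow, sq_abs]
  push_cast; ring

theorem sum_norm_freq_sq (ξ : EuclideanSpace ℝ (Fin d)) :
    ∑ j, ‖freq j ξ‖ ^ 2 = (2 * Real.pi * ‖ξ‖) ^ 2 := by
  rw [mul_pow, EuclideanSpace.norm_sq_eq, Finset.mul_sum]
  refine Finset.sum_congr rfl fun j _ => ?_
  simp [freq, mul_pow, abs_of_pos Real.pi_pos]

/-- The truncated coordinate `ξ_j`. -/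
noncomputable def cutCoord (R : ℝ) (j : Fin d) : Mult d := cutMul R _ (continuous_coord j)

/-- The truncated symbol of `∑_j ξ_j ∂_j`. -/
noncomputable def cutRadial (R : ℝ) : Mult d := cutMul R _ continuous_radialFreq

/-- The truncated symbol of `∑_j ξ_j ∂_j`, multiplied by that of `∂_j`. -/
noncomputable def cutRadialFreq (R : ℝ) (j : Fin d) : Mult d :=
  cutMul R _ (continuous_radialFreq.mul (continuous_freq j))

theorem cutCoord_apply (R : ℝ) (j : Fin d) (ξ : EuclideanSpace ℝ (Fin d)) :
    cutCoord R j ξ = ((ξ j : ℝ) : ℂ) * (cutoff R ξ : ℂ) := rfl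

theorem cutRadial_apply (R : ℝ) (ξ : EuclideanSpace ℝ (Fin d)) :
    cutRadial R ξ = radialFreq ξ * (cutoff R ξ : ℂ) := rfl

theorem cutRadialFreq_apply (R : ℝ) (j : Fin d) (ξ : EuclideanSpace ℝ (Fin d)) :
    cutRadialFreq R j ξ = radialFreq ξ * freq j ξ * (cutoff R ξ : ℂ) := rfl

theorem cutRadial_ne_zero {R : ℝ} {ξ : EuclideanSpace ℝ (Fin d)} (h0 : ξ ≠ 0)
    (h : 2 * Real.pi * ‖ξ‖ < R) : cutRadial R ξ ≠ 0 := by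
  rw [cutRadial_apply, radialFreq]
  have h1 := (cutoff_pos h).ne'
  have h2 := norm_ne_zero_iff.2 h0
  simp [h1, Real.pi_ne_zero, h0]

theorem neg_truncSymbol_mul_cutCoord (R : ℝ) (j : Fin d) :
    -(truncSymbol R * cutCoord R j) = cutRadialFreq R j := by
  ext ξ
  rw [BoundedContinuousFunction.neg_apply, BoundedContinuousFunction.mul_apply, cutCoord_apply,
    cutRadialFreq_apply]
  rcases le_or_gt R (2 * Real.pi * ‖ξ‖) with h | h
  · rw [cutoff_of_le h]; simp
  · rw [truncSymbol_apply h.le, radialFreq, freq]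
    push_cast
    linear_combination (-(4 * (Real.pi : ℂ) ^ 2 * ‖ξ‖ ^ 2 * ξ j * cutoff R ξ)) * Complex.I_sq

end Cutoff

namespace FiniteEnergySolution

variable {d : ℕ} {b : ℝ → ℝ} (S : FiniteEnergySolution d b)

/-- The localized curve `cutoff · ∑_j ξ_j ∂_j u`, which on the Fourier side is a multiple of `û`. -/
noncomputable def locU (R t : ℝ) : L2 d :=
  ∑ j, mulL2 (cutCoord R j) (S.gradHat t j)

/-- The localized time derivative. -/
noncomputable def locW (R t : ℝ) : L2 d := mulL2 (cutRadial R) (S.dtHat t)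

theorem locU_eq (R : ℝ) {t : ℝ} (ht : 0 ≤ t) :
    S.locU R t = S.locU R 0 + mulL2 (cutRadial R) (S.intDtHat t) := by
  have hall : ∀ t, ∀ᵐ ξ, ∀ j, mulL2 (cutCoord R j) (S.gradHat t j) ξ =
      cutCoord R j ξ * S.gradHat t j ξ := fun t => ae_all_iff.2 fun j => coeFn_mulL2 _ _
  refine Lp.ext ?_
  filter_upwards [hall t, hall 0, coeFn_mulL2 (cutRadial R) (S.intDtHat t),
    Lp.coeFn_add (S.locU R 0) (mulL2 (cutRadial R) (S.intDtHat t)),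
    Lp.coeFn_finsetSum Finset.univ fun j => mulL2 (cutCoord R j) (S.gradHat t j),
    Lp.coeFn_finsetSum Finset.univ fun j => mulL2 (cutCoord R j) (S.gradHat 0 j),
    ae_all_iff.2 fun j => S.gradHat_ae_eq ht j] with ξ e1 e2 e3 e4 e5 e6 e7
  rw [e4, Pi.add_apply, locU, e5, locU, e6, e3, Finset.sum_apply, Finset.sum_apply,
    Finset.sum_congr rfl fun j _ => e1 j, Finset.sum_congr rfl fun j _ => e2 j, cutRadial_apply,
    ← sum_coord_mul_freq, Finset.sum_mul, Finset.sum_mul, ← Finset.sum_add_distrib]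
  refine Finset.sum_congr rfl fun j _ => ?_
  rw [e7, cutCoord_apply]; ring

theorem locW_eq (R : ℝ) {b' : ℝ → ℝ} (hb' : Continuous b') (hbb' : ∀ t, 0 ≤ t → b' t = b t) {t : ℝ}
    (ht : 0 ≤ t) :
    S.locW R t = S.locW R 0 + ∑ j, mulL2 (cutRadialFreq R j) (S.intGradHat t j) -
      mulL2 (cutRadial R) (∫ s in (0 : ℝ)..t, (b' s : ℂ) • S.dtHat s) := by
  have hall : ∀ᵐ ξ, ∀ j, mulL2 (cutRadialFreq R j) (S.intGradHat t j) ξ =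
      cutRadialFreq R j ξ * S.intGradHat t j ξ := ae_all_iff.2 fun j => coeFn_mulL2 _ _
  refine Lp.ext ?_
  filter_upwards [hall, coeFn_mulL2 (cutRadial R) (S.dtHat t), coeFn_mulL2 (cutRadial R) (S.dtHat 0),
    coeFn_mulL2 (cutRadial R) (∫ s in (0 : ℝ)..t, (b' s : ℂ) • S.dtHat s),
    Lp.coeFn_sub (S.locW R 0 + ∑ j, mulL2 (cutRadialFreq R j) (S.intGradHat t j))
      (mulL2 (cutRadial R) (∫ s in (0 : ℝ)..t, (b' s : ℂ) • S.dtHat s)),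
    Lp.coeFn_add (S.locW R 0) (∑ j, mulL2 (cutRadialFreq R j) (S.intGradHat t j)),
    Lp.coeFn_finsetSum Finset.univ fun j => mulL2 (cutRadialFreq R j) (S.intGradHat t j),
    S.dtHat_ae_eq hb' hbb' ht] with ξ e1 e2 e3 e4 e5 e6 e7 e8
  rw [e5, Pi.sub_apply, e6, Pi.add_apply, e7, locW, e2, locW, e3, e4, e8, Finset.sum_apply,
    Finset.sum_congr rfl fun j _ => e1 j]
  simp only [cutRadial_apply, cutRadialFreq_apply, mul_sub, mul_add, Finset.mul_sum]
  congr 2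
  refine Finset.sum_congr rfl fun j _ => ?_
  ring

theorem hasDerivAt_mulL2_right (f : Mult d) {z : ℝ → L2 d} {z' : L2 d} {s : ℝ}
    (h : HasDerivAt z z' s) : HasDerivAt (fun s => mulL2 f (z s)) (mulL2 f z') s :=
  (mulL2 f).hasFDerivAt.comp_hasDerivAt s h

theorem neg_truncSymbol_locU (R s : ℝ) : -mulL2 (truncSymbol R) (S.locU R s) =
    ∑ j, mulL2 (cutRadialFreq R j) (S.gradHat s j) := by
  rw [locU, map_sum, ← Finset.sum_neg_distrib]
  refine Finset.sum_congr rfl fun j _ => ?_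
  rw [mulL2_mulL2, ← neg_truncSymbol_mul_cutCoord, map_neg, neg_apply]

theorem smul_locW (R c s : ℝ) : c • S.locW R s = mulL2 (cutRadial R) ((c : ℂ) • S.dtHat s) := by
  rw [locW, Complex.coe_smul, map_smul]

theorem hasDerivAt_locW_formula (R : ℝ) {b' : ℝ → ℝ} (hb' : Continuous b') (s : ℝ) :
    HasDerivAt (fun s => S.locW R 0 + ∑ j, mulL2 (cutRadialFreq R j) (S.intGradHat s j) -
      mulL2 (cutRadial R) (∫ r in (0 : ℝ)..s, (b' r : ℂ) • S.dtHat r))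
      (-mulL2 (truncSymbol R) (S.locU R s) - b' s • S.locW R s) s := by
  have hbd : Continuous fun s => (b' s : ℂ) • S.dtHat s :=
    (Complex.continuous_ofReal.comp hb').smul S.continuous_dtHat
  rw [neg_truncSymbol_locU, smul_locW]
  have h1 : HasDerivAt (fun s => ∑ j, mulL2 (cutRadialFreq R j) (S.intGradHat s j))
      (∑ j, mulL2 (cutRadialFreq R j) (S.gradHat s j)) s :=
    HasDerivAt.fun_sum fun j _ => hasDerivAt_mulL2_right _ (S.hasDerivAt_intGradHat j s)
  exact (h1.const_add _).sub
    (hasDerivAt_mulL2_right _ (hbd.integral_hasStrictDerivAt 0 s).hasDerivAt)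

/-- The integral formulas for `locU` and `locW` extend these curves to negative times so that they are
differentiable also at the end point `0`. -/
theorem exists_hasDerivAt_loc (R : ℝ) {b' : ℝ → ℝ} (hb' : Continuous b')
    (hbb' : ∀ t, 0 ≤ t → b' t = b t) (t : ℝ) :
    ∃ U W : ℝ → L2 d, (∀ s, 0 ≤ s → U s = S.locU R s) ∧ (∀ s, 0 ≤ s → W s = S.locW R s) ∧
      (∀ s ∈ Icc 0 t, HasDerivAt U (W s) s) ∧
      ∀ s ∈ Icc 0 t, HasDerivAt W (-mulL2 (truncSymbol R) (U s) - b' s • W s) s := by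
  refine ⟨fun s => S.locU R 0 + mulL2 (cutRadial R) (S.intDtHat s),
    fun s => S.locW R 0 + ∑ j, mulL2 (cutRadialFreq R j) (S.intGradHat s j) -
      mulL2 (cutRadial R) (∫ r in (0 : ℝ)..s, (b' r : ℂ) • S.dtHat r),
    fun s hs => (S.locU_eq R hs).symm, fun s hs => (S.locW_eq R hb' hbb' hs).symm,
    fun s hs => ?_, fun s hs => ?_⟩
  · beta_reduce
    rw [← S.locW_eq R hb' hbb' hs.1]
    exact (hasDerivAt_mulL2_right _ (S.hasDerivAt_intDtHat s)).const_add _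
  · have h := S.hasDerivAt_locW_formula R hb' s
    beta_reduce
    rw [← S.locU_eq R hs.1, ← S.locW_eq R hb' hbb' hs.1]
    exact h

set_option maxHeartbeats 1000000 in
/-- The localized curve is given by the solution operators of the wave equation with a bounded
symbol, by uniqueness for linear equations in `L²`. -/
theorem loc_eq (R : ℝ) {b' : ℝ → ℝ} (hb' : Continuous b') (hbb' : ∀ t, 0 ≤ t → b' t = b t) {t : ℝ}
    (ht : 0 ≤ t) {x x₁ y y₁ : ℝ → Mult d} (hx0 : x 0 = 1) (hx₁0 : x₁ 0 = 0) (hy0 : y 0 = 0)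
    (hy₁0 : y₁ 0 = 1)
    (hx : ∀ s ∈ Icc 0 t, HasDerivAt x (x₁ s) s)
    (hx₁ : ∀ s ∈ Icc 0 t, HasDerivAt x₁ (-(truncSymbol (d := d) R * x s) - b' s • x₁ s) s)
    (hy : ∀ s ∈ Icc 0 t, HasDerivAt y (y₁ s) s)
    (hy₁ : ∀ s ∈ Icc 0 t, HasDerivAt y₁ (-(truncSymbol (d := d) R * y s) - b' s • y₁ s) s) :
    S.locU R t = mulL2 (x t) (S.locU R 0) + mulL2 (y t) (S.locW R 0) ∧
      S.locW R t = mulL2 (x₁ t) (S.locU R 0) + mulL2 (y₁ t) (S.locW R 0) := by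
  obtain ⟨U, W, eU, eW, dU, dW⟩ := S.exists_hasDerivAt_loc R hb' hbb' t
  have key := eq_action_of_hasDerivAt_wave (mulL2 (d := d)) mulL2_mulL2
    mulL2_one (truncSymbol R) hb' ht hx0 hx₁0
    hy0 hy₁0 hx hx₁ hy hy₁ dU dW
  rwa [eU t ht, eU 0 le_rfl, eW t ht, eW 0 le_rfl] at key

theorem coeFn_locU {g : EuclideanSpace ℝ (Fin d) → ℂ} (hg : HasFourierDensity (S.u 0) g)
    (R : ℝ) {t : ℝ} (ht : 0 ≤ t) :
    ∀ᵐ ξ, S.locU R t ξ = cutRadial R ξ * (g ξ + S.intDtHat t ξ) := by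
  have hall : ∀ᵐ ξ, ∀ j, mulL2 (cutCoord R j) (S.gradHat t j) ξ =
      cutCoord R j ξ * S.gradHat t j ξ := ae_all_iff.2 fun j => coeFn_mulL2 _ _
  filter_upwards [hall, Lp.coeFn_finsetSum Finset.univ fun j => mulL2 (cutCoord R j) (S.gradHat t j),
    ae_all_iff.2 fun j => S.gradHat_ae_eq ht j,
    ae_all_iff.2 fun j => S.gradHat_zero_ae_eq hg j] with ξ e1 e2 e3 e4
  rw [locU, e2, Finset.sum_apply, Finset.sum_congr rfl fun j _ => e1 j, cutRadial_apply,
    ← sum_coord_mul_freq, Finset.sum_mul, Finset.sum_mul]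
  refine Finset.sum_congr rfl fun j _ => ?_
  rw [e3, e4, cutCoord_apply]; ring

/-- Almost every frequency of a solution evolves by the scalar equation. -/
theorem ae_exists_mode [NeZero d] {g : EuclideanSpace ℝ (Fin d) → ℂ}
    (hg : HasFourierDensity (S.u 0) g) {b' : ℝ → ℝ} (hb' : Continuous b')
    (hbb' : ∀ t, 0 ≤ t → b' t = b t) {t : ℝ} (ht : 0 ≤ t) :
    ∀ᵐ ξ, 0 < ‖ξ‖ ∧ ∃ v v₁ : ℝ → ℂ, (∀ s ∈ Icc 0 t, HasDerivAt v (v₁ s) s) ∧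
      (∀ s ∈ Icc 0 t, HasDerivAt v₁
        (-((((2 * Real.pi * ‖ξ‖) ^ 2 : ℝ) : ℂ) * v s) - (b' s : ℂ) * v₁ s) s) ∧
      v 0 = g ξ ∧ v₁ 0 = S.dtHat 0 ξ ∧ v t = g ξ + S.intDtHat t ξ ∧ v₁ t = S.dtHat t ξ := by
  have key : ∀ n : ℕ, ∀ᵐ ξ, 2 * Real.pi * ‖ξ‖ < n → 0 < ‖ξ‖ →
      ∃ v v₁ : ℝ → ℂ, (∀ s ∈ Icc 0 t, HasDerivAt v (v₁ s) s) ∧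
      (∀ s ∈ Icc 0 t, HasDerivAt v₁
        (-((((2 * Real.pi * ‖ξ‖) ^ 2 : ℝ) : ℂ) * v s) - (b' s : ℂ) * v₁ s) s) ∧
      v 0 = g ξ ∧ v₁ 0 = S.dtHat 0 ξ ∧ v t = g ξ + S.intDtHat t ξ ∧ v₁ t = S.dtHat t ξ := by
    intro n
    have hM : ∀ z : Mult d, ContinuousLinearMap.mul ℝ (Mult d) (truncSymbol (n : ℝ)) z =
      truncSymbol (n : ℝ) * z := fun z => rfl
    obtain ⟨x, x₁, hx0, hx₁0, hx, hx₁⟩ := exists_hasDerivAt_wave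
      (ContinuousLinearMap.mul ℝ (Mult d) (truncSymbol (n : ℝ))) hb' 1 0 ht
    obtain ⟨y, y₁, hy0, hy₁0, hy, hy₁⟩ := exists_hasDerivAt_wave
      (ContinuousLinearMap.mul ℝ (Mult d) (truncSymbol (n : ℝ))) hb' 0 1 ht
    simp only [hM] at hx₁ hy₁
    obtain ⟨k1, k2⟩ := S.loc_eq n hb' hbb' ht hx0 hx₁0 hy0 hy₁0 hx hx₁ hy hy₁
    have hev : ∀ (z : ℝ → Mult d) (z' : Mult d) (s : ℝ) (ξ : EuclideanSpace ℝ (Fin d)),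
        HasDerivAt z z' s → HasDerivAt (fun s => z s ξ) (z' ξ) s := fun z z' s ξ h =>
      (BoundedContinuousFunction.evalCLM ℝ (β := ℂ) ξ).hasFDerivAt.comp_hasDerivAt s h
    filter_upwards [S.coeFn_locU hg n ht, S.coeFn_locU hg n le_rfl,
      coeFn_mulL2 (cutRadial (n : ℝ)) (S.dtHat t), coeFn_mulL2 (cutRadial (n : ℝ)) (S.dtHat 0),
      Lp.coeFn_add (mulL2 (x t) (S.locU n 0)) (mulL2 (y t) (S.locW n 0)),
      Lp.coeFn_add (mulL2 (x₁ t) (S.locU n 0)) (mulL2 (y₁ t) (S.locW n 0)),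
      coeFn_mulL2 (x t) (S.locU n 0), coeFn_mulL2 (y t) (S.locW n 0),
      coeFn_mulL2 (x₁ t) (S.locU n 0), coeFn_mulL2 (y₁ t) (S.locW n 0),
      Lp.coeFn_zero ℂ 2 (volume : Measure (EuclideanSpace ℝ (Fin d)))]
      with ξ a1 a2 a3 a4 a5 a6 a7 a8 a9 a10 a11 hξ hξ0
    have hc := cutRadial_ne_zero (norm_pos_iff.1 hξ0) hξ
    have hi : S.intDtHat 0 ξ = 0 := by
      rw [intDtHat, intervalIntegral.integral_same, a11, Pi.zero_apply]
    rw [hi, add_zero] at a2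
    rw [k1, a5, Pi.add_apply, a7, a8, a2, locW, a4] at a1
    have a3' : S.locW n t ξ = cutRadial (n : ℝ) ξ * S.dtHat t ξ := a3
    rw [k2, a6, Pi.add_apply, a9, a10, a2, locW, a4] at a3'
    refine ⟨fun s => x s ξ * g ξ + y s ξ * S.dtHat 0 ξ,
      fun s => x₁ s ξ * g ξ + y₁ s ξ * S.dtHat 0 ξ, fun s hs => ?_, fun s hs => ?_, ?_, ?_, ?_, ?_⟩
    · exact ((hev _ _ _ ξ (hx s hs)).mul_const _).add ((hev _ _ _ ξ (hy s hs)).mul_const _)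
    · refine (((hev _ _ _ ξ (hx₁ s hs)).mul_const _).add
        ((hev _ _ _ ξ (hy₁ s hs)).mul_const _)).congr_deriv ?_
      simp only [BoundedContinuousFunction.sub_apply, BoundedContinuousFunction.neg_apply,
        BoundedContinuousFunction.mul_apply, BoundedContinuousFunction.smul_apply,
        truncSymbol_apply hξ.le, Complex.real_smul]
      ring
    · simp [hx0, hy0]
    · simp [hx₁0, hy₁0]
    · refine mul_left_cancel₀ hc ?_
      rw [← a1]; ring
    · refine mul_left_cancel₀ hc ?_
      rw [← a3']; ring
  have hne : ∀ᵐ ξ : EuclideanSpace ℝ (Fin d), ξ ≠ 0 := by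
    rw [ae_iff]; simp
  filter_upwards [ae_all_iff.2 key, hne] with ξ h h0
  obtain ⟨n, hn⟩ := exists_nat_gt (2 * Real.pi * ‖ξ‖)
  exact ⟨norm_pos_iff.2 h0, h n hn (norm_pos_iff.2 h0)⟩

end FiniteEnergySolution

/-! ### The energy estimate in `L²` -/

section NormSq

variable {d : ℕ}

theorem integrable_norm_sq_L2 (f : L2 d) : Integrable fun ξ => ‖f ξ‖ ^ 2 :=
  (memLp_two_iff_integrable_sq_norm (Lp.memLp f).1).1 (Lp.memLp f)

theorem norm_sq_L2 (f : L2 d) : ‖f‖ ^ 2 = ∫ ξ, ‖f ξ‖ ^ 2 := by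
  have h := congrArg Complex.re (L2.inner_def (𝕜 := ℂ) f f)
  have e : ∀ ξ, inner ℂ (f ξ) (f ξ) = ((‖f ξ‖ ^ 2 : ℝ) : ℂ) := fun ξ => by
    rw [inner_self_eq_norm_sq_to_K]; simp
  simp only [e] at h
  rw [integral_complex_ofReal, Complex.ofReal_re, inner_self_eq_norm_sq_to_K] at h
  rw [← h]
  norm_cast

theorem toReal_eLpNorm_sq {f : EuclideanSpace ℝ (Fin d) → ℂ} (hf : MemLp f 2 volume) :
    Integrable (fun ξ => ‖f ξ‖ ^ 2) ∧ (eLpNorm f 2 volume).toReal ^ 2 = ∫ ξ, ‖f ξ‖ ^ 2 := by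
  refine ⟨(memLp_two_iff_integrable_sq_norm hf.1).1 hf, ?_⟩
  rw [← Lp.norm_toLp f hf, norm_sq_L2]
  refine integral_congr_ae ?_
  filter_upwards [hf.coeFn_toLp] with ξ h
  rw [h]

end NormSq

/-- Real and imaginary parts of a complex mode are modes. -/
theorem Damping.isMode_re_im {D : Damping} {l t : ℝ} {v v₁ : ℝ → ℂ}
    (hv : ∀ s ∈ Icc 0 t, HasDerivAt v (v₁ s) s)
    (hv₁ : ∀ s ∈ Icc 0 t, HasDerivAt v₁ (-(((l ^ 2 : ℝ) : ℂ) * v s) - (D.b s : ℂ) * v₁ s) s) :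
    D.IsMode l 0 t (fun s => (v s).re) (fun s => (v₁ s).re) ∧
      D.IsMode l 0 t (fun s => (v s).im) (fun s => (v₁ s).im) := by
  have hre : ∀ {z : ℝ → ℂ} {z' : ℂ} {s : ℝ}, HasDerivAt z z' s →
      HasDerivAt (fun s => (z s).re) z'.re s := fun h =>
    Complex.reCLM.hasFDerivAt.comp_hasDerivAt _ h
  have him : ∀ {z : ℝ → ℂ} {z' : ℂ} {s : ℝ}, HasDerivAt z z' s →
      HasDerivAt (fun s => (z s).im) z'.im s := fun h =>
    Complex.imCLM.hasFDerivAt.comp_hasDerivAt _ h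
  refine ⟨⟨fun s hs => hre (hv s hs), fun s hs => ?_⟩, fun s hs => him (hv s hs), fun s hs => ?_⟩
  · simpa only [Complex.sub_re, Complex.neg_re, Complex.re_ofReal_mul] using hre (hv₁ s hs)
  · simpa only [Complex.sub_im, Complex.neg_im, Complex.im_ofReal_mul] using him (hv₁ s hs)

/-- The energy estimate for solutions, by integration of the estimate for single frequencies. -/
theorem Damping.exists_energy_le_of_solution (D : Damping) {p ε : ℝ} (hp : 0 < p) (hp1 : p ≤ 1)
    (hpm : 2 * p ≤ D.m) (hε : 0 < ε) (d : ℕ) [NeZero d] :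
    ∃ C : ℝ, 0 < C ∧ ∀ (b : ℝ → ℝ) (S : FiniteEnergySolution d b), (∀ t, 0 ≤ t → D.b t = b t) →
      MemHomSobolev (1 - p) (S.u 0) → ∀ t μ : ℝ, 0 ≤ t → 0 ≤ μ →
      (∀ τ ∈ Icc 0 t, 1 / (1 + τ) ≤ μ * D.η₂ τ) →
      S.energy t ≤ C * ((1 + t) ^ (-(2 * p)) + Real.exp (ε * μ) * (1 + t) ^ (-D.m)) *
        (S.energy 0 + homSobolevNorm (1 - p) (S.u 0) ^ 2) := by
  obtain ⟨C, hC, key⟩ := D.exists_energy_le hp hp1 hpm hε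
  refine ⟨C, hC, fun b S hb hu t μ ht hμ hη => ?_⟩
  obtain ⟨g, hg'⟩ := iInf_lt_iff.1 (show homSobolevENorm (1 - p) (S.u 0) < ∞ from hu)
  obtain ⟨hg, hlt⟩ := iInf_lt_iff.1 hg'
  set h : EuclideanSpace ℝ (Fin d) → ℂ := fun ξ => (((2 * Real.pi * ‖ξ‖) ^ (1 - p) : ℝ) : ℂ) * g ξ
    with hh
  have hmem : MemLp h 2 volume := by
    refine ⟨?_, hlt⟩
    refine AEStronglyMeasurable.mul ?_ hg.1.aestronglyMeasurable
    exact (by fun_prop : Measurable fun ξ : EuclideanSpace ℝ (Fin d) =>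
      (((2 * Real.pi * ‖ξ‖) ^ (1 - p) : ℝ) : ℂ)).aestronglyMeasurable
  obtain ⟨hi, he⟩ := toReal_eLpNorm_sq hmem
  have hsob : homSobolevNorm (1 - p) (S.u 0) ^ 2 = ∫ ξ, ‖h ξ‖ ^ 2 := by
    rw [homSobolevNorm, homSobolevENorm_eq (1 - p) hg, ← he]
  have hint : ∀ s, Integrable fun ξ => ∑ j, ‖S.gradHat s j ξ‖ ^ 2 + ‖S.dtHat s ξ‖ ^ 2 := fun s =>
    (integrable_finsetSum _ fun j _ => integrable_norm_sq_L2 _).add (integrable_norm_sq_L2 _)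
  have hen : ∀ s, 0 ≤ s →
      S.energy s = ∫ ξ, ∑ j, ‖S.gradHat s j ξ‖ ^ 2 + ‖S.dtHat s ξ‖ ^ 2 := fun s hs => by
    rw [integral_add (integrable_finsetSum _ fun j _ => integrable_norm_sq_L2 _)
      (integrable_norm_sq_L2 _), integral_finsetSum _ fun j _ => integrable_norm_sq_L2 _,
      S.energy_eq hs, norm_sq_L2, Finset.sum_congr rfl fun j _ => norm_sq_L2 (S.gradHat s j)]
  set A := C * ((1 + t) ^ (-(2 * p)) + Real.exp (ε * μ) * (1 + t) ^ (-D.m)) with hA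
  rw [hen t ht, hen 0 le_rfl, hsob, ← integral_add (hint 0) hi, ← integral_const_mul]
  refine integral_mono_ae (hint t) (((hint 0).add hi).const_mul A) ?_
  filter_upwards [S.ae_exists_mode hg D.continuous_b hb ht,
    ae_all_iff.2 fun j => S.gradHat_ae_eq ht j,
    ae_all_iff.2 fun j => S.gradHat_zero_ae_eq hg j] with ξ ⟨hξ, v, v₁, hv, hv₁, e1, e2, e3, e4⟩ e5 e6
  set l : ℝ := 2 * Real.pi * ‖ξ‖ with hl
  have hl0 : 0 < l := by positivity
  obtain ⟨hre, him⟩ := Damping.isMode_re_im (D := D) hv hv₁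
  have k1 := key l t μ _ _ hl0 ht hμ hη hre
  have k2 := key l t μ _ _ hl0 ht hμ hη him
  have nsq : ∀ z : ℂ, ‖z‖ ^ 2 = z.re ^ 2 + z.im ^ 2 := fun z => by
    rw [Complex.sq_norm, Complex.normSq_apply]; ring
  have s1 : ∑ j, ‖S.gradHat t j ξ‖ ^ 2 = l ^ 2 * ‖v t‖ ^ 2 := by
    rw [hl, ← sum_norm_freq_sq, Finset.sum_mul]
    refine Finset.sum_congr rfl fun j _ => ?_
    rw [e5, e6, ← mul_add, ← e3, norm_mul, mul_pow]
  have s2 : ∑ j, ‖S.gradHat 0 j ξ‖ ^ 2 = l ^ 2 * ‖v 0‖ ^ 2 := by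
    rw [hl, ← sum_norm_freq_sq, Finset.sum_mul]
    refine Finset.sum_congr rfl fun j _ => ?_
    rw [e6, ← e1, norm_mul, mul_pow]
  have s3 : ‖h ξ‖ ^ 2 = l ^ (2 - 2 * p) * ‖v 0‖ ^ 2 := by
    rw [hh, norm_mul, mul_pow, Complex.norm_real, Real.norm_of_nonneg (by positivity), ← e1,
      ← Real.rpow_mul_natCast hl0.le]
    congr 2
    push_cast; ring
  beta_reduce
  rw [s1, s2, s3, ← e4, ← e2, nsq, nsq, nsq, nsq]
  calc _ = (l ^ 2 * (v t).re ^ 2 + (v₁ t).re ^ 2) + (l ^ 2 * (v t).im ^ 2 + (v₁ t).im ^ 2) := by ring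
    _ ≤ _ := add_le_add k1 k2
    _ = _ := by rw [hA]; ring

/-! ### Extension of the phase to the whole line -/

/-- A function on `[0, ∞)` is extended by means of an extension of its derivative. -/
theorem exists_hasDerivAt_extension {f F' : ℝ → ℝ} (hF' : Continuous F')
    (hf : ∀ t, 0 ≤ t → HasDerivWithinAt f (F' t) (Ici 0) t) :
    ∃ F : ℝ → ℝ, (∀ t, HasDerivAt F (F' t) t) ∧ ∀ t, 0 ≤ t → F t = f t := by
  refine ⟨fun t => f 0 + ∫ s in (0 : ℝ)..t, F' s,
    fun t => (hF'.integral_hasStrictDerivAt 0 t).hasDerivAt.const_add _, fun t ht => ?_⟩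
  have h := intervalIntegral.integral_eq_sub_of_hasDeriv_right_of_le ht
    (f := f) (f' := F') (fun s hs => (hf s hs.1).continuousWithinAt.mono fun r hr => hr.1)
    (fun s hs => (hf s hs.1.le).mono fun r hr => (hs.1.trans hr).le) (hF'.intervalIntegrable _ _)
  beta_reduce
  rw [h]; ring

/-- A phase of class `C²` on `[0, ∞)` has an extension that is twice differentiable on the whole
line. -/
theorem exists_phase_extension {η : ℝ → ℝ} (hη : ContDiffOn ℝ 2 η (Ici 0)) :
    ContinuousOn (deriv₂ η) (Ici 0) ∧ ∃ F F₁ F₂ : ℝ → ℝ, (∀ t, HasDerivAt F (F₁ t) t) ∧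
      (∀ t, HasDerivAt F₁ (F₂ t) t) ∧ ∀ t, 0 ≤ t → F t = η t ∧ F₁ t = deriv₁ η t ∧
        F₂ t = deriv₂ η t := by
  have hu : UniqueDiffOn ℝ (Ici (0 : ℝ)) := uniqueDiffOn_Ici 0
  have h1 : ContDiffOn ℝ 1 (deriv₁ η) (Ici 0) := hη.derivWithin hu (by norm_num)
  have h2 : ContinuousOn (deriv₂ η) (Ici 0) := h1.continuousOn_derivWithin hu le_rfl
  have hc : Continuous fun t => deriv₂ η (max t 0) :=
    h2.comp_continuous (by fun_prop) fun t => le_max_right t 0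
  obtain ⟨F₁, a1, a2⟩ := exists_hasDerivAt_extension hc (f := deriv₁ η) fun t ht => by
    rw [max_eq_left ht]
    exact ((h1.differentiableOn (by norm_num)) t ht).hasDerivWithinAt
  obtain ⟨F, b1, b2⟩ := exists_hasDerivAt_extension
    (continuous_iff_continuousAt.2 fun t => (a1 t).continuousAt) (f := η) fun t ht => by
    rw [a2 t ht]
    exact ((hη.differentiableOn (by norm_num)) t ht).hasDerivWithinAt
  exact ⟨h2, F, F₁, _, b1, a1, fun t ht => ⟨b2 t ht, a2 t ht, by rw [max_eq_left ht]⟩⟩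

theorem one_div_le_oscillationRate_mul {η : ℝ → ℝ} (hη : ContinuousOn (deriv₂ η) (Ici 0))
    (hpos : ∀ t, 0 ≤ t → 0 < deriv₂ η t) {t : ℝ} (ht : 0 ≤ t) :
    0 ≤ oscillationRate η t ∧
      ∀ τ ∈ Icc 0 t, 1 / (1 + τ) ≤ oscillationRate η t * deriv₂ η τ := by
  have hc : ContinuousOn (fun τ => 1 / ((1 + τ) * deriv₂ η τ)) (Icc 0 t) := by
    refine continuousOn_const.div (ContinuousOn.mul (by fun_prop)
      (hη.mono Icc_subset_Ici_self)) fun τ hτ => ?_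
    have := hpos τ hτ.1
    have := hτ.1
    positivity
  have hle : ∀ τ ∈ Icc 0 t, 1 / ((1 + τ) * deriv₂ η τ) ≤ oscillationRate η t := fun τ hτ =>
    le_csSup (isCompact_Icc.image_of_continuousOn hc).bddAbove ⟨τ, hτ, rfl⟩
  refine ⟨le_trans ?_ (hle 0 ⟨le_rfl, ht⟩), fun τ hτ => ?_⟩
  · have := hpos 0 le_rfl
    positivity
  · have h1 := hpos τ hτ.1
    have h2 := hle τ hτ
    have h3 : 0 < 1 + τ := by linarith [hτ.1]
    calc 1 / (1 + τ) = 1 / ((1 + τ) * deriv₂ η τ) * deriv₂ η τ := by field_simp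
      _ ≤ _ := by gcongr

end DissipativeWave

theorem mainTheorem1
    (d : ℕ) (hd : 0 < d)
    (σ₀ : ℝ → ℝ) (T : ℝ) (hT : 0 < T) (hper : Function.Periodic σ₀ (2 * T))
    (K α : ℝ≥0) (hα : 1 / 2 < α) (hHolder : HolderWith K α σ₀)
    (η : ℝ → ℝ) (hη : ContDiffOn ℝ 2 η (Ici 0)) (hη₀ : 0 ≤ η 0)
    (hη₁ : ∀ t, 0 ≤ t → 0 < DissipativeWave.deriv₁ η t)
    (hη₂ : ∀ t, 0 ≤ t → 0 < DissipativeWave.deriv₂ η t)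
    (m : ℝ) (hm : m = DissipativeWave.periodMean T σ₀)
    (ε : ℝ) (hε : 0 < ε)
    (m' : ℝ) (hm'₀ : 0 < m')
    (hm' : ((∀ x, 0 ≤ σ₀ x) ∧ m' ≤ min 2 m) ∨ ((0 < m ∧ m < 1) ∧ m' ≤ m)) :
    ∃ C : ℝ, 0 < C ∧
      ∀ S : DissipativeWave.FiniteEnergySolution d (fun t => σ₀ (η t) / (1 + t)),
        DissipativeWave.MemHomSobolev (1 - m' / 2) (S.u 0) →
        ∀ t : ℝ, 0 ≤ t →
          S.energy t ≤
            C * (1 + Real.exp (ε * DissipativeWave.oscillationRate η t) / (1 + t) ^ (m - m')) *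
              (1 + t) ^ (-m') *
              (S.energy 0 + DissipativeWave.homSobolevNorm (1 - m' / 2) (S.u 0) ^ 2) := by
  have : NeZero d := ⟨hd.ne'⟩
  obtain ⟨hc, F, F₁, F₂, hF, hF₁, hFη⟩ := DissipativeWave.exists_phase_extension hη
  have hbound : m' ≤ 2 ∧ m' ≤ m := by
    rcases hm' with ⟨-, h⟩ | ⟨⟨-, h1⟩, h2⟩
    · exact le_min_iff.1 h
    · exact ⟨by linarith, h2⟩
  let D : DissipativeWave.Damping :=
    { σ := σ₀, T := T, T_pos := hT, periodic := hper, K := K, α := α, half_lt := hα,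
      holder := hHolder, η := F, η₁ := F₁, η₂ := F₂, hasDerivAt_η := hF, hasDerivAt_η₁ := hF₁
      η₁_pos := fun t ht => by rw [(hFη t ht).2.1]; exact hη₁ t ht
      η₂_pos := fun t ht => by rw [(hFη t ht).2.2]; exact hη₂ t ht }
  have hDm : D.m = m := hm.symm
  obtain ⟨C, hC, key⟩ := D.exists_energy_le_of_solution (p := m' / 2) (ε := ε) (by linarith)
    (by linarith) (by rw [hDm]; linarith) hε d
  refine ⟨C, hC, fun S hS t ht => ?_⟩
  obtain ⟨hμ, hμ'⟩ := DissipativeWave.one_div_le_oscillationRate_mul hc hη₂ ht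
  refine (key _ S (fun s hs => ?_) hS t _ ht hμ fun τ hτ => ?_).trans_eq ?_
  · rw [D.b_of_nonneg hs]
    exact congrArg (fun x => σ₀ x / (1 + s)) (hFη s hs).1
  · exact (hμ' τ hτ).trans_eq (by rw [← (hFη τ hτ.1).2.2])
  · have h1 : (0 : ℝ) < 1 + t := by linarith
    have h2 : (1 + t) ^ (-m) = (1 + t) ^ (-m') / (1 + t) ^ (m - m') := by
      rw [← Real.rpow_sub h1]; congr 1; ring
    rw [hDm, h2, show -(2 * (m' / 2)) = -m' by ring]
    ring
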